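/- Let $F_\varepsilon$ be an analytic (or $C^\infty$, or formal) family of area-preserving maps of the plane, defined in a neighbourhood of the origin, such that $F_0(0)=0$ and $DF_0(0)$ has the double eigenvalue $1$ and is not diagonalisable. Analytic and $C^\infty$ families are identified with their Taylor series in $(x,y,\varepsilon)$ at the origin. A canonical formal change of variables is a pair $\phi_\varepsilon$ of formal series in $(x,y,\varepsilon)$ with $\phi_0(0)=0$ and Jacobian determinant in $(x,y)$ equal to $1$ or to $-1$; $\Phi^1_h=(\exp(L_h)x,\exp(L_h)y)$, with $L_hg=g_xh_y-g_yh_x$, is the formal time-one map of $h$. For a series $U=\sum u_{km}x^k\varepsilon^m$ say that $\phi_\varepsilon$ brings $F_\varepsilon$ to $U$ if $F_\varepsilon=\phi_\varepsilon^{-1}\circ\Phi^1_{h_\varepsilon}\circ\phi_\varepsilon$ with $h_\varepsilon=\frac{y^2}{2}+U_\varepsilon(x)$. Then: (1) Some canonical formal change brings $F_\varepsilon$ to a series of the form $U_\varepsilon(x)=\sum_{k+3m\ge3}u_{km}x^k\varepsilon^m$. (2) Suppose that the canonical formal change $\phi_{\varepsilon}$ brings $F_\varepsilon$ to a series $U_\varepsilon=\sum_{k+3m\ge3}u_{km}x^k\varepsilon^m$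 such that, for some $n\ge3$, $u_{k0}=0$ for all $k<n$ and $b:=u_{n0}\ne0$. Then there is a canonical formal change $\theta_\varepsilon$, with $D\theta_0(0)$ the identity, such that $h_\varepsilon\circ\theta_\varepsilon=\frac{y^2}{2}+\tilde U_\varepsilon(x)+u_{01}\varepsilon$, where $$\tilde U_\varepsilon(x)=bx^n+\sum_{\substack{k+nm>n\\ k\not\equiv-1\bmod n}}\tilde u_{km}x^k\varepsilon^m ,\qquad(*)$$ and $\theta_\varepsilon^{-1}\circ\phi_\varepsilon$ brings $F_\varepsilon$ to $\tilde U_\varepsilon$. (3) The coefficients are unique in the following sense. (The coefficients with $k=0$ do not influence $\Phi^1_{h_\varepsilon}$ and are disregarded.) Suppose that canonical formal changes $\phi_1,\phi_2$ bring $F_\varepsilon$ to series $U_1,U_2$ of the form $(*)$, with $n_1,b_1$ and $n_2,b_2$ in place of $n,b$ ($n_i\ge 3$, $b_i\neq 0$) and with coefficients $u^{(1)}_{km},u^{(2)}_{km}$. Then $n_1=n_2$, and there is $s\in\{1,-1\}$ with $u^{(2)}_{km}=s^ku^{(1)}_{km}$ for all $k\ge1$, $m\ge0$; that is, the coefficients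 are unique up to the symmetry $(x,y)\mapsto(-x,-y)$. If $\phi_1$ and $\phi_2$ have the same linear part in $(x,y)$ at the origin for $\varepsilon=0$, then $u^{(2)}_{km}=u^{(1)}_{km}$ for all $k\ge1$, $m\ge0$. (4) The coefficients with $k\ge1$ form a complete set of formal invariants. Let $F_\varepsilon,G_\varepsilon$ be two families as above, brought to series $U_1,U_2$ of the form $(*)$ (with $n_1,b_1$ and $n_2,b_2$) by canonical formal changes $\phi_1,\phi_2$. Then $F_\varepsilon=\theta_\varepsilon^{-1}\circ G_\varepsilon\circ\theta_\varepsilon$ for some canonical formal change $\theta_\varepsilon$ if and only if there is $s\in\{1,-1\}$ with $u^{(2)}_{km}=s^ku^{(1)}_{km}$ for all $k\ge1$, $m\ge0$. If $\phi_1$ and $\phi_2$ have the same linear part in $(x,y)$ at the origin for $\varepsilon=0$, then such a $\theta_\varepsilon$ with $D\theta_0(0)$ the identity exists if and only if $u^{(2)}_{km}=u^{(1)}_{km}$ for all $k\ge1$, $m\ge0$. -/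

import Mathlib

open scoped ContDiff

noncomputable section

namespace FormalNF

/-- Formal power series in `x = X 0`, `y = X 1`, `ε = X 2` with real coefficients. -/
abbrev Series := MvPowerSeries (Fin 3) ℝ

/-- A formal family of maps `(x, y) ↦ (F 0, F 1)` of the plane, depending on the parameter `ε`. -/
abbrev FormalMap := Fin 2 → Series

/-- The identity map of the plane. -/
def idMap : FormalMap := fun i => MvPowerSeries.X i.castSucc

/-- `g ∘ φ`: substitute `x ↦ φ 0`, `y ↦ φ 1`, `ε ↦ ε` into the series `g`. -/
def pullback (φ : FormalMap) (g : Series) : Series :=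
  MvPowerSeries.subst (![φ 0, φ 1, MvPowerSeries.X 2] : Fin 3 → Series) g

/-- The composition `G ∘ φ` of formal families of maps. -/
def comp (G φ : FormalMap) : FormalMap := fun i => pullback φ (G i)

/-- `F_0(0) = 0`. -/
def FixesOrigin (F : FormalMap) : Prop := ∀ i, MvPowerSeries.constantCoeff (F i) = 0

/-- The Jacobian matrix of `F_ε` with respect to `(x, y)`. -/
def jacobian (F : FormalMap) : Matrix (Fin 2) (Fin 2) Series :=
  Matrix.of fun i j => MvPowerSeries.pderiv ℝ j.castSucc (F i)

/-- The matrix `DF_0(0)`. -/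
def linearPart (F : FormalMap) : Matrix (Fin 2) (Fin 2) ℝ :=
  (jacobian F).map MvPowerSeries.constantCoeff

/-- The formal family preserves the area (it may reverse the orientation). -/
def AreaPreserving (F : FormalMap) : Prop := (jacobian F).det = 1 ∨ (jacobian F).det = -1

/-- A formal canonical change of variables, possibly reversing the orientation. -/
def IsCanonicalChange (φ : FormalMap) : Prop := FixesOrigin φ ∧ AreaPreserving φ

/-- `ψ` is the inverse of the formal map `φ`. -/
def IsInverse (φ ψ : FormalMap) : Prop :=
  FixesOrigin ψ ∧ comp φ ψ = idMap ∧ comp ψ φ = idMap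

/-- `F = φ⁻¹ ∘ G ∘ φ`. -/
def ConjugateBy (F φ G : FormalMap) : Prop :=
  ∃ ψ, IsInverse φ ψ ∧ F = comp ψ (comp G φ)

/-- The Poisson bracket `{f, g} = f_x g_y - f_y g_x`. -/
def poisson (f g : Series) : Series :=
  MvPowerSeries.pderiv ℝ 0 f * MvPowerSeries.pderiv ℝ 1 g -
    MvPowerSeries.pderiv ℝ 1 f * MvPowerSeries.pderiv ℝ 0 g

/-- The Lie derivative `L_χ g = {g, χ}`. -/
def lie (χ g : Series) : Series := poisson g χ

/-- `exp(L_χ) g = ∑_k L_χ^k g / k!`, summed coefficient by coefficient. The Hamiltonians to which it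
is applied below have order at least `6` when `x, y, ε` have the orders `2, 3, 6`, so that `L_χ`
raises the order and every coefficient is a finite sum. -/
def expLie (χ g : Series) : Series :=
  fun e => ∑ᶠ k : ℕ, MvPowerSeries.coeff e ((lie χ)^[k] g) / (k.factorial : ℝ)

/-- The time-one map `Φ_χ^1 = (exp(L_χ) x, exp(L_χ) y)`. -/
def timeOne (χ : Series) : FormalMap := fun i => expLie χ (MvPowerSeries.X i.castSucc)

/-- The series `U_ε(x) = ∑ u_{km} x^k ε^m`. -/
def potential (u : ℕ → ℕ → ℝ) : Series := fun e => if e 1 = 0 then u (e 0) (e 2) else 0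

/-- The Hamiltonian `h_ε(x, y) = y² / 2 + U_ε(x)`. -/
def hamiltonian (u : ℕ → ℕ → ℝ) : Series :=
  MvPowerSeries.C (1 / 2 : ℝ) * MvPowerSeries.X 1 ^ 2 + potential u

/-- `U_ε = ∑_{k + 3m ≥ 3} u_{km} x^k ε^m`. -/
def IsSimplified (u : ℕ → ℕ → ℝ) : Prop := ∀ k m, k + 3 * m < 3 → u k m = 0

/-- `U_ε = b x^n + ∑ u_{km} x^k ε^m`, the sum being over the pairs `(k, m)` with
`k + n m > n` and `k ≢ -1 mod n`, where `n ≥ 3` and `b ≠ 0`. -/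
structure IsNormalForm (n : ℕ) (b : ℝ) (u : ℕ → ℕ → ℝ) : Prop where
  three_le : 3 ≤ n
  ne_zero : b ≠ 0
  leading : u n 0 = b
  support : ∀ k m, (k, m) ≠ (n, 0) → ¬ (k + n * m > n ∧ ¬ (k : ℤ) ≡ -1 [ZMOD n]) → u k m = 0

/-- `∂g/∂p_i` for a function `g` of the point `p = (x, y, ε)`. -/
def partialD (i : Fin 3) (g : (Fin 3 → ℝ) → ℝ) : (Fin 3 → ℝ) → ℝ :=
  fun p => fderiv ℝ g p (Pi.single i 1)

/-- The Taylor series of `g` at the origin. -/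
def taylorSeries (g : (Fin 3 → ℝ) → ℝ) : Series := fun e =>
  ((partialD 0)^[e 0] ((partialD 1)^[e 1] ((partialD 2)^[e 2] g))) 0 /
    ((e 0).factorial * (e 1).factorial * (e 2).factorial : ℝ)

/-- `F` is the Taylor series of a `C^∞` (in particular, of an analytic) family
`f (x, y, ε) = F_ε (x, y)` of area-preserving maps defined in a neighbourhood of the origin. -/
def IsTaylorOfSmooth (F : FormalMap) : Prop :=
  ∃ (f : Fin 2 → (Fin 3 → ℝ) → ℝ) (V : Set (Fin 3 → ℝ)), IsOpen V ∧ 0 ∈ V ∧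
    (∀ i, ContDiffOn ℝ ∞ (f i) V) ∧
    (∀ p ∈ V, |(Matrix.of fun i j : Fin 2 => partialD j.castSucc (f i) p).det| = 1) ∧
    F = fun i => taylorSeries (f i)

/-- The real matrix `A` is diagonalisable. -/
def Diagonalisable (A : Matrix (Fin 2) (Fin 2) ℝ) : Prop :=
  ∃ (P : Matrix (Fin 2) (Fin 2) ℝ) (d : Fin 2 → ℝ),
    IsUnit P.det ∧ A = P * Matrix.diagonal d * P⁻¹

/-- `F` is an analytic, `C^∞` or formal family of area-preserving maps (the first two represented
by the Taylor series) with `F_0(0) = 0`, such that `DF_0(0)` has the double eigenvalue `1` and is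
not diagonalisable. -/
structure IsParabolicFamily (F : FormalMap) : Prop where
  areaPreserving : AreaPreserving F ∨ IsTaylorOfSmooth F
  fixesOrigin : FixesOrigin F
  eigenvalue : (linearPart F).charpoly = (Polynomial.X - Polynomial.C 1) ^ 2
  not_diagonalisable : ¬ Diagonalisable (linearPart F)

/-- The canonical change `φ` brings `F` to the time-one map of `y² / 2 + U_ε(x)`:
`F = φ⁻¹ ∘ Φ_h^1 ∘ φ` with `h = y² / 2 + U_ε(x)`. -/
def Normalises (φ : FormalMap) (F : FormalMap) (u : ℕ → ℕ → ℝ) : Prop :=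
  IsCanonicalChange φ ∧ ConjugateBy F φ (timeOne (hamiltonian u))

end FormalNF

end

open FormalNF

/-! Give `x, y, ε` the weights `2, n, 2n`. Then `y² / 2 + b x ^ n` and `ε` are homogeneous of weight
`2n`, and the Poisson bracket lowers weights by `n + 2`, so that `L_χ` raises the weight as soon as
`χ` has weight at least `n + 3`. For such `χ` the exponential `exp(L_χ)` is an algebra automorphism
which preserves the bracket and is the substitution of the time-one map (`expLie_mul`,
`expLie_poisson`, `pullback_timeOne`). Conversely, a map of Jacobian `1` that is tangent to the
identity in the weighted sense is a time-one map (`exists_timeOne_eq`), and its Hamiltonian is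
unique up to a series in `ε` (`eq_add_of_timeOne_eq`). By `conj_timeOne`, conjugating maps then
amounts to transforming Hamiltonians.

Existence: a linear change turns `DF_0(0)` into a Jordan block. In the weights `2, 3, 6` the map
becomes tangent to the identity, hence a time-one map, with Hamiltonian `y² / 2 + b x³ + a ε` plus
terms of higher weight. Simplifying it weight by weight (`exists_simplification`) means choosing `δ`
such that `g + {y² / 2 + b x ^ n, δ}` is simple, the bracket being `n b x ^ (n - 1) δ_y - y δ_x`.
The term `y δ_x` removes every monomial divisible by `y`, whatever `b` is (`exists_homological`). If
`b ≠ 0`, the other term also removes the powers `x ^ i` with `i ≡ -1 mod n` (`exists_homological'`).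

Uniqueness: let `θ` conjugate two normal forms. Its linear part commutes with the Jordan block and
has determinant `±1`, so up to the symmetry `(x, y) ↦ (-x, -y)` it is unipotent. Comparing the
coefficients of `x ^ k y` in the Hamiltonians shows that `θ` is tangent to the identity in the
weights `2, n, 2n` (`coeff_y_eq_zero`), so it is the time-one map of some `χ`. Because the two
normal forms lack the same monomials, the leading part of `χ` is that of a polynomial in `2h` and
`ε` (`kernel_homological`, `exists_first_integral`). The flow of this polynomial preserves `h`, so
it can be divided out. Iterating pushes `χ` to infinite order, and the Hamiltonians agree up to a
series in `ε`.

Completeness follows formally by composing normalising changes. Smooth families reduce to formal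
ones because Taylor expansion commutes with derivatives and products. -/

noncomputable section

namespace FormalNF

open MvPowerSeries

/-! ### Weighted filtrations -/

/-- The weight of the monomial with exponent `e` when `x, y, ε` have the weights `w 0, w 1, w 2`. -/
def wt (w : Fin 3 → ℕ) (e : Fin 3 →₀ ℕ) : ℕ := w 0 * e 0 + w 1 * e 1 + w 2 * e 2

theorem wt_add (w : Fin 3 → ℕ) (d e : Fin 3 →₀ ℕ) : wt w (d + e) = wt w d + wt w e := by
  simp only [wt, Finsupp.add_apply]; ring

theorem wt_single (w : Fin 3 → ℕ) (i : Fin 3) (k : ℕ) : wt w (Finsupp.single i k) = w i * k := by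
  fin_cases i <;> simp [wt]

/-- The ideal of the series all of whose monomials have weight at least `p`. -/
def filt (w : Fin 3 → ℕ) (p : ℕ) : Ideal Series where
  carrier := {g | ∀ e, wt w e < p → coeff e g = 0}
  add_mem' {f g} hf hg e he := by rw [map_add, hf e he, hg e he, add_zero]
  zero_mem' e _ := by simp
  smul_mem' c g hg e he := by
    classical
    rw [smul_eq_mul, coeff_mul]
    refine Finset.sum_eq_zero fun x hx => ?_
    rw [Finset.HasAntidiagonal.mem_antidiagonal] at hx
    rw [hg x.2, mul_zero]
    rw [← hx, wt_add] at he
    omega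

variable {w : Fin 3 → ℕ} {p q r : ℕ} {f g : Series}

theorem filt_anti (h : p ≤ q) (hg : g ∈ filt w q) : g ∈ filt w p :=
  fun e he => hg e (he.trans_le h)

theorem mem_filt_zero (g : Series) : g ∈ filt w 0 := fun _ he => absurd he (Nat.not_lt_zero _)

theorem mul_mem_filt (hf : f ∈ filt w p) (hg : g ∈ filt w q) : f * g ∈ filt w (p + q) := by
  classical
  intro e he
  rw [coeff_mul]
  refine Finset.sum_eq_zero fun x hx => ?_
  rw [Finset.HasAntidiagonal.mem_antidiagonal] at hx
  rw [← hx, wt_add] at he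
  rcases lt_or_ge (wt w x.1) p with h | h
  · rw [hf _ h, zero_mul]
  · rw [hg x.2 (by omega), mul_zero]

theorem pow_mem_filt (hf : f ∈ filt w p) (k : ℕ) : f ^ k ∈ filt w (p * k) := by
  induction k with
  | zero => exact mem_filt_zero _
  | succ k ih => rw [pow_succ, Nat.mul_succ]; exact mul_mem_filt ih hf

theorem smul_mem_filt (c : ℝ) (hg : g ∈ filt w p) : c • g ∈ filt w p :=
  Submodule.smul_of_tower_mem _ c hg

theorem monomial_mem_filt {e : Fin 3 →₀ ℕ} (h : p ≤ wt w e) (c : ℝ) :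
    monomial e c ∈ filt w p := by
  classical
  intro e' he'
  rw [coeff_monomial, if_neg]
  rintro rfl
  omega

theorem X_mem_filt (w : Fin 3 → ℕ) (i : Fin 3) : (X i : Series) ∈ filt w (w i) :=
  monomial_mem_filt (by rw [wt_single, mul_one]) 1

theorem pderiv_mem_filt (i : Fin 3) (hg : g ∈ filt w p) : pderiv ℝ i g ∈ filt w (p - w i) := by
  intro e he
  rw [coeff_pderiv, hg, zero_mul]
  rw [wt_add, wt_single]
  omega

theorem eq_zero_of_mem_filt (h : ∀ p, g ∈ filt w p) : g = 0 := by
  ext e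
  exact h (wt w e + 1) e (Nat.lt_succ_self _)

theorem coeff_eq_of_sub_mem (h : f - g ∈ filt w p) {e : Fin 3 →₀ ℕ} (he : wt w e < p) :
    coeff e f = coeff e g := by
  have := h e he
  rwa [map_sub, sub_eq_zero] at this

theorem sub_mem_trans {f₁ f₂ f₃ : Series} (h₁ : f₁ - f₂ ∈ filt w p) (h₂ : f₂ - f₃ ∈ filt w p) :
    f₁ - f₃ ∈ filt w p := by
  have := add_mem h₁ h₂
  rwa [sub_add_sub_cancel] at this

theorem mem_filt_of_sub_mem (h : f - g ∈ filt w p) (hg : g ∈ filt w p) : f ∈ filt w p := by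
  have := add_mem h hg
  rwa [sub_add_cancel] at this

theorem constantCoeff_eq_zero_of_mem_filt (hp : 0 < p) (hg : g ∈ filt w p) :
    constantCoeff g = 0 := by
  rw [← coeff_zero_eq_constantCoeff_apply]
  exact hg 0 (by simpa [wt] using hp)

theorem wt_ge_degree (hw : ∀ i, 1 ≤ w i) (e : Fin 3 →₀ ℕ) : e.degree ≤ wt w e := by
  rw [Finsupp.degree_eq_sum, Fin.sum_univ_three, wt]
  gcongr <;> exact Nat.le_mul_of_pos_left _ (hw _)

theorem sub_truncTotal_mem_filt (hw : ∀ i, 1 ≤ w i) (g : Series) (N : ℕ) :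
    g - (truncTotal N g : MvPolynomial (Fin 3) ℝ) ∈ filt w N := by
  intro e he
  rw [map_sub, MvPolynomial.coeff_coe, coeff_truncTotal, sub_self]
  exact (wt_ge_degree hw e).trans_lt he

/-- A linear map which is continuous for a weighted filtration and vanishes on the polynomials is
zero. -/
theorem eq_zero_of_polynomial (hw : ∀ i, 1 ≤ w i) (T : Series →ₗ[ℝ] Series) (c : ℕ)
    (hT : ∀ N g, g ∈ filt w (N + c) → T g ∈ filt w N)
    (hpoly : ∀ p : MvPolynomial (Fin 3) ℝ, T p = 0) (g : Series) : T g = 0 := by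
  refine eq_zero_of_mem_filt (w := w) fun N => ?_
  have := hT N _ (sub_truncTotal_mem_filt hw g (N + c))
  rwa [map_sub, hpoly, sub_zero] at this

/-! ### The Poisson bracket -/

theorem pderiv_comm (i j : Fin 3) (g : Series) :
    pderiv ℝ i (pderiv ℝ j g) = pderiv ℝ j (pderiv ℝ i g) := by
  ext e
  simp only [coeff_pderiv, Finsupp.add_apply]
  rw [add_right_comm]
  rcases eq_or_ne i j with rfl | h
  · rfl
  · simp only [Finsupp.single_apply, if_neg h, if_neg h.symm]
    push_cast
    ring

theorem pderiv_mul (i : Fin 3) (f g : Series) :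
    pderiv ℝ i (f * g) = f * pderiv ℝ i g + g * pderiv ℝ i f := by
  rw [Derivation.leibniz]; rfl

theorem poisson_mem_filt (hf : f ∈ filt w p) (hg : g ∈ filt w q)
    (h : r + (w 0 + w 1) ≤ p + q) : poisson f g ∈ filt w r := by
  refine sub_mem ?_ ?_
  · exact filt_anti (by omega) (mul_mem_filt (pderiv_mem_filt 0 hf) (pderiv_mem_filt 1 hg))
  · exact filt_anti (by omega) (mul_mem_filt (pderiv_mem_filt 1 hf) (pderiv_mem_filt 0 hg))

/-- The Poisson bracket as a bilinear map. -/
def poissonL : Series →ₗ[ℝ] Series →ₗ[ℝ] Series :=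
  LinearMap.mk₂ ℝ poisson
    (fun f₁ f₂ g => by simp only [poisson, map_add]; ring)
    (fun c f g => by
      simp only [poisson, Derivation.map_smul, smul_mul_assoc, smul_sub])
    (fun f g₁ g₂ => by simp only [poisson, map_add]; ring)
    (fun c f g => by
      simp only [poisson, Derivation.map_smul, mul_smul_comm, smul_sub])

theorem poissonL_apply (f g : Series) : poissonL f g = poisson f g := rfl

theorem poisson_add_left (f₁ f₂ g : Series) :
    poisson (f₁ + f₂) g = poisson f₁ g + poisson f₂ g := by simp only [poisson, map_add]; ring

theorem poisson_add_right (f g₁ g₂ : Series) :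
    poisson f (g₁ + g₂) = poisson f g₁ + poisson f g₂ := by simp only [poisson, map_add]; ring

theorem poisson_sub_left (f₁ f₂ g : Series) :
    poisson (f₁ - f₂) g = poisson f₁ g - poisson f₂ g := by simp only [poisson, map_sub]; ring

theorem poisson_sub_right (f g₁ g₂ : Series) :
    poisson f (g₁ - g₂) = poisson f g₁ - poisson f g₂ := by simp only [poisson, map_sub]; ring

theorem poisson_neg_right (f g : Series) : poisson f (-g) = -poisson f g := by
  simp only [poisson, map_neg]; ring

theorem poisson_self (f : Series) : poisson f f = 0 := by simp only [poisson]; ring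

theorem poisson_comm (f g : Series) : poisson f g = -poisson g f := by simp only [poisson]; ring

theorem poisson_mul_left (f g h : Series) :
    poisson (f * g) h = f * poisson g h + g * poisson f h := by
  simp only [poisson, pderiv_mul]; ring

theorem poisson_jacobi (f g h : Series) :
    poisson (poisson f g) h = poisson (poisson f h) g + poisson f (poisson g h) := by
  simp only [poisson, map_sub, pderiv_mul]
  rw [pderiv_comm 1 0 f, pderiv_comm 1 0 g, pderiv_comm 1 0 h]
  ring

theorem poisson_X_zero (g : Series) : poisson (X 0) g = pderiv ℝ 1 g := by
  simp [poisson]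

theorem poisson_X_one (g : Series) : poisson (X 1) g = -pderiv ℝ 0 g := by
  simp [poisson]

theorem poisson_X_two (g : Series) : poisson (X 2) g = 0 := by
  simp [poisson]

theorem poisson_X_X : poisson (X 0) (X 1) = 1 := by simp [poisson]

/-! ### Coefficients indexed by triples -/

/-- The exponent of `x ^ i * y ^ j * ε ^ k`. -/
def mon (i j k : ℕ) : Fin 3 →₀ ℕ :=
  Finsupp.single 0 i + Finsupp.single 1 j + Finsupp.single 2 k

@[simp] theorem mon_zero (i j k : ℕ) : mon i j k 0 = i := by simp [mon]
@[simp] theorem mon_one (i j k : ℕ) : mon i j k 1 = j := by simp [mon]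
@[simp] theorem mon_two (i j k : ℕ) : mon i j k 2 = k := by simp [mon]

theorem mon_eta (e : Fin 3 →₀ ℕ) : mon (e 0) (e 1) (e 2) = e := by
  ext i; fin_cases i <;> simp

theorem exponent_ext {d e : Fin 3 →₀ ℕ} (h0 : d 0 = e 0) (h1 : d 1 = e 1) (h2 : d 2 = e 2) :
    d = e := by
  ext i; fin_cases i <;> assumption

theorem mon_add (i j k i' j' k' : ℕ) : mon i j k + mon i' j' k' = mon (i + i') (j + j') (k + k') :=
  exponent_ext (by simp) (by simp) (by simp)

theorem wt_mon (w : Fin 3 → ℕ) (i j k : ℕ) : wt w (mon i j k) = w 0 * i + w 1 * j + w 2 * k := by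
  simp [wt]

theorem mem_filt_iff_mon :
    g ∈ filt w p ↔ ∀ i j k, w 0 * i + w 1 * j + w 2 * k < p → coeff (mon i j k) g = 0 := by
  refine ⟨fun h i j k hw => h _ (by rwa [wt_mon]), fun h e he => ?_⟩
  have := h (e 0) (e 1) (e 2) he
  rwa [mon_eta] at this

theorem ext_mon (h : ∀ i j k, coeff (mon i j k) f = coeff (mon i j k) g) : f = g := by
  ext e
  rw [← mon_eta e, h]

/-- The series with prescribed coefficients. -/
def ser (c : ℕ → ℕ → ℕ → ℝ) : Series := fun e => c (e 0) (e 1) (e 2)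

theorem coeff_ser (c : ℕ → ℕ → ℕ → ℝ) (e : Fin 3 →₀ ℕ) : coeff e (ser c) = c (e 0) (e 1) (e 2) :=
  rfl

@[simp] theorem coeff_mon_ser (c : ℕ → ℕ → ℕ → ℝ) (i j k : ℕ) :
    coeff (mon i j k) (ser c) = c i j k := by simp [coeff_ser]

theorem coeff_mon_pderiv_zero (i j k : ℕ) (g : Series) :
    coeff (mon i j k) (pderiv ℝ 0 g) = coeff (mon (i + 1) j k) g * (i + 1) := by
  rw [coeff_pderiv, mon_zero]
  congr 3
  exact exponent_ext (by simp) (by simp) (by simp)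

theorem coeff_mon_pderiv_one (i j k : ℕ) (g : Series) :
    coeff (mon i j k) (pderiv ℝ 1 g) = coeff (mon i (j + 1) k) g * (j + 1) := by
  rw [coeff_pderiv, mon_one]
  congr 3
  exact exponent_ext (by simp) (by simp) (by simp)

theorem X_zero_pow_eq (l : ℕ) : (X 0 : Series) ^ l = monomial (mon l 0 0) 1 := by
  rw [X_pow_eq]; congr 1; simp [mon]

theorem X_one_pow_eq (l : ℕ) : (X 1 : Series) ^ l = monomial (mon 0 l 0) 1 := by
  rw [X_pow_eq]; congr 1; simp [mon]

theorem X_two_pow_eq (l : ℕ) : (X 2 : Series) ^ l = monomial (mon 0 0 l) 1 := by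
  rw [X_pow_eq]; congr 1; simp [mon]

theorem mon_le_mon {i j k i' j' k' : ℕ} :
    mon i j k ≤ mon i' j' k' ↔ i ≤ i' ∧ j ≤ j' ∧ k ≤ k' := by
  constructor
  · intro h
    exact ⟨by simpa using h 0, by simpa using h 1, by simpa using h 2⟩
  · rintro ⟨h0, h1, h2⟩ a
    fin_cases a <;> simpa

theorem mon_sub (i j k i' j' k' : ℕ) : mon i j k - mon i' j' k' = mon (i - i') (j - j') (k - k') :=
  exponent_ext (by simp) (by simp) (by simp)

theorem coeff_mon_monomial_mul (a b c i j k : ℕ) (r : ℝ) (g : Series) :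
    coeff (mon i j k) (monomial (mon a b c) r * g) =
      if a ≤ i ∧ b ≤ j ∧ c ≤ k then r * coeff (mon (i - a) (j - b) (k - c)) g else 0 := by
  classical
  rw [coeff_monomial_mul, mon_sub]
  simp only [mon_le_mon]

theorem mon_inj {i j k i' j' k' : ℕ} : mon i j k = mon i' j' k' ↔ i = i' ∧ j = j' ∧ k = k' := by
  constructor
  · intro h
    exact ⟨by simpa using DFunLike.congr_fun h 0, by simpa using DFunLike.congr_fun h 1,
      by simpa using DFunLike.congr_fun h 2⟩
  · rintro ⟨rfl, rfl, rfl⟩; rfl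

theorem coeff_mon_monomial (a b c i j k : ℕ) (r : ℝ) :
    coeff (mon i j k) (monomial (mon a b c) r) = if i = a ∧ j = b ∧ k = c then r else 0 := by
  classical
  rw [coeff_monomial]
  simp only [mon_inj]

end FormalNF

end

noncomputable section

namespace FormalNF

open MvPowerSeries

/-! ### The exponential of a Lie derivative -/

variable {w : Fin 3 → ℕ} {p q r N : ℕ} {f g χ χ' : Series}

/-- The Hamiltonian `χ` has weight greater than `w 0 + w 1`, so that `L_χ` raises the weight. -/
def Tame (w : Fin 3 → ℕ) (χ : Series) : Prop := χ ∈ filt w (w 0 + w 1 + 1)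

/-- The Lie derivative as a linear map. -/
def lieL (χ : Series) : Module.End ℝ Series := poissonL.flip χ

theorem lieL_apply (χ g : Series) : lieL χ g = poisson g χ := rfl

theorem lieL_pow_apply (χ : Series) (k : ℕ) (g : Series) : (lie χ)^[k] g = (lieL χ ^ k) g := by
  rw [Module.End.pow_apply]; rfl

theorem lieL_pow_succ_apply (χ : Series) (k : ℕ) (g : Series) :
    (lieL χ ^ (k + 1)) g = poisson ((lieL χ ^ k) g) χ := by
  rw [pow_succ', Module.End.mul_apply]; rfl

/-- The `k`-th term `L_χ^k g / k!` of the exponential series. -/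
def expTerm (χ : Series) (k : ℕ) : Module.End ℝ Series := ((k.factorial : ℝ)⁻¹) • lieL χ ^ k

theorem expTerm_apply (χ : Series) (k : ℕ) (g : Series) :
    expTerm χ k g = (k.factorial : ℝ)⁻¹ • (lieL χ ^ k) g := rfl

theorem expTerm_zero (χ g : Series) : expTerm χ 0 g = g := by simp [expTerm_apply]

theorem expTerm_one (χ g : Series) : expTerm χ 1 g = poisson g χ := by
  simp [expTerm_apply, lieL_apply]

/-- The partial sum `∑_{k < N} L_χ^k g / k!`. -/
def expTrunc (χ : Series) (N : ℕ) (g : Series) : Series := ∑ k ∈ Finset.range N, expTerm χ k g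

theorem lieL_pow_mem_filt (hχ : Tame w χ) (hg : g ∈ filt w p) (k : ℕ) :
    (lieL χ ^ k) g ∈ filt w (p + k) := by
  induction k with
  | zero => simpa using hg
  | succ k ih =>
    rw [lieL_pow_succ_apply]
    exact poisson_mem_filt ih hχ (by omega)

theorem expTerm_mem_filt (hχ : Tame w χ) (hg : g ∈ filt w p) (k : ℕ) :
    expTerm χ k g ∈ filt w (p + k) :=
  smul_mem_filt _ (lieL_pow_mem_filt hχ hg k)

/-- The terms with `k ≥ N` have weight at least `p + N` and do not reach `e`. The support of the
`finsum` is thus finite, and its default value `0` plays no role. -/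
theorem coeff_expLie (hχ : Tame w χ) (hg : g ∈ filt w p) {e : Fin 3 →₀ ℕ} (he : wt w e < p + N) :
    coeff e (expLie χ g) = coeff e (expTrunc χ N g) := by
  have key : ∀ k, coeff e ((lie χ)^[k] g) / (k.factorial : ℝ) = coeff e (expTerm χ k g) := by
    intro k
    rw [lieL_pow_apply, expTerm_apply, coeff_smul, div_eq_inv_mul]
  change (∑ᶠ k : ℕ, coeff e ((lie χ)^[k] g) / (k.factorial : ℝ)) = _
  simp only [key]
  rw [finsum_eq_sum_of_support_subset (s := Finset.range N), expTrunc, map_sum]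
  intro k hk
  by_contra hkN
  rw [Finset.coe_range, Set.mem_Iio, not_lt] at hkN
  exact hk (expTerm_mem_filt hχ hg k e (by omega))

theorem expLie_sub_expTrunc (hχ : Tame w χ) (hg : g ∈ filt w p) (N : ℕ) :
    expLie χ g - expTrunc χ N g ∈ filt w (p + N) := fun e he => by
  rw [map_sub, coeff_expLie hχ hg he, sub_self]

theorem expTrunc_mem_filt (hχ : Tame w χ) (hg : g ∈ filt w p) (N : ℕ) :
    expTrunc χ N g ∈ filt w p :=
  sum_mem fun k _ => filt_anti (by omega) (expTerm_mem_filt hχ hg k)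

theorem expLie_mem_filt (hχ : Tame w χ) (hg : g ∈ filt w p) : expLie χ g ∈ filt w p :=
  mem_filt_of_sub_mem (filt_anti (by omega) (expLie_sub_expTrunc hχ hg 0))
    (expTrunc_mem_filt hχ hg 0)

theorem expLie_sub_self (hχ : Tame w χ) (hg : g ∈ filt w p) : expLie χ g - g ∈ filt w (p + 1) := by
  have := expLie_sub_expTrunc hχ hg 1
  rwa [expTrunc, Finset.sum_range_one, expTerm_zero] at this

/-- To compare two expressions in exponentials it is enough to compare the truncations. -/
theorem expLie_eq_of_trunc (hχ : Tame w χ) (g F : Series)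
    (h : ∀ N, F - expTrunc χ N g ∈ filt w N) : F = expLie χ g := by
  rw [← sub_eq_zero]
  refine eq_zero_of_mem_filt (w := w) fun N => ?_
  refine sub_mem_trans (h N) ?_
  have := neg_mem (expLie_sub_expTrunc hχ (mem_filt_zero g) N)
  rwa [neg_sub, zero_add] at this

theorem expLie_add (hχ : Tame w χ) (f g : Series) :
    expLie χ (f + g) = expLie χ f + expLie χ g := by
  symm
  refine expLie_eq_of_trunc hχ _ _ fun N => ?_
  have := add_mem (expLie_sub_expTrunc hχ (mem_filt_zero f) N)
    (expLie_sub_expTrunc hχ (mem_filt_zero g) N)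
  rw [zero_add] at this
  convert this using 1
  simp only [expTrunc, map_add, Finset.sum_add_distrib]
  ring

theorem expLie_smul (hχ : Tame w χ) (c : ℝ) (g : Series) :
    expLie χ (c • g) = c • expLie χ g := by
  symm
  refine expLie_eq_of_trunc hχ _ _ fun N => ?_
  have := smul_mem_filt c (expLie_sub_expTrunc hχ (mem_filt_zero g) N)
  rw [zero_add] at this
  convert this using 1
  simp only [expTrunc, map_smul, smul_sub, Finset.smul_sum]

theorem expLie_of_poisson_eq_zero (hχ : Tame w χ) (h : poisson g χ = 0) : expLie χ g = g := by
  symm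
  refine expLie_eq_of_trunc hχ _ _ fun N => ?_
  rcases N with _ | N
  · exact mem_filt_zero _
  · rw [expTrunc, Finset.sum_range_succ', expTerm_zero, Finset.sum_eq_zero, zero_add, sub_self]
    · exact zero_mem _
    · intro k _
      rw [expTerm_apply, pow_succ, Module.End.mul_apply, lieL_apply, h, map_zero, smul_zero]

/-- Sums over the square and over the triangle agree up to terms of high weight. -/
theorem sum_square_sub_sum_antidiagonal (a : ℕ → ℕ → Series) (c N : ℕ)
    (ha : ∀ i j, a i j ∈ filt w (i + j - c)) :
    ∑ i ∈ Finset.range N, ∑ j ∈ Finset.range N, a i j -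
      ∑ k ∈ Finset.range N, ∑ x ∈ Finset.HasAntidiagonal.antidiagonal k, a x.1 x.2 ∈
      filt w (N - c) := by
  classical
  rw [← Finset.sum_product', ← Finset.sum_filter_add_sum_filter_not _ (fun x => x.1 + x.2 < N)]
  have : ∑ k ∈ Finset.range N, ∑ x ∈ Finset.HasAntidiagonal.antidiagonal k, a x.1 x.2 =
      ∑ x ∈ (Finset.range N ×ˢ Finset.range N).filter (fun x => x.1 + x.2 < N), a x.1 x.2 := by
    rw [← Finset.sum_fiberwise_of_maps_to (s := (Finset.range N ×ˢ Finset.range N).filter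
      (fun x => x.1 + x.2 < N)) (t := Finset.range N) (g := fun x => x.1 + x.2)]
    · refine Finset.sum_congr rfl fun k hk => Finset.sum_congr ?_ fun _ _ => rfl
      ext ⟨i, j⟩
      simp only [Finset.mem_range] at hk
      simp only [Finset.HasAntidiagonal.mem_antidiagonal, Finset.mem_filter, Finset.mem_product,
        Finset.mem_range]
      omega
    · intro x hx
      simpa using (Finset.mem_filter.mp hx).2
  rw [this, add_sub_cancel_left]
  refine sum_mem fun x hx => filt_anti ?_ (ha _ _)
  have := (Finset.mem_filter.mp hx).2
  omega

/-- The Leibniz rule for the divided powers `L_χ^k / k!`. The induction multiplies by `k + 1`, which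
splits as `i + j` on the antidiagonal. -/
theorem expTerm_bilinear (B : Series →ₗ[ℝ] Series →ₗ[ℝ] Series)
    (hB : ∀ f g, poisson (B f g) χ = B (poisson f χ) g + B f (poisson g χ)) (k : ℕ) (f g : Series) :
    expTerm χ k (B f g) =
      ∑ x ∈ Finset.HasAntidiagonal.antidiagonal k, B (expTerm χ x.1 f) (expTerm χ x.2 g) := by
  have hsucc : ∀ k g, poisson (expTerm χ k g) χ = (k + 1 : ℝ) • expTerm χ (k + 1) g := by
    intro k g
    rw [expTerm_apply, expTerm_apply, lieL_pow_succ_apply, Nat.factorial_succ, smul_smul]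
    change lieL χ ((k.factorial : ℝ)⁻¹ • (lieL χ ^ k) g) = _ • lieL χ ((lieL χ ^ k) g)
    rw [map_smul]
    congr 1
    push_cast
    field_simp
  induction k with
  | zero => simp [expTerm_zero]
  | succ k ih =>
    have hk : (k + 1 : ℝ) ≠ 0 := by positivity
    refine (smul_right_injective Series hk) ?_
    change (k + 1 : ℝ) • _ = (k + 1 : ℝ) • _
    rw [← hsucc, ih]
    change lieL χ _ = _
    rw [map_sum]
    simp only [lieL_apply, hB, hsucc, map_smul, LinearMap.smul_apply]
    rw [Finset.sum_add_distrib]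
    have h1 := Finset.Nat.sum_antidiagonal_succ (n := k)
      (f := fun x : ℕ × ℕ => (x.1 : ℝ) • B (expTerm χ x.1 f) (expTerm χ x.2 g))
    have h2 := Finset.Nat.sum_antidiagonal_succ' (n := k)
      (f := fun x : ℕ × ℕ => (x.2 : ℝ) • B (expTerm χ x.1 f) (expTerm χ x.2 g))
    simp only [Nat.cast_zero, zero_smul, zero_add, Nat.cast_add, Nat.cast_one] at h1 h2
    -- The shifted sums become sums over the antidiagonal of `k + 1` weighted by `x.1` and by `x.2`;
    -- the extra end term of each has the factor zero.
    erw [← h1, ← h2]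
    rw [← Finset.sum_add_distrib, Finset.smul_sum]
    refine Finset.sum_congr rfl fun x hx => ?_
    rw [Finset.HasAntidiagonal.mem_antidiagonal] at hx
    rw [← add_smul]
    congr 1
    exact_mod_cast hx

/-- The exponential of a Lie derivative respects the bilinear operations which satisfy the
Leibniz rule. -/
theorem expLie_bilinear (hχ : Tame w χ) (B : Series →ₗ[ℝ] Series →ₗ[ℝ] Series) (c : ℕ)
    (hB : ∀ f g, poisson (B f g) χ = B (poisson f χ) g + B f (poisson g χ))
    (hBw : ∀ p q f g, f ∈ filt w p → g ∈ filt w q → B f g ∈ filt w (p + q - c)) (f g : Series) :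
    B (expLie χ f) (expLie χ g) = expLie χ (B f g) := by
  refine expLie_eq_of_trunc hχ _ _ fun N => ?_
  -- `B` may lose `c` units of weight, so the truncation is taken at `N + c`.
  have hf := expLie_sub_expTrunc hχ (mem_filt_zero f) (N + c)
  have hg := expLie_sub_expTrunc hχ (mem_filt_zero g) (N + c)
  have h1 : B (expLie χ f) (expLie χ g) - B (expTrunc χ (N + c) f) (expTrunc χ (N + c) g) ∈
      filt w N := by
    have e : B (expLie χ f) (expLie χ g) - B (expTrunc χ (N + c) f) (expTrunc χ (N + c) g) =
        B (expLie χ f - expTrunc χ (N + c) f) (expLie χ g) +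
        B (expTrunc χ (N + c) f) (expLie χ g - expTrunc χ (N + c) g) := by
      simp only [map_sub, LinearMap.sub_apply]; ring
    rw [e]
    refine add_mem (filt_anti ?_ (hBw _ _ _ _ hf (mem_filt_zero _)))
      (filt_anti ?_ (hBw _ _ _ _ (mem_filt_zero _) hg)) <;> omega
  have h2 := sum_square_sub_sum_antidiagonal (w := w)
    (fun i j => B (expTerm χ i f) (expTerm χ j g)) c (N + c) fun i j => filt_anti (by omega)
      (hBw _ _ _ _ (expTerm_mem_filt hχ (mem_filt_zero f) i)
        (expTerm_mem_filt hχ (mem_filt_zero g) j))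
  simp only [← expTerm_bilinear B hB] at h2
  rw [Nat.add_sub_cancel] at h2
  have h3 : B (expTrunc χ (N + c) f) (expTrunc χ (N + c) g) - expTrunc χ (N + c) (B f g) ∈
      filt w N := by
    convert h2 using 2
    · simp only [expTrunc, map_sum, LinearMap.sum_apply]
      rw [Finset.sum_comm]
    · rfl
  refine sub_mem_trans h1 (sub_mem_trans h3 ?_)
  -- The terms of the longer truncation with index at least `N` already have weight at least `N`.
  rw [expTrunc, Finset.sum_range_add, expTrunc, add_sub_cancel_left]
  exact sum_mem fun k _ => filt_anti (by omega) (expTerm_mem_filt hχ (mem_filt_zero _) _)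

theorem expLie_mul (hχ : Tame w χ) (f g : Series) :
    expLie χ (f * g) = expLie χ f * expLie χ g := by
  refine (expLie_bilinear hχ (LinearMap.mul ℝ Series) 0 (fun f g => ?_)
    (fun p q f g hf hg => mul_mem_filt hf hg) f g).symm
  simp only [LinearMap.mul_apply', poisson_mul_left]
  ring

theorem expLie_poisson (hχ : Tame w χ) (f g : Series) :
    expLie χ (poisson f g) = poisson (expLie χ f) (expLie χ g) := by
  refine (expLie_bilinear hχ poissonL (w 0 + w 1) (fun f g => ?_)
    (fun p q f g hf hg => ?_) f g).symm
  · exact poisson_jacobi f g χ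
  · rw [poissonL_apply]
    rcases le_total (w 0 + w 1) (p + q) with h | h
    · exact poisson_mem_filt hf hg (by omega)
    · exact filt_anti (by omega) (mem_filt_zero _)

theorem expLie_one (hχ : Tame w χ) : expLie χ 1 = 1 :=
  expLie_of_poisson_eq_zero hχ (by simp [poisson])

/-- The exponential of a Lie derivative as an algebra endomorphism. -/
def expHom (hχ : Tame w χ) : Series →ₐ[ℝ] Series :=
  AlgHom.ofLinearMap ⟨⟨expLie χ, expLie_add hχ⟩, expLie_smul hχ⟩ (expLie_one hχ) (expLie_mul hχ)

theorem expHom_apply (hχ : Tame w χ) (g : Series) : expHom hχ g = expLie χ g := rfl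

theorem Tame.neg (hχ : Tame w χ) : Tame w (-χ) := neg_mem hχ

theorem lieL_neg (χ : Series) : lieL (-χ) = (-1 : ℝ) • lieL χ := by
  ext1 g
  rw [lieL_apply, poisson_neg_right, LinearMap.smul_apply, neg_one_smul]; rfl

/-- This is the binomial expansion of `(-1 + 1) ^ k`, applied to powers of the single operator `lieL
χ`. -/
theorem sum_antidiagonal_expTerm_neg (k : ℕ) (g : Series) :
    ∑ x ∈ Finset.HasAntidiagonal.antidiagonal k, expTerm (-χ) x.1 (expTerm χ x.2 g) =
      if k = 0 then g else 0 := by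
  have h : ∀ x ∈ Finset.HasAntidiagonal.antidiagonal k,
      expTerm (-χ) x.1 (expTerm χ x.2 g) =
      ((k.factorial : ℝ)⁻¹ * ((-1) ^ x.1 * 1 ^ x.2 * (k.choose x.1))) • (lieL χ ^ k) g := by
    intro x hx
    rw [Finset.HasAntidiagonal.mem_antidiagonal] at hx
    rw [expTerm_apply, expTerm_apply, map_smul, lieL_neg, smul_pow, LinearMap.smul_apply, smul_smul,
      smul_smul, ← Module.End.mul_apply, ← pow_add, hx]
    congr 1
    rw [← hx, Nat.choose_symm_add, Nat.add_choose]
    rw [Nat.cast_div (Nat.factorial_mul_factorial_dvd_factorial_add _ _) (by positivity)]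
    push_cast
    have h1 : ((x.1 + x.2).factorial : ℝ) ≠ 0 := by positivity
    field_simp
    ring
  rw [Finset.sum_congr rfl h, ← Finset.sum_smul, ← Finset.mul_sum]
  have := (Commute.all (-1 : ℝ) 1).add_pow' k
  simp only [nsmul_eq_mul] at this
  have h' : ∑ x ∈ Finset.HasAntidiagonal.antidiagonal k,
      ((-1 : ℝ) ^ x.1 * 1 ^ x.2 * (k.choose x.1)) = (-1 + 1) ^ k := by
    rw [this]
    exact Finset.sum_congr rfl fun _ _ => mul_comm _ _
  rw [h', neg_add_cancel]
  split_ifs with hk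
  · subst hk; simp
  · simp [hk]

theorem expLie_neg_expLie (hχ : Tame w χ) (g : Series) : expLie (-χ) (expLie χ g) = g := by
  rw [← sub_eq_zero]
  refine eq_zero_of_mem_filt (w := w) fun N => ?_
  -- Truncating at `N + 1` keeps the index `0` in the range even for `N = 0`.
  have h1 := expLie_sub_expTrunc hχ.neg (mem_filt_zero (expLie χ g)) (N + 1)
  rw [zero_add] at h1
  have h2 : expTrunc (-χ) (N + 1) (expLie χ g) - expTrunc (-χ) (N + 1) (expTrunc χ (N + 1) g) ∈
      filt w (N + 1) := by
    have : expTrunc (-χ) (N + 1) (expLie χ g) - expTrunc (-χ) (N + 1) (expTrunc χ (N + 1) g) =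
        expTrunc (-χ) (N + 1) (expLie χ g - expTrunc χ (N + 1) g) := by
      simp only [expTrunc, map_sub, Finset.sum_sub_distrib]
    rw [this]
    have := expTrunc_mem_filt hχ.neg (expLie_sub_expTrunc hχ (mem_filt_zero g) (N + 1)) (N + 1)
    rwa [zero_add] at this
  have h3 := sum_square_sub_sum_antidiagonal (w := w)
    (fun i j => expTerm (-χ) i (expTerm χ j g)) 0 (N + 1) fun i j => filt_anti (by omega)
      (expTerm_mem_filt hχ.neg (expTerm_mem_filt hχ (mem_filt_zero g) j) i)
  simp only [sum_antidiagonal_expTerm_neg] at h3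
  rw [Finset.sum_ite_eq' (Finset.range (N + 1)) 0 (fun _ => g), if_pos (by simp)] at h3
  simp only [← map_sum] at h3
  refine filt_anti (Nat.le_succ N) (sub_mem_trans h1 (sub_mem_trans h2 ?_))
  exact h3

theorem expLie_expLie_neg (hχ : Tame w χ) (g : Series) : expLie χ (expLie (-χ) g) = g := by
  have := expLie_neg_expLie hχ.neg g
  rwa [neg_neg] at this

/-- Telescoping: every bracket gains one unit of weight, and the single bracket with `χ - χ'` gains
`r` more. -/
theorem lieL_pow_sub_lieL_pow (hχ : Tame w χ) (hχ' : Tame w χ')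
    (hδ : χ - χ' ∈ filt w (w 0 + w 1 + 1 + r)) (hg : g ∈ filt w q) (k : ℕ) :
    (lieL χ ^ k) g - (lieL χ' ^ k) g ∈ filt w (q + r + k) := by
  induction k with
  | zero => simp
  | succ k ih =>
    have : (lieL χ ^ (k + 1)) g - (lieL χ' ^ (k + 1)) g =
        poisson ((lieL χ ^ k) g - (lieL χ' ^ k) g) χ + poisson ((lieL χ' ^ k) g) (χ - χ') := by
      rw [lieL_pow_succ_apply, lieL_pow_succ_apply, poisson_sub_left, poisson_sub_right]
      ring
    rw [this]
    refine add_mem (poisson_mem_filt ih hχ (by omega))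
      (poisson_mem_filt (lieL_pow_mem_filt hχ' hg k) hδ (by omega))

/-- The first-order dependence of `exp(L_χ) g` on `χ`. -/
theorem expLie_sub_expLie (hχ : Tame w χ) (hχ' : Tame w χ')
    (hδ : χ - χ' ∈ filt w (w 0 + w 1 + 1 + r)) (hg : g ∈ filt w q) :
    expLie χ g - expLie χ' g - poisson g (χ - χ') ∈ filt w (q + 2 + r) := by
  -- The tails beyond `r + 2` terms are negligible. Among the terms kept, those with `k ≥ 2` differ
  -- only in weight at least `q + r + 2`, which leaves the linear term.
  have h1 := expLie_sub_expTrunc hχ hg (r + 2)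
  have h2 := expLie_sub_expTrunc hχ' hg (r + 2)
  have h3 : expTrunc χ (r + 2) g - expTrunc χ' (r + 2) g - poisson g (χ - χ') ∈
      filt w (q + (r + 2)) := by
    rw [expTrunc, expTrunc, Finset.sum_range_succ', Finset.sum_range_succ',
      Finset.sum_range_succ' (fun k => expTerm χ' k g),
      Finset.sum_range_succ' (fun k => expTerm χ' (k + 1) g)]
    simp only [zero_add, expTerm_zero, expTerm_one, poisson_sub_right]
    have : ∑ k ∈ Finset.range r, expTerm χ (k + 1 + 1) g -
        ∑ k ∈ Finset.range r, expTerm χ' (k + 1 + 1) g ∈ filt w (q + (r + 2)) := by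
      rw [← Finset.sum_sub_distrib]
      refine sum_mem fun k _ => ?_
      rw [expTerm_apply, expTerm_apply, ← smul_sub]
      exact smul_mem_filt _ (filt_anti (by omega) (lieL_pow_sub_lieL_pow hχ hχ' hδ hg _))
    convert this using 1
    ring
  have := add_mem (sub_mem h1 h2) h3
  refine filt_anti (q := q + (r + 2)) (by omega) ?_
  convert this using 1
  ring

theorem expLie_sub_expLie_mem (hχ : Tame w χ) (hχ' : Tame w χ')
    (hδ : χ - χ' ∈ filt w (w 0 + w 1 + 1 + r)) (hg : g ∈ filt w q) :
    expLie χ g - expLie χ' g ∈ filt w (q + 1 + r) :=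
  mem_filt_of_sub_mem (filt_anti (by omega) (expLie_sub_expLie hχ hχ' hδ hg))
    (poisson_mem_filt hg hδ (by omega))

theorem tame_zero (w : Fin 3 → ℕ) : Tame w 0 := zero_mem (filt w (w 0 + w 1 + 1))

theorem expLie_zero (g : Series) : expLie 0 g = g :=
  expLie_of_poisson_eq_zero (tame_zero (fun _ => 1)) (by simp [poisson])

/-- The linearisation `exp(L_χ) g = g + {g, χ} + …`. -/
theorem expLie_sub_linear (hχ : χ ∈ filt w (w 0 + w 1 + 1 + r)) (hg : g ∈ filt w q) :
    expLie χ g - g - poisson g χ ∈ filt w (q + 2 + r) := by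
  have := expLie_sub_expLie (χ' := 0) (r := r) (filt_anti (by omega) hχ : Tame w χ) (tame_zero w)
    (by rwa [sub_zero]) hg
  rwa [expLie_zero, sub_zero] at this

theorem timeOne_zero_eq (χ : Series) : timeOne χ 0 = expLie χ (X 0) := rfl

theorem timeOne_one_eq (χ : Series) : timeOne χ 1 = expLie χ (X 1) := rfl

theorem poisson_timeOne (hχ : Tame w χ) : poisson (timeOne χ 0) (timeOne χ 1) = 1 := by
  rw [timeOne_zero_eq, timeOne_one_eq, ← expLie_poisson hχ, poisson_X_X, expLie_one hχ]

theorem lieL_congr (h : ∀ i : Fin 2, pderiv ℝ i.castSucc χ = pderiv ℝ i.castSucc χ') :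
    lieL χ = lieL χ' := by
  ext1 g
  have h0 := h 0
  have h1 := h 1
  simp only [Fin.castSucc_zero, Fin.castSucc_one] at h0 h1
  simp only [lieL_apply, poisson, h0, h1]

/-- Lie derivatives see only the `x`- and `y`-derivatives of the Hamiltonian. The two `finsum`s
agree term by term, so tameness is not needed. -/
theorem expLie_congr (h : ∀ i : Fin 2, pderiv ℝ i.castSucc χ = pderiv ℝ i.castSucc χ')
    (g : Series) : expLie χ g = expLie χ' g := by
  have := lieL_congr h
  funext e
  change (∑ᶠ k : ℕ, coeff e ((lie χ)^[k] g) / (k.factorial : ℝ)) =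
    ∑ᶠ k : ℕ, coeff e ((lie χ')^[k] g) / (k.factorial : ℝ)
  simp only [lieL_pow_apply, this]

end FormalNF

end

noncomputable section

namespace FormalNF

open MvPowerSeries

/-! ### Substitution of formal maps -/

variable {w : Fin 3 → ℕ} {p q r N : ℕ} {f g χ h : Series} {φ ψ θ F G H : FormalMap}

theorem FixesOrigin.hasSubst (hφ : FixesOrigin φ) :
    HasSubst (![φ 0, φ 1, X 2] : Fin 3 → Series) := by
  refine hasSubst_of_constantCoeff_zero fun i => ?_
  fin_cases i
  · exact hφ 0
  · exact hφ 1
  · exact constantCoeff_X 2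

/-- The substitution of a formal map as an algebra endomorphism. -/
def pbHom (hφ : FixesOrigin φ) : Series →ₐ[ℝ] Series := substAlgHom hφ.hasSubst

theorem pbHom_apply (hφ : FixesOrigin φ) (g : Series) : pbHom hφ g = pullback φ g :=
  substAlgHom_apply hφ.hasSubst g

theorem pullback_X_zero (hφ : FixesOrigin φ) : pullback φ (X 0) = φ 0 :=
  subst_X hφ.hasSubst 0

theorem pullback_X_one (hφ : FixesOrigin φ) : pullback φ (X 1) = φ 1 :=
  subst_X hφ.hasSubst 1

theorem pullback_X_two (hφ : FixesOrigin φ) : pullback φ (X 2) = X 2 :=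
  subst_X hφ.hasSubst 2

theorem pullback_X_castSucc (hφ : FixesOrigin φ) (i : Fin 2) :
    pullback φ (X i.castSucc) = φ i := by
  fin_cases i
  · exact pullback_X_zero hφ
  · exact pullback_X_one hφ

theorem pullback_add (hφ : FixesOrigin φ) (f g : Series) :
    pullback φ (f + g) = pullback φ f + pullback φ g := by
  simp only [← pbHom_apply hφ, map_add]

theorem pullback_sub (hφ : FixesOrigin φ) (f g : Series) :
    pullback φ (f - g) = pullback φ f - pullback φ g := by
  simp only [← pbHom_apply hφ, map_sub]

theorem pullback_mul (hφ : FixesOrigin φ) (f g : Series) :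
    pullback φ (f * g) = pullback φ f * pullback φ g := by
  simp only [← pbHom_apply hφ, map_mul]

theorem pullback_pow (hφ : FixesOrigin φ) (f : Series) (k : ℕ) :
    pullback φ (f ^ k) = pullback φ f ^ k := by
  simp only [← pbHom_apply hφ, map_pow]

theorem pullback_smul (hφ : FixesOrigin φ) (c : ℝ) (g : Series) :
    pullback φ (c • g) = c • pullback φ g := by
  simp only [← pbHom_apply hφ, map_smul]

theorem pullback_one (hφ : FixesOrigin φ) : pullback φ 1 = 1 := by
  simp only [← pbHom_apply hφ, map_one]

theorem pullback_C (hφ : FixesOrigin φ) (c : ℝ) : pullback φ (C c) = C c := by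
  have h : (C c : Series) = c • 1 := by rw [smul_eq_C_mul, mul_one]
  rw [h, pullback_smul hφ, pullback_one hφ]

theorem pullback_idMap (g : Series) : pullback idMap g = g := by
  have : (![idMap 0, idMap 1, X 2] : Fin 3 → Series) = X := by
    funext i; fin_cases i <;> rfl
  rw [pullback, this, subst_self]; rfl

theorem constantCoeff_pullback_eq_zero (hφ : FixesOrigin φ) (hg : constantCoeff g = 0) :
    constantCoeff (pullback φ g) = 0 := by
  refine constantCoeff_subst_eq_zero hφ.hasSubst (fun i => ?_) hg
  fin_cases i
  · exact hφ 0
  · exact hφ 1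
  · exact constantCoeff_X 2

theorem constantCoeff_pullback (hφ : FixesOrigin φ) (g : Series) :
    constantCoeff (pullback φ g) = constantCoeff g := by
  have h : g = (g - C (constantCoeff g)) + C (constantCoeff g) := by ring
  have h2 := constantCoeff_pullback_eq_zero hφ (g := g - C (constantCoeff g)) (by simp)
  rw [pullback_sub hφ, pullback_C hφ, map_sub, sub_eq_zero, constantCoeff_C] at h2
  exact h2

theorem FixesOrigin.comp (hF : FixesOrigin F) (hφ : FixesOrigin φ) : FixesOrigin (comp F φ) :=
  fun i => constantCoeff_pullback_eq_zero hφ (hF i)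

theorem pullback_pullback (hφ : FixesOrigin φ) (hψ : FixesOrigin ψ) (g : Series) :
    pullback ψ (pullback φ g) = pullback (comp φ ψ) g := by
  rw [pullback, pullback, subst_comp_subst_apply hφ.hasSubst hψ.hasSubst]
  congr 1
  funext i
  fin_cases i
  · rfl
  · rfl
  · exact subst_X hψ.hasSubst 2

theorem comp_assoc (hG : FixesOrigin G) (hH : FixesOrigin H) :
    comp (comp F G) H = comp F (comp G H) :=
  funext fun i => pullback_pullback hG hH (F i)

theorem comp_idMap (F : FormalMap) : comp F idMap = F := funext fun i => pullback_idMap (F i)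

theorem idMap_comp (hφ : FixesOrigin φ) : comp idMap φ = φ :=
  funext fun i => pullback_X_castSucc hφ i

/-- `φ` does not decrease the weights. -/
def Filtered (w : Fin 3 → ℕ) (φ : FormalMap) : Prop := φ 0 ∈ filt w (w 0) ∧ φ 1 ∈ filt w (w 1)

theorem Filtered.fixesOrigin (hw : ∀ i, 1 ≤ w i) (hφ : Filtered w φ) : FixesOrigin φ := by
  intro i
  fin_cases i
  · exact constantCoeff_eq_zero_of_mem_filt (hw 0) hφ.1
  · exact constantCoeff_eq_zero_of_mem_filt (hw 1) hφ.2

theorem FixesOrigin.filtered (hφ : FixesOrigin φ) : Filtered (fun _ => 1) φ := by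
  have : ∀ i, φ i ∈ filt (fun _ => 1) 1 := by
    intro i e he
    have : e = 0 := by
      rw [wt] at he
      exact exponent_ext (by simp; omega) (by simp; omega) (by simp; omega)
    rw [this]
    exact hφ i
  exact ⟨this 0, this 1⟩

theorem pullback_mem_filt (hw : ∀ i, 1 ≤ w i) (hφ : Filtered w φ) (hg : g ∈ filt w p) :
    pullback φ g ∈ filt w p := by
  intro e he
  rw [pullback, coeff_subst (hφ.fixesOrigin hw).hasSubst]
  refine finsum_eq_zero_of_forall_eq_zero fun d => ?_
  rcases lt_or_ge (wt w d) p with h | h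
  · rw [hg d h, zero_smul]
  · have hd : (d.prod fun s k => (![φ 0, φ 1, X 2] : Fin 3 → Series) s ^ k) ∈ filt w (wt w d) := by
      rw [Finsupp.prod_fintype _ _ (fun _ => pow_zero _), Fin.prod_univ_three, wt]
      exact mul_mem_filt (mul_mem_filt (pow_mem_filt hφ.1 _) (pow_mem_filt hφ.2 _))
        (pow_mem_filt (X_mem_filt w 2) _)
    rw [hd e (by omega), smul_zero]

/-- Two algebra endomorphisms which respect a filtration are equal if they agree on the
variables. -/
theorem algHom_eq (hw : ∀ i, 1 ≤ w i) (A B : Series →ₐ[ℝ] Series)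
    (hA : ∀ N g, g ∈ filt w N → A g ∈ filt w N) (hB : ∀ N g, g ∈ filt w N → B g ∈ filt w N)
    (h : ∀ i, A (X i) = B (X i)) (g : Series) : A g = B g := by
  rw [← sub_eq_zero]
  refine eq_zero_of_polynomial hw (A.toLinearMap - B.toLinearMap) 0
    (fun N g hg => sub_mem (hA N g hg) (hB N g hg)) (fun p => ?_) g
  have : A.comp (MvPolynomial.coeToMvPowerSeries.algHom ℝ) =
      B.comp (MvPolynomial.coeToMvPowerSeries.algHom ℝ) := by
    ext1 i
    simpa using h i
  have := DFunLike.congr_fun this p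
  simp only [AlgHom.comp_apply, MvPolynomial.coeToMvPowerSeries.algHom_apply] at this
  rw [LinearMap.sub_apply, sub_eq_zero]
  simpa using this

theorem timeOne_sub_mem (hχ : Tame w χ) :
    timeOne χ 0 - X 0 ∈ filt w (w 0 + 1) ∧ timeOne χ 1 - X 1 ∈ filt w (w 1 + 1) :=
  ⟨expLie_sub_self hχ (X_mem_filt w 0), expLie_sub_self hχ (X_mem_filt w 1)⟩

theorem filtered_timeOne (hχ : Tame w χ) : Filtered w (timeOne χ) :=
  ⟨expLie_mem_filt hχ (X_mem_filt w 0), expLie_mem_filt hχ (X_mem_filt w 1)⟩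

/-- Both sides are algebra endomorphisms respecting the filtration and agree on the variables; `ε`
is fixed because its bracket with anything vanishes. -/
theorem pullback_timeOne (hw : ∀ i, 1 ≤ w i) (hχ : Tame w χ) (g : Series) :
    pullback (timeOne χ) g = expLie χ g := by
  have hφ := filtered_timeOne hχ
  have h0 := hφ.fixesOrigin hw
  rw [← pbHom_apply h0, ← expHom_apply hχ]
  refine algHom_eq hw _ _ (fun N g hg => ?_) (fun N g hg => expLie_mem_filt hχ hg) (fun i => ?_) g
  · rw [pbHom_apply]; exact pullback_mem_filt hw hφ hg
  · rw [pbHom_apply, expHom_apply]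
    fin_cases i
    · exact pullback_X_zero h0
    · exact pullback_X_one h0
    · exact (pullback_X_two h0).trans (expLie_of_poisson_eq_zero hχ (poisson_X_two χ)).symm

/-! ### The chain rule -/

/-- The defect of the chain rule is linear in `g` and loses at most one degree, so it suffices to
treat polynomials, where the product rule gives an induction. For `i = 2` there would be a further
term, as `ε` is substituted by itself. -/
theorem pderiv_pullback (hφ : FixesOrigin φ) {i : Fin 3} (hi : i ≠ 2) (g : Series) :
    pderiv ℝ i (pullback φ g) = pullback φ (pderiv ℝ 0 g) * pderiv ℝ i (φ 0) +
      pullback φ (pderiv ℝ 1 g) * pderiv ℝ i (φ 1) := by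
  rw [← sub_eq_zero]
  let T : Series →ₗ[ℝ] Series :=
    (pderiv ℝ i).toLinearMap ∘ₗ (pbHom hφ).toLinearMap -
      (LinearMap.mulRight ℝ (pderiv ℝ i (φ 0)) ∘ₗ (pbHom hφ).toLinearMap ∘ₗ
        (pderiv ℝ 0).toLinearMap +
      LinearMap.mulRight ℝ (pderiv ℝ i (φ 1)) ∘ₗ (pbHom hφ).toLinearMap ∘ₗ
        (pderiv ℝ 1).toLinearMap)
  have hT : ∀ g, T g = pderiv ℝ i (pullback φ g) - (pullback φ (pderiv ℝ 0 g) * pderiv ℝ i (φ 0) +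
      pullback φ (pderiv ℝ 1 g) * pderiv ℝ i (φ 1)) := by
    intro g
    simp only [T, LinearMap.sub_apply, LinearMap.add_apply, LinearMap.comp_apply,
      AlgHom.toLinearMap_apply, pbHom_apply, LinearMap.mulRight_apply]
    rfl
  rw [← hT]
  have hw : ∀ i : Fin 3, 1 ≤ (fun _ : Fin 3 => 1) i := fun _ => le_rfl
  refine eq_zero_of_polynomial hw T 1 (fun N g hg => ?_) (fun p => ?_) g
  · rw [hT]
    have h1 : ∀ j, pullback φ (pderiv ℝ j g) ∈ filt (fun _ => 1) N := fun j =>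
      pullback_mem_filt hw hφ.filtered (pderiv_mem_filt j hg)
    refine sub_mem (pderiv_mem_filt i (pullback_mem_filt hw hφ.filtered hg)) (add_mem ?_ ?_)
    · exact Ideal.mul_mem_right _ _ (h1 0)
    · exact Ideal.mul_mem_right _ _ (h1 1)
  · induction p using MvPolynomial.induction_on with
    | C a =>
      rw [hT, MvPolynomial.coe_C, pullback_C hφ, pderiv_C, pderiv_C, pderiv_C,
        ← pbHom_apply hφ, map_zero]
      ring
    | add p q hp hq => rw [MvPolynomial.coe_add, map_add, hp, hq, add_zero]
    | mul_X p j hp =>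
      have hX : T (X j) = 0 := by
        rw [hT]
        fin_cases j
        · simp [pullback_X_zero hφ, pullback_one hφ, ← pbHom_apply hφ]
        · simp [pullback_X_one hφ, pullback_one hφ, ← pbHom_apply hφ]
        · have h2 : pderiv ℝ i (X 2 : Series) = 0 := pderiv_X_of_ne hi.symm
          simp [pullback_X_two hφ, h2, ← pbHom_apply hφ]
      rw [hT, sub_eq_zero] at hp hX
      rw [MvPolynomial.coe_mul, MvPolynomial.coe_X, hT, pullback_mul hφ, pderiv_mul, pderiv_mul,
        pderiv_mul, hp, hX]
      simp only [pullback_add hφ, pullback_mul hφ]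
      ring

theorem poisson_pullback (hφ : FixesOrigin φ) (f g : Series) :
    poisson (pullback φ f) (pullback φ g) = pullback φ (poisson f g) * poisson (φ 0) (φ 1) := by
  have h0 : (0 : Fin 3) ≠ 2 := by decide
  have h1 : (1 : Fin 3) ≠ 2 := by decide
  simp only [poisson, pderiv_pullback hφ h0, pderiv_pullback hφ h1, pullback_sub hφ,
    pullback_mul hφ]
  ring

theorem det_jacobian (F : FormalMap) : (jacobian F).det = poisson (F 0) (F 1) := by
  rw [Matrix.det_fin_two]
  simp only [jacobian, Matrix.of_apply, poisson, Fin.castSucc_zero, Fin.castSucc_one]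

theorem det_jacobian_comp (hφ : FixesOrigin φ) (G : FormalMap) :
    (jacobian (comp G φ)).det = pullback φ (jacobian G).det * (jacobian φ).det := by
  simp only [det_jacobian]
  exact poisson_pullback hφ _ _

theorem linearPart_comp (hφ : FixesOrigin φ) (G : FormalMap) :
    linearPart (comp G φ) = linearPart G * linearPart φ := by
  ext i j
  have hj : j.castSucc ≠ (2 : Fin 3) := by fin_cases j <;> decide
  simp only [linearPart, jacobian, Matrix.map_apply, Matrix.of_apply, Matrix.mul_apply,
    Fin.sum_univ_two, comp, pderiv_pullback hφ hj, map_add, map_mul, constantCoeff_pullback hφ,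
    Fin.castSucc_zero, Fin.castSucc_one]

theorem linearPart_apply (F : FormalMap) (i j : Fin 2) :
    linearPart F i j = coeff (Finsupp.single j.castSucc 1) (F i) := by
  rw [linearPart, Matrix.map_apply, jacobian, Matrix.of_apply,
    ← coeff_zero_eq_constantCoeff_apply, coeff_pderiv]
  simp

theorem linearPart_apply_zero (F : FormalMap) (i : Fin 2) :
    linearPart F i 0 = coeff (mon 1 0 0) (F i) := by
  rw [linearPart_apply]; simp [mon]

theorem linearPart_apply_one (F : FormalMap) (i : Fin 2) :
    linearPart F i 1 = coeff (mon 0 1 0) (F i) := by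
  rw [linearPart_apply]; simp [mon]

theorem linearPart_idMap : linearPart idMap = 1 := by
  ext i j
  fin_cases i <;> fin_cases j <;>
  simp [linearPart, jacobian, idMap]

theorem areaPreserving_comp (hφ : FixesOrigin φ) (hG : AreaPreserving G) (hφ' : AreaPreserving φ) :
    AreaPreserving (comp G φ) := by
  have hneg : pullback φ (-1) = -1 := by rw [← pbHom_apply hφ, map_neg, map_one]
  unfold AreaPreserving at *
  rw [det_jacobian_comp hφ]
  rcases hG with h | h <;> rcases hφ' with h' | h' <;>
    simp [h, h', hneg, pullback_one hφ]

theorem IsCanonicalChange.comp (hG : IsCanonicalChange G) (hφ : IsCanonicalChange φ) :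
    IsCanonicalChange (comp G φ) :=
  ⟨hG.1.comp hφ.1, areaPreserving_comp hφ.1 hG.2 hφ.2⟩

/-! ### Inverses and conjugacy -/

theorem IsInverse.symm (hφ : FixesOrigin φ) (h : IsInverse φ ψ) : IsInverse ψ φ :=
  ⟨hφ, h.2.2, h.2.1⟩

theorem isInverse_comp {φ₁ ψ₁ φ₂ ψ₂ : FormalMap} (h₁ : FixesOrigin φ₁) (h₂ : FixesOrigin φ₂)
    (i₁ : IsInverse φ₁ ψ₁) (i₂ : IsInverse φ₂ ψ₂) : IsInverse (comp φ₁ φ₂) (comp ψ₂ ψ₁) := by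
  refine ⟨i₂.1.comp i₁.1, ?_, ?_⟩
  · rw [comp_assoc h₂ (i₂.1.comp i₁.1), ← comp_assoc (F := φ₂) i₂.1 i₁.1, i₂.2.1, idMap_comp i₁.1,
      i₁.2.1]
  · rw [comp_assoc i₁.1 (h₁.comp h₂), ← comp_assoc (F := ψ₁) h₁ h₂, i₁.2.2, idMap_comp h₂, i₂.2.2]

theorem IsCanonicalChange.inverse (hφ : IsCanonicalChange φ) (h : IsInverse φ ψ) :
    IsCanonicalChange ψ := by
  refine ⟨h.1, ?_⟩
  have h1 := det_jacobian_comp h.1 φ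
  have hneg : pullback ψ (-1) = -1 := by rw [← pbHom_apply h.1, map_neg, map_one]
  have hid : (jacobian idMap).det = 1 := by
    rw [det_jacobian]; exact poisson_X_X
  rw [h.2.1, hid] at h1
  rcases hφ.2 with h2 | h2
  · left
    rw [h2, pullback_one h.1, one_mul] at h1
    exact h1.symm
  · right
    rw [h2, hneg] at h1
    linear_combination h1

theorem isCanonicalChange_timeOne (hw : ∀ i, 1 ≤ w i) (hχ : Tame w χ) :
    IsCanonicalChange (timeOne χ) :=
  ⟨(filtered_timeOne hχ).fixesOrigin hw, Or.inl (by rw [det_jacobian, poisson_timeOne hχ])⟩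

theorem isInverse_timeOne (hw : ∀ i, 1 ≤ w i) (hχ : Tame w χ) :
    IsInverse (timeOne χ) (timeOne (-χ)) := by
  refine ⟨(filtered_timeOne hχ.neg).fixesOrigin hw, funext fun i => ?_, funext fun i => ?_⟩
  · exact (pullback_timeOne hw hχ.neg _).trans (expLie_neg_expLie hχ _)
  · exact (pullback_timeOne hw hχ _).trans (expLie_expLie_neg hχ _)

theorem ConjugateBy.symm (hφ : FixesOrigin φ) (hG : FixesOrigin G) (hi : IsInverse φ ψ)
    (h : F = comp ψ (comp G φ)) : G = comp φ (comp F ψ) := by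
  rw [h, comp_assoc (hG.comp hφ) hi.1, comp_assoc hφ hi.1, hi.2.1, comp_idMap,
    ← comp_assoc hi.1 hG, hi.2.1, idMap_comp hG]

theorem ConjugateBy.trans (hφ : FixesOrigin φ) (hθ : FixesOrigin θ) (hH : FixesOrigin H)
    (h₁ : ConjugateBy F φ G) (h₂ : ConjugateBy G θ H) : ConjugateBy F (comp θ φ) H := by
  obtain ⟨ψ, hi, rfl⟩ := h₁
  obtain ⟨η, hi', rfl⟩ := h₂
  refine ⟨comp ψ η, isInverse_comp hθ hφ hi' hi, ?_⟩
  rw [comp_assoc (hH.comp hθ) hφ, comp_assoc hθ hφ,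
    comp_assoc hi'.1 (hH.comp (hθ.comp hφ))]

/-- A substitution of Jacobian `1` respects the bracket, so it intertwines the powers of `lieL h`
with those of `lieL (pullback φ h)`. -/
theorem expLie_pullback (hw : ∀ i, 1 ≤ w i) (hφ : Filtered w φ)
    (hdet : poisson (φ 0) (φ 1) = 1) (hh : Tame w h) (g : Series) :
    pullback φ (expLie h g) = expLie (pullback φ h) (pullback φ g) := by
  have h0 := hφ.fixesOrigin hw
  have hh' : Tame w (pullback φ h) := pullback_mem_filt hw hφ hh
  have hpow : ∀ k, pullback φ ((lieL h ^ k) g) = (lieL (pullback φ h) ^ k) (pullback φ g) := by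
    intro k
    induction k with
    | zero => rfl
    | succ k ih =>
      rw [lieL_pow_succ_apply, lieL_pow_succ_apply, ← ih, poisson_pullback h0, hdet, mul_one]
  refine expLie_eq_of_trunc hh' _ _ fun N => ?_
  have : expTrunc (pullback φ h) N (pullback φ g) = pullback φ (expTrunc h N g) := by
    rw [expTrunc, expTrunc, ← pbHom_apply h0 (Finset.sum _ _), map_sum]
    simp only [pbHom_apply, expTerm_apply, pullback_smul h0, hpow]
  rw [this, ← pullback_sub h0]
  have := pullback_mem_filt hw hφ (expLie_sub_expTrunc hh (mem_filt_zero g) N)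
  rwa [zero_add] at this

/-- This turns conjugacy of time-one maps into a change of variables in the Hamiltonian. It needs
Jacobian `1`, not `-1`. -/
theorem conj_timeOne (hw : ∀ i, 1 ≤ w i) (hφ : Filtered w φ)
    (hdet : poisson (φ 0) (φ 1) = 1) (hh : Tame w h) (hi : IsInverse φ ψ) :
    comp ψ (comp (timeOne h) φ) = timeOne (pullback φ h) := by
  have h0 := hφ.fixesOrigin hw
  have h1 := (filtered_timeOne hh).fixesOrigin hw
  funext i
  change pullback (comp (timeOne h) φ) (ψ i) = expLie (pullback φ h) (X i.castSucc)
  rw [← pullback_pullback h1 h0, pullback_timeOne hw hh, expLie_pullback hw hφ hdet hh]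
  congr 1
  exact congr_fun hi.2.2 i

end FormalNF

end

noncomputable section

namespace FormalNF

open MvPowerSeries

/-! ### Formal logarithms -/

variable {w : Fin 3 → ℕ} {p q r s N : ℕ} {f g χ h h' c ξ η : Series} {φ ψ θ F G H : FormalMap}

/-- Successive approximation in the weighted filtration, with corrections whose coefficients
vanish on `Z`. -/
theorem exists_of_successive (w : Fin 3 → ℕ) (Z : Set (Fin 3 →₀ ℕ)) (P : ℕ → Series → Prop) (m : ℕ)
    (h0 : P 0 0)
    (step : ∀ r c, P r c → ∃ δ ∈ filt w (m + r), (∀ e ∈ Z, coeff e δ = 0) ∧ P (r + 1) (c + δ))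
    (cont : ∀ r c δ, P r c → δ ∈ filt w (m + r) → P r (c + δ)) :
    ∃ c, (∀ e ∈ Z, coeff e c = 0) ∧ ∀ r, P r c := by
  choose δ hδ hZ hP using step
  let S : (r : ℕ) → {c // P r c} := fun r => Nat.rec (motive := fun r => {c // P r c}) ⟨0, h0⟩
    (fun r c => ⟨c.1 + δ r c.1 c.2, hP r c.1 c.2⟩) r
  have hS : ∀ r, (S (r + 1)).1 = (S r).1 + δ r (S r).1 (S r).2 := fun r => rfl
  have hsub : ∀ r k, (S (r + k)).1 - (S r).1 ∈ filt w (m + r) := by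
    intro r k
    induction k with
    | zero => simp
    | succ k ih =>
      rw [← add_assoc, hS, add_sub_right_comm]
      exact add_mem ih (filt_anti (by omega) (hδ _ _ _))
  have hSZ : ∀ r, ∀ e ∈ Z, coeff e (S r).1 = 0 := by
    intro r e he
    induction r with
    | zero => exact map_zero (coeff e)
    | succ r ih => rw [hS, map_add, ih, hZ _ _ _ e he, add_zero]
  -- From stage `wt w e + 1` on, the corrections have weight greater than that of `e`, so the
  -- coefficient at `e` no longer changes.
  let c : Series := fun e => coeff e (S (wt w e + 1)).1
  have hc : ∀ e, coeff e c = coeff e (S (wt w e + 1)).1 := fun e => rfl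
  refine ⟨c, fun e he => by rw [hc, hSZ _ e he], fun r => ?_⟩
  have hcr : c - (S r).1 ∈ filt w (m + r) := by
    intro e he
    rw [map_sub, hc, sub_eq_zero]
    rcases le_total r (wt w e + 1) with h | h
    · obtain ⟨k, hk⟩ := Nat.exists_eq_add_of_le h
      rw [hk]
      exact coeff_eq_of_sub_mem (hsub r k) he
    · obtain ⟨k, hk⟩ := Nat.exists_eq_add_of_le h
      have := coeff_eq_of_sub_mem (hsub (wt w e + 1) k) (e := e) (by omega)
      rw [← hk] at this
      exact this.symm
  have := cont r _ _ (S r).2 hcr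
  rwa [add_sub_cancel] at this

/-- The Poincaré lemma for vector fields which are divergence-free in the leading order. -/
theorem exists_hamiltonian_of_divergence (hξ : ξ ∈ filt w (w 0 + 1 + s))
    (hη : η ∈ filt w (w 1 + 1 + s)) (hdiv : pderiv ℝ 0 ξ + pderiv ℝ 1 η ∈ filt w (2 + s)) :
    ∃ δ ∈ filt w (w 0 + w 1 + 1 + s), pderiv ℝ 1 δ = ξ ∧
      pderiv ℝ 0 δ + η ∈ filt w (w 1 + 2 + s) := by
  rw [mem_filt_iff_mon] at hξ hη hdiv
  -- `δ` is the `y`-integral of `ξ` minus the `x`-integral of `η` restricted to `y = 0`; its terms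
  -- in `ε` alone are set to zero.
  let d : ℕ → ℕ → ℕ → ℝ := fun i j k => match j, i with
    | j + 1, i => coeff (mon i j k) ξ / (j + 1)
    | 0, i + 1 => -coeff (mon i 0 k) η / (i + 1)
    | 0, 0 => 0
  refine ⟨ser d, ?_, ?_, ?_⟩
  · rw [mem_filt_iff_mon]
    intro i j k hw
    rw [coeff_mon_ser]
    rcases j with _ | j
    · rcases i with _ | i
      · rfl
      · change -coeff (mon i 0 k) η / (i + 1) = 0
        rw [hη i 0 k (by rw [mul_add_one] at hw; omega), neg_zero, zero_div]
    · change coeff (mon i j k) ξ / (j + 1) = 0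
      rw [hξ i j k (by rw [mul_add_one] at hw; omega), zero_div]
  · refine ext_mon fun i j k => ?_
    rw [coeff_mon_pderiv_one, coeff_mon_ser]
    change coeff (mon i j k) ξ / (j + 1) * (j + 1) = _
    rw [div_mul_cancel₀]
    positivity
  · rw [mem_filt_iff_mon]
    intro i j k hw
    rw [map_add, coeff_mon_pderiv_zero, coeff_mon_ser]
    rcases j with _ | j
    · change -coeff (mon i 0 k) η / (i + 1) * (i + 1) + _ = 0
      rw [div_mul_cancel₀ _ (by positivity), neg_add_cancel]
    · have := hdiv i j k (by rw [mul_add_one] at hw; omega)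
      rw [map_add, coeff_mon_pderiv_zero, coeff_mon_pderiv_one] at this
      change coeff (mon (i + 1) j k) ξ / (j + 1) * (i + 1) + _ = 0
      have hj : (j + 1 : ℝ) ≠ 0 := by positivity
      field_simp
      linear_combination this

/-- An area-preserving formal map which is tangent to the identity with respect to a weighted
filtration is the time-one map of a formal Hamiltonian. -/
theorem exists_timeOne_eq (h0 : θ 0 - X 0 ∈ filt w (w 0 + 1 + s))
    (h1 : θ 1 - X 1 ∈ filt w (w 1 + 1 + s)) (hdet : poisson (θ 0) (θ 1) = 1) :
    ∃ χ ∈ filt w (w 0 + w 1 + 1 + s), timeOne χ = θ := by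
  have tame : ∀ {χ : Series}, χ ∈ filt w (w 0 + w 1 + 1 + s) → Tame w χ := fun h =>
    filt_anti (by omega) h
  suffices hex : ∃ χ, ∀ r, χ ∈ filt w (w 0 + w 1 + 1 + s) ∧
      θ 0 - timeOne χ 0 ∈ filt w (w 0 + 1 + s + r) ∧
      θ 1 - timeOne χ 1 ∈ filt w (w 1 + 1 + s + r) by
    obtain ⟨χ, hχ⟩ := hex
    refine ⟨χ, (hχ 0).1, funext fun i => ?_⟩
    have : ∀ i, θ i - timeOne χ i = 0 := by
      intro i
      refine eq_zero_of_mem_filt (w := w) fun p => ?_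
      fin_cases i
      · exact filt_anti (by omega) (hχ p).2.1
      · exact filt_anti (by omega) (hχ p).2.2
    exact (sub_eq_zero.mp (this i)).symm
  refine (exists_of_successive w ∅ (fun r χ => χ ∈ filt w (w 0 + w 1 + 1 + s) ∧
    θ 0 - timeOne χ 0 ∈ filt w (w 0 + 1 + s + r) ∧
    θ 1 - timeOne χ 1 ∈ filt w (w 1 + 1 + s + r)) (w 0 + w 1 + 1 + s)
    ⟨zero_mem _, by rwa [timeOne_zero_eq, expLie_zero], by rwa [timeOne_one_eq, expLie_zero]⟩
    ?_ ?_).imp fun χ hχ => hχ.2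
  · rintro r χ ⟨hχ, hξ, hη⟩
    have ht := tame hχ
    have hd : pderiv ℝ 0 (θ 0 - timeOne χ 0) + pderiv ℝ 1 (θ 1 - timeOne χ 1) ∈
        filt w (2 + (s + r)) := by
      -- Both maps have Jacobian `1`. Expanding the brackets around `X 0` and `X 1` leaves for the
      -- divergence of the error only products of small terms.
      have e : pderiv ℝ 0 (θ 0 - timeOne χ 0) + pderiv ℝ 1 (θ 1 - timeOne χ 1) =
          -(poisson (θ 0 - timeOne χ 0) (timeOne χ 1 - X 1) +
            poisson (timeOne χ 0 - X 0) (θ 1 - timeOne χ 1) +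
            poisson (θ 0 - timeOne χ 0) (θ 1 - timeOne χ 1)) := by
        have h2 := poisson_timeOne ht
        simp only [poisson_sub_left, poisson_sub_right] at *
        rw [hdet, h2, poisson_X_zero, poisson_X_zero, poisson_comm _ (X 1), poisson_X_one,
          poisson_comm _ (X 1), poisson_X_one, map_sub, map_sub]
        ring
      rw [e]
      refine neg_mem (add_mem (add_mem ?_ ?_) ?_)
      · exact poisson_mem_filt hξ (timeOne_sub_mem ht).2 (by omega)
      · exact poisson_mem_filt (timeOne_sub_mem ht).1 hη (by omega)
      · exact poisson_mem_filt hξ hη (by omega)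
    rw [add_assoc _ s r] at hξ hη
    -- To leading order, adding `δ` to `χ` adds `δ_y` and `-δ_x` to the two components of the
    -- time-one map, which cancels the error.
    obtain ⟨δ, hδ, hδ1, hδ0⟩ := exists_hamiltonian_of_divergence hξ hη hd
    rw [← add_assoc] at hδ
    have hδ' : δ ∈ filt w (w 0 + w 1 + 1 + s) := filt_anti (by omega) hδ
    have hδ'' : (χ + δ) - χ ∈ filt w (w 0 + w 1 + 1 + (s + r)) := by
      rwa [add_sub_cancel_left, ← add_assoc]
    refine ⟨δ, hδ, by simp, add_mem hχ hδ', ?_, ?_⟩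
    · have := neg_mem (expLie_sub_expLie (tame (add_mem hχ hδ')) ht hδ'' (X_mem_filt w 0))
      rw [add_sub_cancel_left, poisson_X_zero, hδ1] at this
      refine filt_anti (by omega) (?_ : _ ∈ filt w (w 0 + 2 + (s + r)))
      convert this using 1
      simp only [timeOne_zero_eq]
      ring
    · have := sub_mem hδ0 (expLie_sub_expLie (tame (add_mem hχ hδ')) ht hδ'' (X_mem_filt w 1))
      rw [add_sub_cancel_left, poisson_X_one] at this
      refine filt_anti (by omega) (?_ : _ ∈ filt w (w 1 + 2 + (s + r)))
      convert this using 1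
      simp only [timeOne_one_eq]
      ring
  · rintro r χ δ ⟨hχ, hξ, hη⟩ hδ
    have hδ' : δ ∈ filt w (w 0 + w 1 + 1 + s) := filt_anti (by omega) hδ
    have hδ'' : (χ + δ) - χ ∈ filt w (w 0 + w 1 + 1 + (s + r)) := by
      rwa [add_sub_cancel_left, ← add_assoc]
    have key : ∀ i, timeOne (χ + δ) i - timeOne χ i ∈ filt w (w i.castSucc + 1 + (s + r)) :=
      fun i => expLie_sub_expLie_mem (tame (add_mem hχ hδ')) (tame hχ) hδ''
        (X_mem_filt w i.castSucc)
    refine ⟨add_mem hχ hδ', ?_, ?_⟩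
    · have := sub_mem hξ (filt_anti (q := w 0 + 1 + (s + r)) (by omega) (key 0))
      rwa [sub_sub_sub_cancel_right] at this
    · have := sub_mem hη (filt_anti (q := w 1 + 1 + (s + r)) (by omega) (key 1))
      rwa [sub_sub_sub_cancel_right] at this

/-- A series in `ε` alone. -/
def EpsOnly (c : Series) : Prop := ∀ i j k, i ≠ 0 ∨ j ≠ 0 → coeff (mon i j k) c = 0

theorem EpsOnly.pderiv_zero (hc : EpsOnly c) : pderiv ℝ 0 c = 0 :=
  ext_mon fun i j k => by
    rw [coeff_mon_pderiv_zero, hc _ _ _ (Or.inl (Nat.succ_ne_zero i)), zero_mul, map_zero]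

theorem EpsOnly.pderiv_one (hc : EpsOnly c) : pderiv ℝ 1 c = 0 :=
  ext_mon fun i j k => by
    rw [coeff_mon_pderiv_one, hc _ _ _ (Or.inr (Nat.succ_ne_zero j)), zero_mul, map_zero]

theorem EpsOnly.expLie_add (hc : EpsOnly c) (h g : Series) : expLie (h + c) g = expLie h g := by
  refine expLie_congr (fun i => ?_) g
  fin_cases i
  · change pderiv ℝ 0 (h + c) = pderiv ℝ 0 h
    rw [map_add, hc.pderiv_zero, add_zero]
  · change pderiv ℝ 1 (h + c) = pderiv ℝ 1 h
    rw [map_add, hc.pderiv_one, add_zero]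

theorem EpsOnly.timeOne_add (hc : EpsOnly c) (h : Series) : timeOne (h + c) = timeOne h :=
  funext fun _ => hc.expLie_add h _

theorem EpsOnly.poisson_left (hc : EpsOnly c) (g : Series) : poisson c g = 0 := by
  rw [poisson, hc.pderiv_zero, hc.pderiv_one]; ring

/-- The Hamiltonian of a formal time-one map is unique up to a series in `ε`. -/
theorem eq_add_of_timeOne_eq (hh : Tame w h) (hh' : Tame w h') (heq : timeOne h = timeOne h') :
    ∃ c, EpsOnly c ∧ h = h' + c := by
  -- `c` is the part of `h - h'` in `ε` alone, which the time-one map cannot see.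
  let c : Series := ser fun i j k => if i = 0 ∧ j = 0 then coeff (mon 0 0 k) (h - h') else 0
  have hc : EpsOnly c := fun i j k hij => by
    rw [coeff_mon_ser, if_neg (by tauto)]
  have hc0 : ∀ k, coeff (mon 0 0 k) c = coeff (mon 0 0 k) (h - h') := fun k => by
    rw [coeff_mon_ser, if_pos ⟨rfl, rfl⟩]
  have hcw : Tame w c := by
    refine mem_filt_iff_mon.mpr fun i j k hw => ?_
    rw [coeff_mon_ser]
    split_ifs with hij
    · obtain ⟨rfl, rfl⟩ := hij
      exact mem_filt_iff_mon.mp (sub_mem hh hh') 0 0 k hw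
    · rfl
  refine ⟨c, hc, sub_eq_zero.mp ?_⟩
  have hh'' : Tame w (h' + c) := add_mem hh' hcw
  suffices H : ∀ r, h - (h' + c) ∈ filt w (w 0 + w 1 + 1 + r) from
    eq_zero_of_mem_filt (w := w) fun p => filt_anti (by omega) (H p)
  intro r
  induction r with
  | zero => exact sub_mem hh hh''
  | succ r ih =>
    have hi : ∀ i : Fin 2, expLie h (X i.castSucc) - expLie (h' + c) (X i.castSucc) = 0 := by
      intro i
      rw [hc.expLie_add, sub_eq_zero]
      exact congr_fun heq i
    -- The equality of the time-one maps, linearised, says that both derivatives of the leading part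
    -- of `h - (h' + c)` vanish; this part has no terms in `ε` alone, so it is zero.
    have k0 := neg_mem (expLie_sub_expLie hh hh'' ih (X_mem_filt w 0))
    have k1 := expLie_sub_expLie hh hh'' ih (X_mem_filt w 1)
    have hi0 := hi 0
    have hi1 := hi 1
    rw [Fin.castSucc_zero] at hi0
    rw [Fin.castSucc_one] at hi1
    rw [hi0, zero_sub, neg_neg, poisson_X_zero] at k0
    rw [hi1, zero_sub, poisson_X_one, neg_neg] at k1
    refine mem_filt_iff_mon.mpr fun i j k hw => ?_
    rcases i with _ | i
    · rcases j with _ | j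
      · rw [map_sub, map_add, hc0, map_sub]; ring
      · have := mem_filt_iff_mon.mp k0 0 j k (by rw [mul_add_one] at hw; omega)
        rw [coeff_mon_pderiv_one] at this
        exact (mul_eq_zero.mp this).resolve_right (by positivity)
    · have := mem_filt_iff_mon.mp k1 i j k (by rw [mul_add_one] at hw; omega)
      rw [coeff_mon_pderiv_zero] at this
      exact (mul_eq_zero.mp this).resolve_right (by positivity)

end FormalNF

end

noncomputable section

namespace FormalNF

open MvPowerSeries

/-! ### The homological equation -/

variable {n : ℕ} {b : ℝ} {p q r s : ℕ} {f g χ h D : Series}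

/-- The weights for which `y² / 2 + b x ^ n` and `ε` are homogeneous of weight `2 * n`. -/
def wn (n : ℕ) : Fin 3 → ℕ := ![2, n, 2 * n]

@[simp] theorem wn_zero (n : ℕ) : wn n 0 = 2 := rfl
@[simp] theorem wn_one (n : ℕ) : wn n 1 = n := rfl
@[simp] theorem wn_two (n : ℕ) : wn n 2 = 2 * n := rfl

theorem one_le_wn (hn : 1 ≤ n) (i : Fin 3) : 1 ≤ wn n i := by
  fin_cases i
  · exact one_le_two
  · exact hn
  · change 1 ≤ 2 * n
    omega

theorem mem_filt_wn : g ∈ filt (wn n) p ↔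
    ∀ i j k, 2 * i + n * j + 2 * n * k < p → coeff (mon i j k) g = 0 := mem_filt_iff_mon

/-- The leading part `y² / 2 + b x ^ n` of the Hamiltonian. -/
def model (n : ℕ) (b : ℝ) : Series := monomial (mon 0 2 0) (1 / 2) + monomial (mon n 0 0) b

theorem model_mem_filt (n : ℕ) (b : ℝ) : model n b ∈ filt (wn n) (2 * n) := by
  refine add_mem (monomial_mem_filt ?_ _) (monomial_mem_filt ?_ _) <;> rw [wt_mon] <;> simp
  omega

theorem pderiv_zero_model (hn : 1 ≤ n) (b : ℝ) :
    pderiv ℝ 0 (model n b) = monomial (mon (n - 1) 0 0) (n * b) := by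
  refine ext_mon fun i j k => ?_
  rw [coeff_mon_pderiv_zero, model, map_add, coeff_mon_monomial, coeff_mon_monomial,
    coeff_mon_monomial]
  have : (i + 1 = n) ↔ (i = n - 1) := by omega
  simp only [this]
  by_cases h : i = n - 1 ∧ j = 0 ∧ k = 0
  · rw [if_pos h, if_neg (by omega), if_pos h]
    have : (n : ℝ) = i + 1 := by exact_mod_cast (this.mpr h.1).symm
    rw [this]; ring
  · rw [if_neg h, if_neg (by omega), if_neg h]; ring

theorem pderiv_one_model (n : ℕ) (b : ℝ) :
    pderiv ℝ 1 (model n b) = monomial (mon 0 1 0) 1 := by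
  refine ext_mon fun i j k => ?_
  rw [coeff_mon_pderiv_one, model, map_add, coeff_mon_monomial, coeff_mon_monomial,
    coeff_mon_monomial]
  have : (j + 1 = 2) ↔ (j = 1) := by omega
  simp only [this]
  by_cases h : i = 0 ∧ j = 1 ∧ k = 0
  · rw [if_pos h, if_neg (by omega), if_pos h, h.2.1]
    norm_num
  · rw [if_neg h, if_neg (by omega), if_neg h]; ring

/-- The bracket is `n b x ^ (n - 1) δ_y - y δ_x`; its second term does not contribute at `y = 0`. -/
theorem coeff_poisson_model_zero (hn : 1 ≤ n) (b : ℝ) (δ : Series) (i k : ℕ) :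
    coeff (mon i 0 k) (poisson (model n b) δ) =
      if n ≤ i + 1 then n * b * coeff (mon (i + 1 - n) 1 k) δ else 0 := by
  rw [poisson, pderiv_zero_model hn, pderiv_one_model, map_sub, coeff_mon_monomial_mul,
    coeff_mon_monomial_mul, if_neg (by omega : ¬ (0 ≤ i ∧ 1 ≤ 0 ∧ 0 ≤ k)), sub_zero]
  simp only [coeff_mon_pderiv_one, Nat.sub_zero, zero_le, and_true]
  have : n - 1 ≤ i ↔ n ≤ i + 1 := by omega
  simp only [this]
  split_ifs with h
  · rw [show i - (n - 1) = i + 1 - n by omega]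
    push_cast
    ring
  · rfl

theorem coeff_poisson_model_succ (hn : 1 ≤ n) (b : ℝ) (δ : Series) (i j k : ℕ) :
    coeff (mon i (j + 1) k) (poisson (model n b) δ) =
      (if n ≤ i + 1 then n * b * (j + 2) * coeff (mon (i + 1 - n) (j + 2) k) δ else 0) -
        (i + 1) * coeff (mon (i + 1) j k) δ := by
  rw [poisson, pderiv_zero_model hn, pderiv_one_model, map_sub, coeff_mon_monomial_mul,
    coeff_mon_monomial_mul, if_pos (by omega : (0 ≤ i ∧ 1 ≤ j + 1 ∧ 0 ≤ k))]
  simp only [coeff_mon_pderiv_one, coeff_mon_pderiv_zero, Nat.sub_zero, zero_le, and_true,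
    Nat.add_sub_cancel]
  have : n - 1 ≤ i ↔ n ≤ i + 1 := by omega
  simp only [this]
  congr 1
  · split_ifs with h
    · rw [show i - (n - 1) = i + 1 - n by omega, show j + 1 + 1 = j + 2 by ring]
      push_cast
      ring
    · rfl
  · ring

/-- The coefficients of the solution of `g + {y² / 2 + b x ^ n, δ} = U(x, ε)`. -/
def solCoeff (n : ℕ) (b : ℝ) (g : Series) (i j k : ℕ) : ℝ :=
  if _hi : i = 0 then 0 else
    (coeff (mon (i - 1) (j + 1) k) g +
      if h : 0 < n ∧ n ≤ i then n * b * (j + 2) * solCoeff n b g (i - n) (j + 2) k else 0) / i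
termination_by i
decreasing_by omega

theorem solCoeff_zero (n : ℕ) (b : ℝ) (g : Series) (j k : ℕ) : solCoeff n b g 0 j k = 0 := by
  rw [solCoeff, dif_pos rfl]

theorem solCoeff_succ (hn : 1 ≤ n) (b : ℝ) (g : Series) (i j k : ℕ) :
    (i + 1) * solCoeff n b g (i + 1) j k = coeff (mon i (j + 1) k) g +
      if n ≤ i + 1 then n * b * (j + 2) * solCoeff n b g (i + 1 - n) (j + 2) k else 0 := by
  rw [solCoeff, dif_neg (Nat.succ_ne_zero i), Nat.add_sub_cancel]
  push_cast
  rw [mul_div_cancel₀ _ (by positivity)]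
  congr 1
  by_cases h : n ≤ i + 1
  · rw [dif_pos ⟨hn, h⟩, if_pos h]
  · rw [dif_neg (fun hh => h hh.2), if_neg h]

/-- Bracketing with the leading part raises the weight by `2n - (n + 2) = n - 2`. The recursion
passes from `x ^ (i + 1) y ^ j` to `x ^ (i + 1 - n) y ^ (j + 2)`, which has the same weight. -/
theorem solCoeff_eq_zero (hn : 3 ≤ n) (hg : g ∈ filt (wn n) (q + (n - 2))) (i : ℕ) :
    ∀ j k, 2 * i + n * j + 2 * n * k < q → solCoeff n b g i j k = 0 := by
  rw [mem_filt_wn] at hg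
  induction i using Nat.strong_induction_on with
  | _ i ih =>
    intro j k hw
    rcases i with _ | i
    · exact solCoeff_zero ..
    · have h := solCoeff_succ (by omega : 1 ≤ n) b g i j k
      rw [hg i (j + 1) k (by rw [mul_add_one]; omega), zero_add] at h
      have h2 : (if n ≤ i + 1 then n * b * (j + 2) * solCoeff n b g (i + 1 - n) (j + 2) k
          else 0) = 0 := by
        split_ifs with hi
        · rw [ih (i + 1 - n) (by omega) (j + 2) k (by rw [mul_add]; omega), mul_zero]
        · rfl
      rw [h2] at h
      exact (mul_eq_zero.mp h).resolve_left (by positivity)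

/-- Every series is a function of `x` and `ε` modulo the Poisson brackets with the leading part
of the Hamiltonian. -/
theorem exists_homological (hn : 3 ≤ n) (b : ℝ) (hg : g ∈ filt (wn n) (q + (n - 2))) :
    ∃ δ ∈ filt (wn n) q, (∀ j k, coeff (mon 0 (2 * j) k) δ = 0) ∧
      ∀ i j k, coeff (mon i (j + 1) k) (g + poisson (model n b) δ) = 0 := by
  -- The recursion leaves the coefficients on `x = 0` free, and `solCoeff` makes them zero. In
  -- particular `δ` has no `y²` term, which later keeps the linear part of the change trivial.
  refine ⟨ser (solCoeff n b g), ?_, fun j k => ?_, fun i j k => ?_⟩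
  · rw [mem_filt_wn]
    intro i j k hw
    rw [coeff_mon_ser]
    exact solCoeff_eq_zero hn hg i j k hw
  · rw [coeff_mon_ser, solCoeff_zero]
  · rw [map_add, coeff_poisson_model_succ (by omega)]
    simp only [coeff_mon_ser]
    rw [solCoeff_succ (by omega) b g i j k]
    ring

/-- The coefficients of the solutions of `{y² / 2 + b x ^ n, δ} = x ^ (n * a + n - 1)`. -/
def chainCoeff (n : ℕ) (b : ℝ) : ℕ → ℕ → ℝ
  | _, 0 => 1 / (n * b)
  | a, l + 1 => chainCoeff n b (a + 1) l * (n * (a + 1)) / (n * b * (2 * l + 3))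

/-- If `b ≠ 0`, then moreover the powers `x ^ i` with `i ≡ -1 mod n` can be removed. -/
theorem exists_homological' (hn : 3 ≤ n) (hb : b ≠ 0) (hg : g ∈ filt (wn n) (q + (n - 2))) :
    ∃ δ ∈ filt (wn n) q, (∀ j k, coeff (mon 0 (2 * j) k) δ = 0) ∧
      (∀ i j k, coeff (mon i (j + 1) k) (g + poisson (model n b) δ) = 0) ∧
      ∀ i k, n ∣ i + 1 → coeff (mon i 0 k) (g + poisson (model n b) δ) = 0 := by
  obtain ⟨δ, hδ, hδ0, hδ1⟩ := exists_homological hn b hg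
  set U := g + poisson (model n b) δ with hU
  have hUw : U ∈ filt (wn n) (q + (n - 2)) :=
    add_mem hg (poisson_mem_filt (model_mem_filt n b) hδ (by simp; omega))
  have hn0 : (n : ℝ) ≠ 0 := by positivity
  -- The chain removing `x ^ (n N + n - 1)` consists of the monomials `x ^ (n a) y ^ (2 l + 1)` with
  -- `a + l = N`. It begins with `x ^ (n N) y / (n b)`, each term cancels the remainder left by the
  -- previous one, and it ends at `a = 0`.
  let c : ℕ → ℕ → ℕ → ℝ := fun i j k => if n ∣ i ∧ j % 2 = 1 then
    -(coeff (mon (i + n * (j / 2) + (n - 1)) 0 k) U * chainCoeff n b (i / n) (j / 2)) else 0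
  have hc0 : ∀ i j k, ¬ (n ∣ i ∧ j % 2 = 1) → c i j k = 0 := fun i j k h => if_neg h
  have hc1 : ∀ a l k, c (n * a) (2 * l + 1) k =
      -(coeff (mon (n * (a + l) + (n - 1)) 0 k) U * chainCoeff n b a l) := by
    intro a l k
    have h2 : (2 * l + 1) / 2 = l := by omega
    simp only [c]
    rw [if_pos ⟨dvd_mul_right _ _, by omega⟩, h2, Nat.mul_div_cancel_left _ (by omega), mul_add]
  have hsum : ∀ e, coeff e (g + poisson (model n b) (δ + ser c)) =
      coeff e U + coeff e (poisson (model n b) (ser c)) := by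
    intro e
    rw [poisson_add_right, ← add_assoc, ← hU, map_add]
  refine ⟨δ + ser c, add_mem hδ ?_, fun j k => ?_, fun i j k => ?_, fun i k hi => ?_⟩
  · rw [mem_filt_wn] at hUw ⊢
    intro i j k hw
    rw [coeff_mon_ser]
    by_cases h : n ∣ i ∧ j % 2 = 1
    · obtain ⟨⟨a, rfl⟩, hj⟩ := h
      obtain ⟨l, rfl⟩ : ∃ l, j = 2 * l + 1 := ⟨j / 2, by omega⟩
      rw [hc1, hUw, zero_mul, neg_zero]
      have e1 : n * (2 * l + 1) = 2 * (n * l) + n := by ring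
      have e2 : n * (a + l) = n * a + n * l := by ring
      omega
    · exact hc0 i j k h
  · rw [map_add, hδ0, coeff_mon_ser, hc0 _ _ _ (by omega), add_zero]
  · rw [hsum, hδ1, zero_add, coeff_poisson_model_succ (by omega)]
    simp only [coeff_mon_ser]
    -- On a chain the two terms of the bracket cancel by the recursion for `chainCoeff`. Off the
    -- chains both vanish, since subtracting `n` from `i + 1` and adding `2` to `j` preserves the
    -- two conditions.
    by_cases h : n ∣ i + 1 ∧ j % 2 = 1
    · obtain ⟨⟨a, ha⟩, hj⟩ := h
      obtain ⟨l, rfl⟩ : ∃ l, j = 2 * l + 1 := ⟨j / 2, by omega⟩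
      obtain ⟨a, rfl⟩ : ∃ a', a = a' + 1 := Nat.exists_eq_succ_of_ne_zero (by rintro rfl; omega)
      have ha' : (i : ℝ) + 1 = n * (a + 1) := by exact_mod_cast ha
      rw [ha', ha, if_pos (by rw [mul_add]; omega), show n * (a + 1) - n = n * a by
        rw [mul_add]; omega, show 2 * l + 1 + 2 = 2 * (l + 1) + 1 by ring, hc1, hc1, chainCoeff,
        show a + (l + 1) = a + 1 + l by ring]
      push_cast
      have : (2 * (l : ℝ) + 3) ≠ 0 := by positivity
      field_simp
      ring
    · rw [hc0 (i + 1) j k h, mul_zero, sub_zero]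
      split_ifs with hi
      · rw [hc0, mul_zero]
        rintro ⟨h1, h2⟩
        refine h ⟨?_, by omega⟩
        have := dvd_add h1 (dvd_refl n)
        rwa [Nat.sub_add_cancel hi] at this
      · rfl
  · rw [hsum, coeff_poisson_model_zero (by omega)]
    obtain ⟨a, ha⟩ := hi
    obtain ⟨a, rfl⟩ : ∃ a', a = a' + 1 := Nat.exists_eq_succ_of_ne_zero (by rintro rfl; omega)
    rw [mul_add_one] at ha
    rw [if_pos (by omega), coeff_mon_ser, show i + 1 - n = n * a by omega]
    have := hc1 a 0 k
    rw [mul_zero, zero_add, add_zero, show n * a + (n - 1) = i by omega] at this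
    rw [this, chainCoeff]
    field_simp
    ring

/-- Suppose that in the leading order the bracket of `χ` with the Hamiltonian is a function of `x`
and `ε` without the powers `x ^ i`, `i ≡ -1 mod n`. Then the leading order of `χ` is determined by
its restriction to `x = 0`. -/
theorem kernel_homological (hn : 3 ≤ n) (hb : b ≠ 0)
    (hD : ∀ i j k, 2 * i + n * j + 2 * n * k = q + (n - 2) →
      coeff (mon i j k) (poisson (model n b) χ) = coeff (mon i j k) D)
    (hD1 : ∀ i j k, coeff (mon i (j + 1) k) D = 0)
    (hD2 : ∀ i k, n ∣ i + 1 → coeff (mon i 0 k) D = 0)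
    (h0 : ∀ l k, n * (2 * l) + 2 * n * k = q → coeff (mon 0 (2 * l) k) χ = 0) :
    ∀ i j k, 2 * i + n * j + 2 * n * k = q → coeff (mon i j k) χ = 0 := by
  have hn1 : 1 ≤ n := by omega
  have hn0 : (n : ℝ) ≠ 0 := by positivity
  have rec' : ∀ i j k, 2 * (i + 1) + n * j + 2 * n * k = q →
      (i + 1) * coeff (mon (i + 1) j k) χ =
        if n ≤ i + 1 then n * b * (j + 2) * coeff (mon (i + 1 - n) (j + 2) k) χ else 0 := by
    intro i j k hw
    have := hD i (j + 1) k (by rw [mul_add_one]; omega)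
    rw [hD1, coeff_poisson_model_succ hn1] at this
    linear_combination -this
  -- The recursion lowers `i` by `n`. Outside the multiples of `n` it ends at some `0 < i < n`,
  -- where it forces the coefficient to vanish.
  have hA : ∀ i j k, 2 * i + n * j + 2 * n * k = q → ¬ n ∣ i → coeff (mon i j k) χ = 0 := by
    intro i
    induction i using Nat.strong_induction_on with
    | _ i ih =>
      intro j k hw hi
      rcases i with _ | i
      · exact absurd (dvd_zero n) hi
      · have h := rec' i j k hw
        have h2 : (if n ≤ i + 1 then n * b * (j + 2) * coeff (mon (i + 1 - n) (j + 2) k) χ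
            else 0) = 0 := by
          split_ifs with hni
          · rw [ih (i + 1 - n) (by omega) (j + 2) k (by rw [mul_add]; omega), mul_zero]
            intro h1
            have := dvd_add h1 (dvd_refl n)
            rw [Nat.sub_add_cancel hni] at this
            exact hi this
          · rfl
        rw [h2] at h
        exact (mul_eq_zero.mp h).resolve_left (by positivity)
  -- In this weight `D` vanishes on `y = 0`: the powers with `n ∣ i + 1` are absent by hypothesis,
  -- and the others come from coefficients of `χ` killed by `hA`.
  have hB : ∀ i k, 2 * i + 2 * n * k = q + (n - 2) → coeff (mon i 0 k) D = 0 := by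
    intro i k hw
    by_cases hi : n ∣ i + 1
    · exact hD2 i k hi
    · have := hD i 0 k (by omega)
      rw [← this, coeff_poisson_model_zero hn1]
      split_ifs with hni
      · rw [hA (i + 1 - n) 1 k (by omega), mul_zero]
        intro h1
        have := dvd_add h1 (dvd_refl n)
        rw [Nat.sub_add_cancel hni] at this
        exact hi this
      · rfl
  -- For `y¹` this is the bracket at `y = 0`, solved using `b ≠ 0`; the recursion, read backwards,
  -- then raises the power of `y` by two.
  have hodd : ∀ l i k, 2 * i + n * (2 * l + 1) + 2 * n * k = q →
      coeff (mon i (2 * l + 1) k) χ = 0 := by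
    intro l
    induction l with
    | zero =>
      intro i k hw
      have h1 := hD (i + n - 1) 0 k (by omega)
      rw [hB _ _ (by omega), coeff_poisson_model_zero hn1, if_pos (by omega),
        show i + n - 1 + 1 - n = i by omega] at h1
      exact (mul_eq_zero.mp h1).resolve_left (mul_ne_zero hn0 hb)
    | succ l ih =>
      intro i k hw
      have e : n * (2 * (l + 1) + 1) = n * (2 * l + 1) + 2 * n := by ring
      have h1 := rec' (i + n - 1) (2 * l + 1) k (by omega)
      rw [show i + n - 1 + 1 = i + n by omega, ih (i + n) k (by omega), if_pos (by omega),
        Nat.add_sub_cancel, mul_zero] at h1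
      refine (mul_eq_zero.mp h1.symm).resolve_left (mul_ne_zero (mul_ne_zero hn0 hb) ?_)
      positivity
  -- Everything is now determined by `x = 0`, where the odd powers of `y` vanish by `hodd` and the
  -- even ones by `h0`.
  intro i
  induction i using Nat.strong_induction_on with
  | _ i ih =>
    intro j k hw
    rcases i with _ | i
    · obtain ⟨l, hl | hl⟩ := Nat.even_or_odd' j
      · subst hl
        exact h0 l k (by omega)
      · subst hl
        exact hodd l 0 k hw
    · have h := rec' i j k hw
      have h2 : (if n ≤ i + 1 then n * b * (j + 2) * coeff (mon (i + 1 - n) (j + 2) k) χ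
          else 0) = 0 := by
        split_ifs with hni
        · rw [ih (i + 1 - n) (by omega) (j + 2) k (by rw [mul_add]; omega), mul_zero]
        · rfl
      rw [h2] at h
      exact (mul_eq_zero.mp h).resolve_left (by positivity)

/-- Simplification of a Hamiltonian with the leading part `y² / 2 + b x ^ n` by a formal canonical
change, when the homological equation can be solved up to the monomials which are not `bad`. -/
theorem exists_simplification (hn : 3 ≤ n) {h₀ c : Series} (bad : ℕ → ℕ → ℕ → Prop)
    (hsolve : ∀ q g, g ∈ filt (wn n) (q + (n - 2)) →
      ∃ δ ∈ filt (wn n) q, (∀ j k, coeff (mon 0 (2 * j) k) δ = 0) ∧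
        ∀ i j k, bad i j k → coeff (mon i j k) (g + poisson (model n b) δ) = 0)
    (hc : EpsOnly c) (hcw : c ∈ filt (wn n) (2 * n)) (h₀eq : h₀ = model n b + c)
    (hh : h - h₀ ∈ filt (wn n) (2 * n + 1)) :
    ∃ χ, Tame (wn n) χ ∧ (∀ j k, coeff (mon 0 (2 * j) k) χ = 0) ∧
      expLie χ h - h₀ ∈ filt (wn n) (2 * n + 1) ∧
      ∀ i j k, bad i j k → coeff (mon i j k) (expLie χ h - h₀) = 0 := by
  have hh0 : h₀ ∈ filt (wn n) (2 * n) := h₀eq ▸ add_mem (model_mem_filt n b) hcw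
  have hhw : h ∈ filt (wn n) (2 * n) := mem_filt_of_sub_mem (filt_anti (by omega) hh) hh0
  have hT : ∀ {χ}, χ ∈ filt (wn n) (n + 3) ↔ Tame (wn n) χ := by
    intro χ
    rw [Tame, wn_zero, wn_one, show 2 + n + 1 = n + 3 by ring]
  -- A correction `δ` of weight `n + 3 + r` acts on the Hamiltonian through `{h, δ}`, of weight `2n
  -- + 1 + r`, up to terms of weight `2n + 2 + r`.
  have key : ∀ r χ δ, χ ∈ filt (wn n) (n + 3) → δ ∈ filt (wn n) (n + 3 + r) →
      expLie (χ + δ) h - expLie χ h - poisson h δ ∈ filt (wn n) (2 * n + 2 + r) := by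
    intro r χ δ hχ hδ
    have := expLie_sub_expLie (r := r)
      (hT.mp (add_mem hχ (filt_anti (by omega) hδ))) (hT.mp hχ)
      (by rw [add_sub_cancel_left, wn_zero, wn_one]; exact filt_anti (by omega) hδ) hhw
    rwa [add_sub_cancel_left] at this
  suffices hex : ∃ χ, (∀ e ∈ {e | ∃ j k, e = mon 0 (2 * j) k}, coeff e χ = 0) ∧
      ∀ r, χ ∈ filt (wn n) (n + 3) ∧ ∀ i j k, bad i j k →
        2 * i + n * j + 2 * n * k < 2 * n + 1 + r → coeff (mon i j k) (expLie χ h - h₀) = 0 by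
    obtain ⟨χ, hχZ, hχ⟩ := hex
    refine ⟨χ, hT.mp (hχ 0).1, fun j k => hχZ _ ⟨j, k, rfl⟩, ?_, fun i j k hb =>
      (hχ (2 * i + n * j + 2 * n * k)).2 i j k hb (by omega)⟩
    have := add_mem (expLie_sub_self (hT.mp (hχ 0).1) hhw) hh
    rwa [sub_add_sub_cancel] at this
  refine exists_of_successive (wn n) {e | ∃ j k, e = mon 0 (2 * j) k}
    (fun r χ => χ ∈ filt (wn n) (n + 3) ∧ ∀ i j k, bad i j k →
      2 * i + n * j + 2 * n * k < 2 * n + 1 + r → coeff (mon i j k) (expLie χ h - h₀) = 0) (n + 3)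
    ⟨zero_mem _, fun i j k _ hw => by
      rw [expLie_zero]; exact mem_filt_wn.mp hh i j k hw⟩ ?_ ?_
  · rintro r χ ⟨hχ, hbad⟩
    classical
    -- `g` is the unwanted part of the current error. In the leading weight `{h, δ}` is the bracket
    -- with `model n b`, because `c` commutes with everything.
    let g : Series := ser fun i j k =>
      if bad i j k then coeff (mon i j k) (expLie χ h - h₀) else 0
    have hg : g ∈ filt (wn n) (n + 3 + r + (n - 2)) := by
      rw [mem_filt_wn]
      intro i j k hw
      rw [coeff_mon_ser]
      split_ifs with hb
      · exact hbad i j k hb (by omega)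
      · rfl
    obtain ⟨δ, hδ, hδ0, hδ1⟩ := hsolve _ g hg
    refine ⟨δ, hδ, ?_, add_mem hχ (filt_anti (by omega) hδ), fun i j k hb hw => ?_⟩
    · rintro e ⟨j, k, rfl⟩
      exact hδ0 j k
    · have h1 := mem_filt_wn.mp (key r χ δ hχ hδ) i j k (by omega)
      have h2 := mem_filt_wn.mp (poisson_mem_filt (r := 2 * n + 2 + r) hh hδ
        (by rw [wn_zero, wn_one]; omega)) i j k (by omega)
      have h3 := hδ1 i j k hb
      rw [map_add, coeff_mon_ser, if_pos hb] at h3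
      rw [poisson_sub_left, h₀eq, poisson_add_left, hc.poisson_left, add_zero] at h2
      simp only [map_sub] at h1 h2 h3 ⊢
      linear_combination h1 + h2 + h3
  · rintro r χ δ ⟨hχ, hbad⟩ hδ
    refine ⟨add_mem hχ (filt_anti (by omega) hδ), fun i j k hb hw => ?_⟩
    have h1 := mem_filt_wn.mp (key r χ δ hχ hδ) i j k (by omega)
    have h2 := mem_filt_wn.mp (poisson_mem_filt (r := 2 * n + 1 + r) hhw hδ
      (by rw [wn_zero, wn_one]; omega)) i j k (by omega)
    have h3 := hbad i j k hb hw
    simp only [map_sub] at h1 h2 h3 ⊢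
    linear_combination h1 + h2 + h3

end FormalNF

end

noncomputable section

namespace FormalNF

open MvPowerSeries

/-! ### Hamiltonians of the simplified form -/

variable {w : Fin 3 → ℕ} {n : ℕ} {b : ℝ} {f g χ h : Series} {φ φ₀ ψ θ F G : FormalMap}
  {u u₀ : ℕ → ℕ → ℝ}

theorem coeff_potential (u : ℕ → ℕ → ℝ) (i j k : ℕ) :
    coeff (mon i j k) (potential u) = if j = 0 then u i k else 0 := by
  change (if mon i j k 1 = 0 then u (mon i j k 0) (mon i j k 2) else 0) = _
  simp

theorem hamiltonian_eq (u : ℕ → ℕ → ℝ) :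
    hamiltonian u = monomial (mon 0 2 0) (1 / 2) + potential u := by
  rw [hamiltonian, X_one_pow_eq, ← smul_eq_C_mul, ← map_smul, smul_eq_mul, mul_one]

theorem coeff_hamiltonian_zero (u : ℕ → ℕ → ℝ) (i k : ℕ) :
    coeff (mon i 0 k) (hamiltonian u) = u i k := by
  rw [hamiltonian_eq, map_add, coeff_potential, coeff_mon_monomial, if_pos rfl, if_neg (by omega),
    zero_add]

theorem coeff_hamiltonian_succ (u : ℕ → ℕ → ℝ) (i j k : ℕ) :
    coeff (mon i (j + 1) k) (hamiltonian u) = if i = 0 ∧ j = 1 ∧ k = 0 then 1 / 2 else 0 := by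
  rw [hamiltonian_eq, map_add, coeff_potential, coeff_mon_monomial, if_neg (Nat.succ_ne_zero j),
    add_zero]
  simp only [Nat.reduceEqDiff]

theorem coeff_model_zero (n : ℕ) (b : ℝ) (i k : ℕ) :
    coeff (mon i 0 k) (model n b) = if i = n ∧ k = 0 then b else 0 := by
  rw [model, map_add, coeff_mon_monomial, coeff_mon_monomial, if_neg (by omega), zero_add]
  simp

theorem coeff_model_succ (n : ℕ) (b : ℝ) (i j k : ℕ) :
    coeff (mon i (j + 1) k) (model n b) = if i = 0 ∧ j = 1 ∧ k = 0 then 1 / 2 else 0 := by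
  rw [model, map_add, coeff_mon_monomial, coeff_mon_monomial,
    if_neg (by omega : ¬ (i = n ∧ j + 1 = 0 ∧ k = 0)), add_zero]
  simp only [Nat.reduceEqDiff]

theorem coeff_eps (a : ℝ) (i j k : ℕ) :
    coeff (mon i j k) (C a * X 2 : Series) = if i = 0 ∧ j = 0 ∧ k = 1 then a else 0 := by
  have : (C a * X 2 : Series) = monomial (mon 0 0 1) a := by
    rw [← pow_one (X 2 : Series), X_two_pow_eq, ← smul_eq_C_mul, ← map_smul, smul_eq_mul, mul_one]
  rw [this, coeff_mon_monomial]

theorem epsOnly_eps (a : ℝ) : EpsOnly (C a * X 2) := fun i j k hij => by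
  rw [coeff_eps, if_neg (by omega)]

theorem eps_mem_filt (w : Fin 3 → ℕ) (a : ℝ) : (C a * X 2 : Series) ∈ filt w (w 2) :=
  Ideal.mul_mem_left _ _ (X_mem_filt w 2)

theorem tame_of_mem_filt_two_mul (hn : 3 ≤ n) (hh : h ∈ filt (wn n) (2 * n)) : Tame (wn n) h :=
  filt_anti (by rw [wn_zero, wn_one]; omega) hh

/-- A formal canonical change of the Hamiltonian. -/
theorem conjugateBy_expLie (hw : ∀ i, 1 ≤ w i) (hφ₀ : FixesOrigin φ₀) (hh : Tame w h)
    (hχ : Tame w χ) (hF : ConjugateBy F φ₀ (timeOne h)) :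
    ConjugateBy F (comp (timeOne (-χ)) φ₀) (timeOne (expLie χ h)) := by
  have h0 := (filtered_timeOne hχ).fixesOrigin hw
  have hi := isInverse_timeOne hw hχ
  have hh' : Tame w (expLie χ h) := expLie_mem_filt hχ hh
  have h1 := conj_timeOne hw (filtered_timeOne hχ) (poisson_timeOne hχ) hh hi
  rw [pullback_timeOne hw hχ] at h1
  have h2 := ConjugateBy.symm h0 ((filtered_timeOne hh).fixesOrigin hw) hi h1.symm
  exact ConjugateBy.trans hφ₀ hi.1 ((filtered_timeOne hh').fixesOrigin hw) hF
    ⟨_, hi.symm h0, h2⟩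

theorem linearPart_eq_one_of_sub_mem (h : ∀ i, θ i - X i.castSucc ∈ filt ![1, 1, 3] 2) :
    linearPart θ = 1 := by
  have key : ∀ i j, coeff (Finsupp.single (Fin.castSucc j) 1) (θ i) =
      coeff (Finsupp.single (Fin.castSucc j) 1) (idMap i) := by
    intro i j
    refine coeff_eq_of_sub_mem (h i) ?_
    rw [wt_single]
    fin_cases j <;> simp
  rw [← linearPart_idMap]
  ext i j
  rw [linearPart_apply, linearPart_apply, key]

/-- At `ε = 0`, tameness excludes from `χ` all monomials of degree at most two except `y²`, and `h0`
excludes that one. The weights `1, 1, 3` record that no such term is left, with `ε` too heavy to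
interfere. -/
theorem linearPart_timeOne_eq_one (hn : 3 ≤ n) (hχ : Tame (wn n) χ)
    (h0 : ∀ j k, coeff (mon 0 (2 * j) k) χ = 0) : linearPart (timeOne χ) = 1 := by
  have hχ' : Tame ![1, 1, 3] χ := by
    refine mem_filt_iff_mon.mpr fun i j k hw => ?_
    simp only [Matrix.cons_val_zero, Matrix.cons_val_one, Matrix.cons_val] at hw
    obtain rfl : k = 0 := by omega
    by_cases hj : j = 2
    · obtain rfl : i = 0 := by omega
      subst hj
      exact h0 1 0
    · refine mem_filt_wn.mp hχ i j 0 ?_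
      rw [wn_zero, wn_one]
      have : j = 0 ∨ j = 1 := by omega
      rcases this with rfl | rfl <;> omega
  refine linearPart_eq_one_of_sub_mem fun i => ?_
  refine filt_anti ?_ (expLie_sub_self hχ' (X_mem_filt _ i.castSucc))
  fin_cases i <;> simp

/-- Removal of the powers `x ^ k` with `k ≡ -1 mod n`. -/
theorem exists_normalForm (hn : 3 ≤ n) (hN : Normalises φ₀ F u₀)
    (hlow : ∀ k < n, u₀ k 0 = 0) (hlead : u₀ n 0 = b) (hb : b ≠ 0) :
    ∃ (θ φ : FormalMap) (u : ℕ → ℕ → ℝ), IsNormalForm n b u ∧ IsCanonicalChange θ ∧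
      linearPart θ = 1 ∧ pullback θ (hamiltonian u₀) = hamiltonian u + C (u₀ 0 1) * X 2 ∧
      comp θ φ = φ₀ ∧ Normalises φ F u := by
  have hw : ∀ i, 1 ≤ wn n i := one_le_wn (by omega)
  -- This term has the weight `2n` of the leading part but is not admitted in the normal form; being
  -- central for the bracket, it is carried along unchanged.
  set c : Series := C (u₀ 0 1) * X 2 with hcdef
  have hc : EpsOnly c := epsOnly_eps _
  have hcw : c ∈ filt (wn n) (2 * n) := eps_mem_filt _ _
  have hh : hamiltonian u₀ - (model n b + c) ∈ filt (wn n) (2 * n + 1) := by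
    rw [mem_filt_wn]
    intro i j k hwt
    rw [map_sub, map_add, hcdef, coeff_eps]
    rcases j with _ | j
    · rw [coeff_hamiltonian_zero, coeff_model_zero]
      rcases k with _ | k
      · rw [if_neg (by omega : ¬ (i = 0 ∧ 0 = 0 ∧ 0 = 1)), add_zero]
        rcases lt_or_eq_of_le (by omega : i ≤ n) with hi | rfl
        · rw [hlow i hi, if_neg (by omega), sub_zero]
        · rw [if_pos ⟨rfl, rfl⟩, hlead, sub_self]
      · rw [mul_add_one] at hwt
        obtain rfl : k = 0 := by
          by_contra hk
          have : 2 * n ≤ 2 * n * k := Nat.le_mul_of_pos_right _ (by omega)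
          omega
        obtain rfl : i = 0 := by omega
        simp
    · rw [coeff_hamiltonian_succ, coeff_model_succ, if_neg (by omega : ¬ (i = 0 ∧ j + 1 = 0 ∧ k = 1))]
      ring
  have hhw : hamiltonian u₀ ∈ filt (wn n) (2 * n) :=
    mem_filt_of_sub_mem (filt_anti (by omega) hh) (add_mem (model_mem_filt n b) hcw)
  obtain ⟨χ, hχ, hχ0, hlow', hbad⟩ := exists_simplification hn (h := hamiltonian u₀)
    (fun i j _ => j ≠ 0 ∨ n ∣ i + 1) (fun q g hg => by
      obtain ⟨δ, hδ, h0, h1, h2⟩ := exists_homological' hn hb hg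
      refine ⟨δ, hδ, h0, fun i j k hij => ?_⟩
      rcases j with _ | j
      · exact h2 i k (hij.resolve_left (by simp))
      · exact h1 i j k) hc hcw rfl hh
  set h' := expLie χ (hamiltonian u₀) with hh'
  let u : ℕ → ℕ → ℝ := fun i k => coeff (mon i 0 k) h' - coeff (mon i 0 k) c
  have hu : hamiltonian u + c = h' := by
    refine ext_mon fun i j k => ?_
    rw [map_add]
    rcases j with _ | j
    · rw [coeff_hamiltonian_zero]
      simp only [u]
      ring
    · have := hbad i (j + 1) k (Or.inl (Nat.succ_ne_zero j))
      rw [map_sub, map_add, coeff_model_succ] at this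
      rw [coeff_hamiltonian_succ]
      linear_combination -this
  have h0 := (filtered_timeOne hχ).fixesOrigin hw
  have hi := isInverse_timeOne hw hχ
  have hu' : ∀ k m, coeff (mon k 0 m) (h' - (model n b + c)) = 0 → (k, m) ≠ (n, 0) → u k m = 0 := by
    intro k m h1 h2
    rw [map_sub, map_add, coeff_model_zero, if_neg (by simpa using h2)] at h1
    simp only [u]
    linear_combination h1
  refine ⟨timeOne χ, comp (timeOne (-χ)) φ₀, u, ⟨hn, hb, ?_, ?_⟩, isCanonicalChange_timeOne hw hχ,
    linearPart_timeOne_eq_one hn hχ hχ0, ?_, ?_, ?_, ?_⟩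
  · have := mem_filt_wn.mp hlow' n 0 0 (by omega)
    rw [map_sub, map_add, coeff_model_zero, if_pos ⟨rfl, rfl⟩] at this
    simp only [u]
    linear_combination this
  · intro k m hne hkm
    refine hu' k m ?_ hne
    by_cases hk : k + n * m > n
    · refine hbad k 0 m (Or.inr ?_)
      have h1 : (k : ℤ) ≡ -1 [ZMOD n] := by tauto
      have h2 := h1.symm.dvd
      rw [sub_neg_eq_add] at h2
      exact_mod_cast h2
    · exact mem_filt_wn.mp hlow' k 0 m (by rw [mul_assoc]; omega)
  · rw [pullback_timeOne hw hχ, ← hh', hu]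
  · rw [← comp_assoc hi.1 hN.1.1, hi.2.1, idMap_comp hN.1.1]
  · exact (isCanonicalChange_timeOne hw hχ.neg).comp hN.1
  · have := conjugateBy_expLie hw hN.1.1 (tame_of_mem_filt_two_mul hn hhw) hχ hN.2
    rwa [← hh', ← hu, hc.timeOne_add] at this

/-! ### Linear changes -/

/-- The linear map with the matrix `P`. -/
def linMap (P : Matrix (Fin 2) (Fin 2) ℝ) : FormalMap := fun i => P i 0 • X 0 + P i 1 • X 1

theorem fixesOrigin_linMap (P : Matrix (Fin 2) (Fin 2) ℝ) : FixesOrigin (linMap P) := fun i => by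
  simp [linMap, smul_eq_C_mul]

theorem comp_linMap (P : Matrix (Fin 2) (Fin 2) ℝ) (hφ : FixesOrigin φ) (i : Fin 2) :
    comp (linMap P) φ i = P i 0 • φ 0 + P i 1 • φ 1 := by
  simp only [comp, linMap, pullback_add hφ, pullback_smul hφ, pullback_X_zero hφ,
    pullback_X_one hφ]

theorem linMap_mul (P Q : Matrix (Fin 2) (Fin 2) ℝ) :
    comp (linMap P) (linMap Q) = linMap (P * Q) := by
  funext i
  rw [comp_linMap P (fixesOrigin_linMap Q)]
  simp only [linMap, Matrix.mul_apply, Fin.sum_univ_two]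
  module

theorem linMap_one : linMap 1 = idMap := by
  funext i
  fin_cases i
  · change (1 : Matrix (Fin 2) (Fin 2) ℝ) 0 0 • X 0 + (1 : Matrix (Fin 2) (Fin 2) ℝ) 0 1 • X 1 = X 0
    simp
  · change (1 : Matrix (Fin 2) (Fin 2) ℝ) 1 0 • X 0 + (1 : Matrix (Fin 2) (Fin 2) ℝ) 1 1 • X 1 = X 1
    simp

theorem isInverse_linMap {P Q : Matrix (Fin 2) (Fin 2) ℝ} (h : P * Q = 1) :
    IsInverse (linMap P) (linMap Q) :=
  ⟨fixesOrigin_linMap Q, by rw [linMap_mul, h, linMap_one],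
    by rw [linMap_mul, mul_eq_one_comm.mp h, linMap_one]⟩

theorem jacobian_linMap (P : Matrix (Fin 2) (Fin 2) ℝ) : jacobian (linMap P) = P.map C := by
  ext1 i j
  fin_cases j <;>
  simp [jacobian, linMap, smul_eq_C_mul]

theorem linearPart_linMap (P : Matrix (Fin 2) (Fin 2) ℝ) : linearPart (linMap P) = P := by
  rw [linearPart, jacobian_linMap]
  ext i j
  simp

theorem det_jacobian_linMap (P : Matrix (Fin 2) (Fin 2) ℝ) :
    (jacobian (linMap P)).det = C P.det := by
  rw [jacobian_linMap, Matrix.det_fin_two, Matrix.det_fin_two]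
  simp only [Matrix.map_apply, map_sub, map_mul]

theorem isCanonicalChange_linMap {P : Matrix (Fin 2) (Fin 2) ℝ} (h : P.det = 1 ∨ P.det = -1) :
    IsCanonicalChange (linMap P) :=
  ⟨fixesOrigin_linMap P, by
    unfold AreaPreserving
    rw [det_jacobian_linMap]
    rcases h with h | h
    · left; rw [h, map_one]
    · right; rw [h, map_neg, map_one]⟩

/-- The Jordan block with the eigenvalue `1`. -/
def jordan : Matrix (Fin 2) (Fin 2) ℝ := !![1, 1; 0, 1]

theorem det_eq_one_of_charpoly {A : Matrix (Fin 2) (Fin 2) ℝ}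
    (hA : A.charpoly = (Polynomial.X - Polynomial.C 1) ^ 2) : A.det = 1 ∧ A.trace = 2 := by
  rw [Matrix.charpoly_fin_two] at hA
  have h0 := congrArg (Polynomial.eval 0) hA
  have h1 := congrArg (Polynomial.eval 1) hA
  simp at h0 h1
  exact ⟨h0, by linarith⟩

/-- The rows of `P` are `v` and `v (A - 1)` with `v` a multiple `t` of a basis vector; `(A - 1)² =
0` gives the intertwining. The determinant is `±t²` times an off-diagonal entry of `A`, so scaling
reaches only `±1`, which is why reversed orientation has to be allowed. -/
theorem exists_conj_jordan {A : Matrix (Fin 2) (Fin 2) ℝ}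
    (hA : A.charpoly = (Polynomial.X - Polynomial.C 1) ^ 2) (hd : ¬ Diagonalisable A) :
    ∃ P : Matrix (Fin 2) (Fin 2) ℝ, (P.det = 1 ∨ P.det = -1) ∧ P * A = jordan * P := by
  obtain ⟨hdet, htr⟩ := det_eq_one_of_charpoly hA
  have hne : A ≠ 1 := by
    rintro rfl
    exact hd ⟨1, fun _ => 1, by simp, by simp⟩
  rw [Matrix.det_fin_two] at hdet
  rw [Matrix.trace_fin_two] at htr
  have hscale : ∀ z : ℝ, z ≠ 0 → ∃ t : ℝ, t ^ 2 * z = 1 ∨ t ^ 2 * z = -1 := by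
    intro z hz
    refine ⟨(Real.sqrt |z|)⁻¹, ?_⟩
    have h1 : 0 < |z| := abs_pos.mpr hz
    rw [inv_pow, Real.sq_sqrt h1.le]
    rcases abs_choice z with h | h <;> rw [h]
    · left; field_simp
    · right; field_simp
  have hnil : (A 0 0 - 1) ^ 2 + A 0 1 * A 1 0 = 0 := by
    have : A 1 1 = 2 - A 0 0 := by linarith
    rw [this] at hdet
    linear_combination -hdet
  have h11 : A 1 1 = 2 - A 0 0 := by linarith
  by_cases hq : A 0 1 = 0
  · have hr : A 1 0 ≠ 0 := by
      intro hr
      rw [hq, zero_mul, add_zero] at hnil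
      have h00 : A 0 0 = 1 := by
        have := pow_eq_zero_iff (two_ne_zero) |>.mp hnil
        linarith
      refine hne ?_
      ext i j
      fin_cases i <;> fin_cases j <;> simp [h00, hq, hr, h11]
      norm_num
    obtain ⟨t, ht⟩ := hscale (A 1 0) hr
    refine ⟨!![0, t; t * A 1 0, t * (A 1 1 - 1)], ?_, ?_⟩
    · rw [Matrix.det_fin_two_of]
      rcases ht with ht | ht
      · right; linear_combination -ht
      · left; linear_combination -ht
    · ext i j
      fin_cases i <;> fin_cases j <;>
        simp [jordan, Matrix.mul_apply, Fin.sum_univ_two, h11, hq]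
      · ring
      · ring
      · rw [hq] at hnil
        linear_combination t * hnil
  · obtain ⟨t, ht⟩ := hscale (A 0 1) hq
    refine ⟨!![t, 0; t * (A 0 0 - 1), t * A 0 1], ?_, ?_⟩
    · rw [Matrix.det_fin_two_of]
      rcases ht with ht | ht
      · left; linear_combination ht
      · right; linear_combination ht
    · ext i j
      fin_cases i <;> fin_cases j <;>
        simp [jordan, Matrix.mul_apply, Fin.sum_univ_two, h11]
      · ring
      · linear_combination t * hnil
      · ring

/-! ### Existence of the simplified Hamiltonian. -/

theorem constantCoeff_det_jacobian (F : FormalMap) :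
    constantCoeff (jacobian F).det = (linearPart F).det := by
  rw [linearPart]
  exact RingHom.map_det constantCoeff (jacobian F)

theorem det_jacobian_eq_one (hF : AreaPreserving F) (h : 0 < (linearPart F).det) :
    (jacobian F).det = 1 := by
  rcases hF with h1 | h1
  · exact h1
  · have := constantCoeff_det_jacobian F
    rw [h1, map_neg, map_one] at this
    linarith

/-- Only `1` and `x` have weight less than `3`. The entry `t` is harmless because `y` has weight `n
≥ 3`. -/
theorem sub_X_mem_filt_of_linearPart (hF : FixesOrigin F) (hn : 3 ≤ n) {t : ℝ}
    (hL : linearPart F = !![1, t; 0, 1]) : F 0 - X 0 ∈ filt (wn n) 3 := by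
  rw [mem_filt_wn]
  intro i j k hw
  have hj : j = 0 := by
    by_contra hj
    have : n ≤ n * j := Nat.le_mul_of_pos_right _ (by omega)
    omega
  have hk : k = 0 := by
    by_contra hk
    have : 2 * n ≤ 2 * n * k := Nat.le_mul_of_pos_right _ (by omega)
    omega
  subst hj hk
  have hX : (X 0 : Series) = monomial (mon 1 0 0) 1 := by rw [← X_zero_pow_eq, pow_one]
  rw [map_sub, hX, coeff_mon_monomial]
  have : i = 0 ∨ i = 1 := by omega
  rcases this with rfl | rfl
  · have := hF 0
    rw [← coeff_zero_eq_constantCoeff_apply] at this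
    have h0 : mon 0 0 0 = 0 := by simp [mon]
    rw [h0, this, if_neg (by omega), sub_zero]
  · rw [← linearPart_apply_zero, hL]
    simp

/-- A family of area-preserving maps with a parabolic fixed point can be brought to the time-one
map of `y² / 2 + U_ε(x)`. -/
theorem exists_simplified (hF : AreaPreserving F) (hF0 : FixesOrigin F)
    (hchar : (linearPart F).charpoly = (Polynomial.X - Polynomial.C 1) ^ 2)
    (hdiag : ¬ Diagonalisable (linearPart F)) :
    ∃ φ₀ u₀, IsSimplified u₀ ∧ Normalises φ₀ F u₀ := by
  obtain ⟨P, hPdet, hP⟩ := exists_conj_jordan hchar hdiag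
  have hPu : IsUnit P.det := by
    rcases hPdet with h | h <;> rw [h]
    · exact isUnit_one
    · exact isUnit_one.neg
  have hPP : P * P⁻¹ = 1 := Matrix.mul_nonsing_inv P hPu
  have hi := isInverse_linMap hPP
  have hL0 := fixesOrigin_linMap P
  set F₁ := comp (linMap P) (comp F (linMap P⁻¹)) with hF₁
  have hF₁0 : FixesOrigin F₁ := hL0.comp (hF0.comp hi.1)
  have hlin : linearPart F₁ = jordan := by
    rw [hF₁, linearPart_comp (hF0.comp hi.1), linearPart_comp hi.1, linearPart_linMap,
      linearPart_linMap, ← mul_assoc, hP, mul_assoc, hPP, mul_one]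
  have hcanP := isCanonicalChange_linMap hPdet
  have hdet : poisson (F₁ 0) (F₁ 1) = 1 := by
    rw [← det_jacobian]
    -- The conjugate is area-preserving, and its Jacobian at the origin is `det jordan = 1`, which
    -- fixes the sign even if `P` reverses the orientation.
    refine det_jacobian_eq_one ?_ (by rw [hlin, jordan, Matrix.det_fin_two_of]; norm_num)
    exact areaPreserving_comp (hF0.comp hi.1) hcanP.2
      (areaPreserving_comp hi.1 hF (hcanP.inverse hi).2)
  have hw : ∀ i, 1 ≤ wn 3 i := one_le_wn (by omega)
  have h10 := sub_X_mem_filt_of_linearPart hF₁0 le_rfl hlin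
  have h11 : F₁ 1 - X 1 ∈ filt (wn 3) 4 := by
    rw [mem_filt_wn]
    intro i j k hwt
    obtain rfl : k = 0 := by omega
    have hX : (X 1 : Series) = monomial (mon 0 1 0) 1 := by rw [← X_one_pow_eq, pow_one]
    have : (i = 0 ∧ j = 0) ∨ (i = 1 ∧ j = 0) ∨ (i = 0 ∧ j = 1) := by omega
    rw [map_sub, hX, coeff_mon_monomial]
    rcases this with ⟨rfl, rfl⟩ | ⟨rfl, rfl⟩ | ⟨rfl, rfl⟩
    · have := hF₁0 1
      rw [← coeff_zero_eq_constantCoeff_apply] at this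
      have h0 : mon 0 0 0 = 0 := by simp [mon]
      rw [h0, this, if_neg (by omega), sub_zero]
    · rw [← linearPart_apply_zero, hlin]
      simp [jordan]
    · rw [← linearPart_apply_one, hlin]
      simp [jordan]
  obtain ⟨h, hh, hhF⟩ := exists_timeOne_eq (w := wn 3) (s := 0) h10 h11 hdet
  have hhT : Tame (wn 3) h := hh
  have hh6 : h ∈ filt (wn 3) (2 * 3) := hh
  -- To leading order the first component is `x + h_y`, and the Jordan block gives it the linear
  -- term `y`.
  have hy : coeff (mon 0 2 0) h = 1 / 2 := by
    have h1 := expLie_sub_linear (r := 0) hh (X_mem_filt (wn 3) 0)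
    rw [← timeOne_zero_eq, hhF, poisson_X_zero] at h1
    have h2 := mem_filt_wn.mp h1 0 1 0 (by rw [wn_zero]; omega)
    have hX : (X 0 : Series) = monomial (mon 1 0 0) 1 := by rw [← X_zero_pow_eq, pow_one]
    rw [map_sub, map_sub, ← linearPart_apply_one, hlin, hX, coeff_mon_monomial,
      coeff_mon_pderiv_one] at h2
    simp [jordan] at h2
    linarith
  -- `b` may be zero here: removing the multiples of `y` does not use `b ≠ 0`. The monomials of
  -- weight `6` are just `x³`, `y²` and `ε`.
  set b := coeff (mon 3 0 0) h with hb
  set c : Series := C (coeff (mon 0 0 1) h) * X 2 with hcdef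
  have hc : EpsOnly c := epsOnly_eps _
  have hcw : c ∈ filt (wn 3) (2 * 3) := eps_mem_filt _ _
  have hsub : h - (model 3 b + c) ∈ filt (wn 3) (2 * 3 + 1) := by
    rw [mem_filt_wn]
    intro i j k hwt
    rcases lt_or_eq_of_le (by omega : 2 * i + 3 * j + 2 * 3 * k ≤ 2 * 3) with hlt | heq
    · exact mem_filt_wn.mp (sub_mem hh6 (add_mem (model_mem_filt 3 b) hcw)) i j k hlt
    · have : (i = 3 ∧ j = 0 ∧ k = 0) ∨ (i = 0 ∧ j = 2 ∧ k = 0) ∨ (i = 0 ∧ j = 0 ∧ k = 1) := by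
        omega
      rw [map_sub, map_add, hcdef, coeff_eps]
      rcases this with ⟨rfl, rfl, rfl⟩ | ⟨rfl, rfl, rfl⟩ | ⟨rfl, rfl, rfl⟩
      · rw [coeff_model_zero]; simp [hb]
      · rw [coeff_model_succ, hy]; simp
      · rw [coeff_model_zero]; simp
  obtain ⟨χ, hχ, -, hlow', hbad⟩ := exists_simplification le_rfl (h := h)
    (fun _ j _ => j ≠ 0) (fun q g hg => by
      obtain ⟨δ, hδ, h0, h1⟩ := exists_homological le_rfl b hg
      refine ⟨δ, hδ, h0, fun i j k hij => ?_⟩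
      obtain ⟨j, rfl⟩ := Nat.exists_eq_succ_of_ne_zero hij
      exact h1 i j k) hc hcw rfl hsub
  set h' := expLie χ h with hh'
  let u : ℕ → ℕ → ℝ := fun i k => coeff (mon i 0 k) h'
  have hu : hamiltonian u = h' := by
    refine ext_mon fun i j k => ?_
    rcases j with _ | j
    · rw [coeff_hamiltonian_zero]
    · have := hbad i (j + 1) k (Nat.succ_ne_zero j)
      rw [map_sub, map_add, coeff_model_succ, hc _ _ _ (Or.inr (Nat.succ_ne_zero j))] at this
      rw [coeff_hamiltonian_succ]
      linear_combination -this
  refine ⟨comp (timeOne (-χ)) (linMap P), u, fun k m hkm => ?_,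
    (isCanonicalChange_timeOne hw hχ.neg).comp hcanP, ?_⟩
  · exact mem_filt_wn.mp (expLie_mem_filt hχ hh6) k 0 m (by omega)
  · rw [hu]
    refine conjugateBy_expLie hw hL0 hhT hχ ⟨_, hi, ?_⟩
    rw [hhF]
    exact ConjugateBy.symm hi.1 hF0 (hi.symm hL0) hF₁

end FormalNF

end

noncomputable section

namespace FormalNF

open MvPowerSeries

/-! ### Uniqueness of the normal form -/

variable {w : Fin 3 → ℕ} {n n₁ n₂ p q r : ℕ} {b b₁ b₂ t : ℝ} {c f g χ h : Series}
  {φ φ₀ ψ θ F G : FormalMap} {u u₁ u₂ : ℕ → ℕ → ℝ}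

theorem IsNormalForm.lt_of_ne_zero (hu : IsNormalForm n b u) {k m : ℕ} (h : u k m ≠ 0) :
    (k = n ∧ m = 0) ∨ n < k + n * m := by
  by_contra hc
  push Not at hc
  refine h (hu.support k m (fun he => ?_) fun hk => ?_)
  · exact hc.1 (Prod.mk.inj he).1 (Prod.mk.inj he).2
  · exact absurd hk.1 (by omega)

theorem IsNormalForm.le_of_ne_zero (hu : IsNormalForm n b u) {k m : ℕ} (h : u k m ≠ 0) :
    n ≤ k ∨ 1 ≤ m := by
  rcases hu.lt_of_ne_zero h with ⟨rfl, -⟩ | h'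
  · exact Or.inl le_rfl
  · rcases m with _ | m
    · rw [mul_zero, add_zero] at h'
      exact Or.inl h'.le
    · exact Or.inr (by omega)

theorem IsNormalForm.eq_zero_of_dvd (hu : IsNormalForm n b u) {k : ℕ} (m : ℕ) (h : n ∣ k + 1) :
    u k m = 0 := by
  refine hu.support k m (fun he => ?_) fun hk => hk.2 ?_
  · have hkn := (Prod.mk.inj he).1
    rw [hkn] at h
    have := Nat.le_of_dvd one_pos ((Nat.dvd_add_right (dvd_refl n)).mp h)
    have := hu.three_le
    omega
  · refine (Int.modEq_iff_dvd.mpr ?_).symm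
    rw [sub_neg_eq_add]
    exact_mod_cast h

/-- Allowing weights with `n` below the order `n₁` of the form is what permits comparing normal
forms of a priori different orders. -/
theorem IsNormalForm.hamiltonian_mem_filt (hu : IsNormalForm n₁ b u) (h : n ≤ n₁) :
    hamiltonian u ∈ filt (wn n) (2 * n) := by
  rw [mem_filt_wn]
  intro i j k hw
  rcases j with _ | j
  · rw [coeff_hamiltonian_zero]
    by_contra hne
    rcases hu.le_of_ne_zero hne with h1 | h1
    · omega
    · have : 2 * n ≤ 2 * n * k := Nat.le_mul_of_pos_right _ h1
      omega
  · rw [coeff_hamiltonian_succ, if_neg]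
    rintro ⟨rfl, rfl, rfl⟩
    omega

theorem IsNormalForm.tame (hu : IsNormalForm n b u) : Tame (wn 3) (hamiltonian u) :=
  tame_of_mem_filt_two_mul le_rfl (hu.hamiltonian_mem_filt hu.three_le)

theorem IsNormalForm.sub_model_mem_filt (hu : IsNormalForm n b u) :
    hamiltonian u - model n b ∈ filt (wn n) (2 * n + 1) := by
  rw [mem_filt_wn]
  intro i j k hw
  rw [map_sub]
  rcases j with _ | j
  · rw [coeff_hamiltonian_zero, coeff_model_zero]
    by_cases h : i = n ∧ k = 0
    · obtain ⟨rfl, rfl⟩ := h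
      rw [if_pos ⟨rfl, rfl⟩, hu.leading, sub_self]
    · rw [if_neg h, sub_zero]
      by_contra hne
      rcases hu.lt_of_ne_zero hne with h1 | h1
      · exact h h1
      · rw [mul_assoc] at hw
        omega
  · rw [coeff_hamiltonian_succ, coeff_model_succ, sub_self]

theorem linearPart_timeOne_hamiltonian (hu : IsNormalForm n b u) :
    linearPart (timeOne (hamiltonian u)) = jordan := by
  have hT := hu.tame
  have h0 := expLie_sub_linear (r := 0) hT (X_mem_filt (wn 3) 0)
  have h1 := expLie_sub_self hT (X_mem_filt (wn 3) 1)
  have hX0 : (X 0 : Series) = monomial (mon 1 0 0) 1 := by rw [← X_zero_pow_eq, pow_one]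
  have hX1 : (X 1 : Series) = monomial (mon 0 1 0) 1 := by rw [← X_one_pow_eq, pow_one]
  rw [← timeOne_zero_eq, poisson_X_zero] at h0
  rw [← timeOne_one_eq] at h1
  have a00 := mem_filt_wn.mp h0 1 0 0 (by rw [wn_zero]; omega)
  have a01 := mem_filt_wn.mp h0 0 1 0 (by rw [wn_zero]; omega)
  have a10 := mem_filt_wn.mp h1 1 0 0 (by rw [wn_one]; omega)
  have a11 := mem_filt_wn.mp h1 0 1 0 (by rw [wn_one]; omega)
  rw [map_sub, map_sub, ← linearPart_apply_zero, hX0, coeff_mon_monomial, coeff_mon_pderiv_one,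
    coeff_hamiltonian_succ] at a00
  rw [map_sub, map_sub, ← linearPart_apply_one, hX0, coeff_mon_monomial, coeff_mon_pderiv_one,
    coeff_hamiltonian_succ] at a01
  rw [map_sub, ← linearPart_apply_zero, hX1, coeff_mon_monomial] at a10
  rw [map_sub, ← linearPart_apply_one, hX1, coeff_mon_monomial] at a11
  simp at a00 a01 a10 a11
  ext i j
  fin_cases i <;> fin_cases j <;> simp [jordan] <;> linarith

theorem eq_of_commute_jordan {M : Matrix (Fin 2) (Fin 2) ℝ} (h : M * jordan = jordan * M) :
    M 1 0 = 0 ∧ M 1 1 = M 0 0 := by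
  have h00 := congrFun (congrFun h 0) 0
  have h01 := congrFun (congrFun h 0) 1
  simp [jordan, Matrix.mul_apply, Fin.sum_univ_two] at h00 h01
  exact ⟨h00, by linarith⟩

/-! ### First integrals of the Hamiltonian -/

theorem poisson_pow_self (h : Series) (l : ℕ) : poisson (h ^ l) h = 0 := by
  induction l with
  | zero => simp [poisson]
  | succ l ih => rw [pow_succ, poisson_mul_left, ih, poisson_self]; ring

theorem poisson_smul_left (a : ℝ) (f g : Series) : poisson (a • f) g = a • poisson f g := by
  rw [← poissonL_apply, map_smul]; rfl

theorem pow_sub_pow_mem_filt (hf : f ∈ filt w p) (hg : g ∈ filt w p)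
    (hfg : f - g ∈ filt w (p + 1)) (l : ℕ) : f ^ l - g ^ l ∈ filt w (p * l + 1) := by
  induction l with
  | zero => simp
  | succ l ih =>
    have : f ^ (l + 1) - g ^ (l + 1) = f ^ l * (f - g) + (f ^ l - g ^ l) * g := by ring
    rw [this]
    refine add_mem (filt_anti ?_ (mul_mem_filt (pow_mem_filt hf l) hfg))
      (filt_anti ?_ (mul_mem_filt ih hg)) <;> rw [mul_add_one] <;> omega

/-- On `x = 0` the leading part of `2h` is `y²`, so that of `(2h) ^ l ε ^ m` is `y ^ (2 l) ε ^ m`;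
`hw` restricts attention to that weight. -/
theorem coeff_first_integral (hn : 1 ≤ n) (hh : h - model n b ∈ filt (wn n) (2 * n + 1))
    (l m l' m' : ℕ) (hw : n * (2 * l') + 2 * n * m' = 2 * n * l + 2 * n * m) :
    coeff (mon 0 (2 * l') m') ((2 * h) ^ l * X 2 ^ m) = if l' = l ∧ m' = m then 1 else 0 := by
  have hhw : h ∈ filt (wn n) (2 * n) :=
    mem_filt_of_sub_mem (filt_anti (by omega) hh) (model_mem_filt n b)
  have h1 : (2 * h) ^ l * X 2 ^ m - (2 * model n b) ^ l * X 2 ^ m ∈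
      filt (wn n) (2 * n * l + 1 + 2 * n * m) := by
    rw [← sub_mul]
    refine mul_mem_filt (pow_sub_pow_mem_filt (Ideal.mul_mem_left _ _ hhw)
      (Ideal.mul_mem_left _ _ (model_mem_filt n b)) ?_ l) (pow_mem_filt (X_mem_filt (wn n) 2) m)
    rw [← mul_sub]
    exact Ideal.mul_mem_left _ _ hh
  rw [coeff_eq_of_sub_mem h1 (by rw [wt_mon, wn_zero, wn_one, wn_two]; omega)]
  -- The weights `1, 0, 0` count powers of `x`; working modulo weight `1` restricts to `x = 0`.
  have h2 : (2 * model n b) ^ l * X 2 ^ m - (X 1 ^ 2) ^ l * X 2 ^ m ∈ filt ![1, 0, 0] 1 := by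
    rw [← sub_mul]
    refine Ideal.mul_mem_right _ _ (Ideal.mem_of_dvd _ (sub_dvd_pow_sub_pow _ _ l) ?_)
    have : 2 * model n b - X 1 ^ 2 = monomial (mon n 0 0) (2 * b) := by
      have e2 : (2 : Series) = C (2 : ℝ) := (map_ofNat (C : ℝ →+* Series) 2).symm
      rw [model, X_one_pow_eq, mul_add, e2, ← smul_eq_C_mul, ← smul_eq_C_mul, ← map_smul,
        ← map_smul, smul_eq_mul, smul_eq_mul, mul_one_div_cancel two_ne_zero, add_sub_cancel_left]
    rw [this]
    refine monomial_mem_filt ?_ _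
    rw [wt_mon]
    simpa using hn
  rw [coeff_eq_of_sub_mem h2 (by rw [wt_mon]; exact Nat.zero_lt_one.trans_le' (by simp)), ← pow_mul, X_one_pow_eq, X_two_pow_eq,
    monomial_mul_monomial, mon_add, coeff_mon_monomial, mul_one]
  refine if_congr ?_ rfl rfl
  omega

/-- A first integral of the Hamiltonian with a prescribed leading part on `x = 0`. -/
theorem exists_first_integral (hn : 1 ≤ n) (hh : h - model n b ∈ filt (wn n) (2 * n + 1))
    (q : ℕ) (a : ℕ → ℕ → ℝ) :
    ∃ f ∈ filt (wn n) q, poisson f h = 0 ∧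
      ∀ l k, n * (2 * l) + 2 * n * k = q → coeff (mon 0 (2 * l) k) f = a l k := by
  have hhw : h ∈ filt (wn n) (2 * n) :=
    mem_filt_of_sub_mem (filt_anti (by omega) hh) (model_mem_filt n b)
  -- The exponents of the products `(2h) ^ l ε ^ k` of weight exactly `q`. The set is empty unless
  -- `2n` divides `q`, and then `f = 0`.
  let S : Finset (ℕ × ℕ) := ((Finset.range (q + 1)) ×ˢ (Finset.range (q + 1))).filter
    fun x => 2 * n * x.1 + 2 * n * x.2 = q
  have hS : ∀ l k, (l, k) ∈ S ↔ 2 * n * l + 2 * n * k = q := by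
    intro l k
    simp only [S, Finset.mem_filter, Finset.mem_product, Finset.mem_range, and_iff_right_iff_imp]
    intro h
    have h1 : l ≤ 2 * n * l := Nat.le_mul_of_pos_left _ (by omega)
    have h2 : k ≤ 2 * n * k := Nat.le_mul_of_pos_left _ (by omega)
    omega
  refine ⟨∑ x ∈ S, a x.1 x.2 • ((2 * h) ^ x.1 * X 2 ^ x.2), ?_, ?_, ?_⟩
  · refine sum_mem fun x hx => smul_mem_filt _ ?_
    rw [← (hS x.1 x.2).mp hx]
    exact mul_mem_filt (pow_mem_filt (Ideal.mul_mem_left _ _ hhw) _)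
      (pow_mem_filt (X_mem_filt (wn n) 2) _)
  · change lieL h _ = 0
    rw [map_sum]
    refine Finset.sum_eq_zero fun x _ => ?_
    have h2 : poisson (X 2 ^ x.2) h = 0 := by
      generalize x.2 = m
      induction m with
      | zero => simp [poisson]
      | succ m ih => rw [pow_succ, poisson_mul_left, ih, poisson_X_two]; ring
    have h3 : (2 : Series) ^ x.1 = (2 ^ x.1 : ℝ) • 1 := by
      rw [smul_eq_C_mul, mul_one, map_pow, map_ofNat]
    rw [map_smul, lieL_apply, poisson_mul_left, h2, mul_pow, h3, smul_mul_assoc, one_mul,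
      poisson_smul_left, poisson_pow_self, smul_zero, mul_zero, mul_zero, add_zero, smul_zero]
  · intro l k hlk
    rw [map_sum, Finset.sum_eq_single (l, k)]
    · rw [coeff_smul, coeff_first_integral hn hh _ _ _ _ (by ring), if_pos ⟨rfl, rfl⟩,
        mul_one]
    · rintro ⟨l', k'⟩ hx hne
      have := (hS _ _).mp hx
      rw [coeff_smul, coeff_first_integral hn hh _ _ _ _ (by simp only; omega), if_neg, mul_zero]
      rintro ⟨rfl, rfl⟩
      exact hne rfl
    · intro hx
      exact absurd ((hS l k).mpr (by rw [← hlk]; ring)) hx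

/-- Changes of variables which conjugate two Hamiltonians in the normal form with the same leading
part can be replaced by ones of a higher order. -/
theorem exists_higher_order (hu₁ : IsNormalForm n b₁ u₁) (hu₂ : IsNormalForm n b₂ u₂)
    (hc : EpsOnly c) (hχ : χ ∈ filt (wn n) (2 + n + 1 + r))
    (heq : hamiltonian u₁ = expLie χ (hamiltonian u₂) + c) :
    ∃ χ' ∈ filt (wn n) (2 + n + 1 + (r + 1)),
      hamiltonian u₁ = expLie χ' (hamiltonian u₂) + c := by
  have hn := hu₁.three_le
  have hw : ∀ i, 1 ≤ wn n i := one_le_wn (by omega)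
  have hh := hu₂.sub_model_mem_filt
  have hhw := hu₂.hamiltonian_mem_filt le_rfl
  -- `f` commutes with the second Hamiltonian and reproduces the leading part of `χ` on `x = 0`, the
  -- only part the homological equation leaves undetermined.
  obtain ⟨f, hf, hf0, hfa⟩ := exists_first_integral (by omega) hh (2 + n + 1 + r)
    (fun l k => coeff (mon 0 (2 * l) k) χ)
  have hT : ∀ {g}, g ∈ filt (wn n) (2 + n + 1 + r) → Tame (wn n) g := fun hg =>
    filt_anti (by rw [wn_zero, wn_one]; omega) hg
  have hδ : χ - f ∈ filt (wn n) (2 + n + 1 + (r + 1)) := by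
    rw [mem_filt_wn]
    intro i j k hwt
    rcases lt_or_eq_of_le (by omega : 2 * i + n * j + 2 * n * k ≤ 2 + n + 1 + r) with hlt | he
    · exact mem_filt_wn.mp (sub_mem hχ hf) i j k hlt
    -- In the leading weight `{h, χ - f}` equals this difference, which contains neither `y` nor the
    -- excluded powers of `x`, both Hamiltonians being in normal form.
    refine kernel_homological hn hu₂.ne_zero (D := hamiltonian u₁ - hamiltonian u₂ - c)
      (fun i j k hwt => ?_) (fun i j k => ?_) (fun i k hi => ?_) (fun l k hlk => ?_) i j k he
    · have h1 := mem_filt_wn.mp (expLie_sub_linear (r := r) hχ hhw) i j k (by omega)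
      have h2 := mem_filt_wn.mp (poisson_mem_filt (r := 2 * n + 2 + r) hh (sub_mem hχ hf)
        (by rw [wn_zero, wn_one]; omega)) i j k (by omega)
      rw [poisson_sub_left, poisson_sub_right (hamiltonian u₂), poisson_comm _ f, hf0, neg_zero,
        sub_zero, map_sub] at h2
      rw [heq]
      simp only [map_sub, map_add] at h1 ⊢
      linear_combination -h1 - h2
    · rw [map_sub, map_sub, coeff_hamiltonian_succ, coeff_hamiltonian_succ, sub_self, zero_sub,
        hc _ _ _ (Or.inr (Nat.succ_ne_zero j)), neg_zero]
    · rw [map_sub, map_sub, coeff_hamiltonian_zero, coeff_hamiltonian_zero, hu₁.eq_zero_of_dvd k hi,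
        hu₂.eq_zero_of_dvd k hi, hc i 0 k (Or.inl ?_)]
      · ring
      · rintro rfl
        have := Nat.le_of_dvd one_pos hi
        omega
    · rw [map_sub, hfa l k hlk, sub_self]
  have hfn := (hT hf).neg
  have hX : ∀ i, expLie χ (expLie (-f) (X i)) - X i ∈ filt (wn n) (wn n i + 1 + (r + 1)) := by
    intro i
    have := expLie_sub_expLie_mem (hT hχ) (hT hf) hδ (expLie_mem_filt hfn (X_mem_filt (wn n) i))
    rwa [expLie_expLie_neg (hT hf)] at this
  -- `exp(L_χ) exp(-L_f)` acts on the second Hamiltonian as `exp(L_χ)` does, but is closer to the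
  -- identity by one order.
  obtain ⟨χ', hχ', hχ'eq⟩ := exists_timeOne_eq (w := wn n) (s := r + 1)
    (θ := comp (timeOne (-f)) (timeOne χ))
    (by rw [comp, pullback_timeOne hw (hT hχ)]; exact hX 0)
    (by rw [comp, pullback_timeOne hw (hT hχ)]; exact hX 1)
    (by
      simp only [comp, pullback_timeOne hw (hT hχ)]
      rw [← expLie_poisson (hT hχ), poisson_timeOne hfn, expLie_one (hT hχ)])
  refine ⟨χ', hχ', ?_⟩
  have hχ'T : Tame (wn n) χ' := filt_anti (by omega) hχ'
  rw [heq, ← pullback_timeOne hw hχ'T, hχ'eq,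
    ← pullback_pullback ((filtered_timeOne hfn).fixesOrigin hw)
      ((filtered_timeOne (hT hχ)).fixesOrigin hw), pullback_timeOne hw hfn,
    pullback_timeOne hw (hT hχ), expLie_of_poisson_eq_zero hfn]
  rw [poisson_neg_right, poisson_comm, hf0, neg_zero, neg_zero]

/-- The change can be replaced by ones of arbitrarily high order, so the two sides agree to every
order. -/
theorem eq_of_expLie_eq (hu₁ : IsNormalForm n b₁ u₁) (hu₂ : IsNormalForm n b₂ u₂)
    (hc : EpsOnly c) (hχ : Tame (wn n) χ)
    (heq : hamiltonian u₁ = expLie χ (hamiltonian u₂) + c) : hamiltonian u₁ = hamiltonian u₂ + c := by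
  have H : ∀ r, ∃ χ' ∈ filt (wn n) (2 + n + 1 + r),
      hamiltonian u₁ = expLie χ' (hamiltonian u₂) + c := by
    intro r
    induction r with
    | zero => exact ⟨χ, hχ, heq⟩
    | succ r ih =>
      obtain ⟨χ', hχ', h'⟩ := ih
      exact exists_higher_order hu₁ hu₂ hc hχ' h'
  rw [← sub_eq_zero]
  refine eq_zero_of_mem_filt (w := wn n) fun r => ?_
  obtain ⟨χ', hχ', h'⟩ := H r
  have hT' : Tame (wn n) χ' := filt_anti (by rw [wn_zero, wn_one]; omega) hχ'
  have h1 := expLie_sub_expLie_mem (r := r) hT' (tame_zero _)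
    (by rw [sub_zero]; exact hχ') (mem_filt_zero (hamiltonian u₂))
  rw [expLie_zero] at h1
  rw [h', add_sub_add_right_eq_sub]
  exact filt_anti (by omega) h1

/-- A canonical change which conjugates two Hamiltonians in the normal form and whose linear part
is unipotent is tangent to the identity. -/
theorem coeff_y_eq_zero (hu₂ : IsNormalForm n₂ b₂ u₂)
    (hc : EpsOnly c) (hθ : FixesOrigin θ) (hL : linearPart θ = !![1, t; 0, 1])
    (heq : hamiltonian u₁ = pullback θ (hamiltonian u₂) + c) (hn₂ : n ≤ n₂) :
    ∀ k, 2 * k ≤ n → coeff (mon k 0 0) (θ 1) = 0 := by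
  intro k
  induction k using Nat.strong_induction_on with
  | _ k ih =>
    intro hk
    obtain rfl | rfl | hk2 : k = 0 ∨ k = 1 ∨ 2 ≤ k := by omega
    · have := hθ 1
      rwa [← coeff_zero_eq_constantCoeff_apply, show (0 : Fin 3 →₀ ℕ) = mon 0 0 0 by simp [mon]]
        at this
    · rw [← linearPart_apply_zero, hL]; simp
    set a := coeff (mon k 0 0) (θ 1) with ha
    have hy : coeff (mon 0 1 0) (θ 1) = 1 := by rw [← linearPart_apply_one, hL]; simp
    have hX1 : (X 1 : Series) = monomial (mon 0 1 0) 1 := by rw [← X_one_pow_eq, pow_one]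
    set B : Series := X 1 + monomial (mon k 0 0) a with hB
    -- In the weights `1, k, 2k + 1` the leading part of `θ 1` is `y + a x ^ k`, and `ε` is too
    -- heavy to affect `x ^ k y` in the square. That coefficient of `(θ 1)² / 2` is therefore `a`.
    have hBw : B ∈ filt ![1, k, 2 * k + 1] k := by
      refine add_mem (X_mem_filt _ 1) (monomial_mem_filt ?_ a)
      rw [wt_mon]; simp
    have hYB : θ 1 - B ∈ filt ![1, k, 2 * k + 1] (k + 1) := by
      refine mem_filt_iff_mon.mpr fun i j l hwt => ?_
      simp only [Matrix.cons_val_zero, Matrix.cons_val_one, Matrix.cons_val] at hwt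
      have hl : l = 0 := by
        by_contra hl
        have := Nat.le_mul_of_pos_right (2 * k + 1) (Nat.pos_of_ne_zero hl)
        omega
      subst hl
      rw [map_sub, hB, map_add, hX1, coeff_mon_monomial, coeff_mon_monomial]
      rcases j with _ | j
      · rcases lt_or_eq_of_le (by omega : i ≤ k) with hi | rfl
        · rw [ih i hi (by omega), if_neg (by omega), if_neg (by omega)]
          ring
        · rw [if_neg (by omega), if_pos ⟨rfl, rfl, rfl⟩, ← ha]
          ring
      · rw [mul_add_one] at hwt
        obtain rfl : i = 0 := by omega
        obtain rfl : j = 0 := by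
          by_contra hj
          have := Nat.le_mul_of_pos_right k (Nat.pos_of_ne_zero hj)
          omega
        rw [zero_add, hy, if_pos ⟨rfl, rfl, rfl⟩, if_neg (by omega)]
        ring
    have hYw : θ 1 ∈ filt ![1, k, 2 * k + 1] k := mem_filt_of_sub_mem (filt_anti (by omega) hYB) hBw
    have hsq : coeff (mon k 1 0) (θ 1 ^ 2) = coeff (mon k 1 0) (B ^ 2) :=
      coeff_eq_of_sub_mem (pow_sub_pow_mem_filt hYw hBw hYB 2) (by rw [wt_mon]; simp; omega)
    have hB2 : coeff (mon k 1 0) (B ^ 2) = 2 * a := by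
      have : B ^ 2 = monomial (mon 0 2 0) 1 + (2 : ℝ) • monomial (mon k 1 0) a +
          monomial (mon (k + k) 0 0) (a * a) := by
        have e : B ^ 2 = X 1 * X 1 + (2 : ℝ) • (X 1 * monomial (mon k 0 0) a) +
            monomial (mon k 0 0) a * monomial (mon k 0 0) a := by
          rw [hB, two_smul]; ring
        rw [e, hX1, monomial_mul_monomial, monomial_mul_monomial, monomial_mul_monomial, mon_add,
          mon_add, mon_add]
        simp only [zero_add, add_zero, one_mul, Nat.reduceAdd]
      rw [this, map_add, map_add, coeff_smul, coeff_mon_monomial, coeff_mon_monomial,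
        coeff_mon_monomial, if_neg (by omega), if_pos ⟨rfl, rfl, rfl⟩, if_neg (by omega)]
      ring
    -- The transformed potential starts in degree `n`, with `ε` of weight `n`, whereas `x ^ k y` has
    -- degree `k + 1 < 2k ≤ n`. As `x ^ k y` is absent from the first Hamiltonian, `a = 0`.
    have hpot : potential u₂ ∈ filt ![1, 1, n] n := by
      refine mem_filt_iff_mon.mpr fun i j l hwt => ?_
      simp only [Matrix.cons_val_zero, Matrix.cons_val_one, Matrix.cons_val] at hwt
      rw [coeff_potential]
      split_ifs with hj
      · by_contra hne
        rcases hu₂.le_of_ne_zero hne with h1 | h1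
        · omega
        · have := Nat.le_mul_of_pos_right n h1
          omega
      · rfl
    have hpos : ∀ i : Fin 3, 1 ≤ (![1, 1, n] : Fin 3 → ℕ) i := by
      intro i
      fin_cases i
      · exact le_rfl
      · exact le_rfl
      · change 1 ≤ n
        omega
    have hcc : ∀ i, θ i ∈ filt ![1, 1, n] 1 := by
      intro i e he
      have he0 : e = 0 := by
        have := wt_ge_degree hpos e
        rw [Nat.lt_one_iff] at he
        rw [he, Nat.le_zero] at this
        exact (Finsupp.degree_eq_zero_iff e).mp this
      rw [he0]
      exact hθ i
    have hpot' : pullback θ (potential u₂) ∈ filt ![1, 1, n] n :=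
      pullback_mem_filt hpos ⟨hcc 0, hcc 1⟩ hpot
    have h1 := congrArg (coeff (mon k 1 0)) heq
    rw [coeff_hamiltonian_succ u₁ k 0 0, if_neg (by omega), map_add, hc _ _ _ (Or.inr one_ne_zero),
      hamiltonian, pullback_add hθ, pullback_mul hθ, pullback_C hθ, pullback_pow hθ,
      pullback_X_one hθ, map_add, ← smul_eq_C_mul, coeff_smul, hsq, hB2,
      hpot' _ (by rw [wt_mon]; simp; omega)] at h1
    linarith

theorem sub_X_one_mem_filt_of_linearPart (hn : 3 ≤ n) (hL : linearPart θ = !![1, t; 0, 1])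
    (hy : ∀ k, 2 * k ≤ n → coeff (mon k 0 0) (θ 1) = 0) : θ 1 - X 1 ∈ filt (wn n) (n + 1) := by
  rw [mem_filt_wn]
  intro i j k hw
  have hX1 : (X 1 : Series) = monomial (mon 0 1 0) 1 := by rw [← X_one_pow_eq, pow_one]
  have hk : k = 0 := by
    by_contra hk
    have : 2 * n ≤ 2 * n * k := Nat.le_mul_of_pos_right _ (by omega)
    omega
  subst hk
  rw [map_sub, hX1, coeff_mon_monomial]
  rcases j with _ | j
  · rw [hy i (by omega), if_neg (by omega), sub_zero]
  · rw [mul_add_one] at hw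
    obtain rfl : i = 0 := by omega
    obtain rfl : j = 0 := by
      by_contra hj
      have := Nat.le_mul_of_pos_right n (Nat.pos_of_ne_zero hj)
      omega
    rw [zero_add, ← linearPart_apply_one, hL]
    simp

/-- Uniqueness of the normal form for changes with a unipotent linear part. -/
theorem unique_of_unipotent (hu₁ : IsNormalForm n₁ b₁ u₁) (hu₂ : IsNormalForm n₂ b₂ u₂)
    (hc : EpsOnly c) (hθ : FixesOrigin θ) (hdet : poisson (θ 0) (θ 1) = 1)
    (hL : linearPart θ = !![1, t; 0, 1])
    (heq : hamiltonian u₁ = pullback θ (hamiltonian u₂) + c) :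
    n₁ = n₂ ∧ ∀ k m, 1 ≤ k → u₂ k m = u₁ k m := by
  have hlog : ∀ n, 3 ≤ n → n ≤ n₂ → ∃ χ, Tame (wn n) χ ∧
      hamiltonian u₁ = expLie χ (hamiltonian u₂) + c := by
    intro n hn hn₂
    obtain ⟨χ, hχ, rfl⟩ := exists_timeOne_eq (w := wn n) (s := 0)
      (sub_X_mem_filt_of_linearPart hθ hn hL)
      (sub_X_one_mem_filt_of_linearPart hn hL (coeff_y_eq_zero hu₂ hc hθ hL heq hn₂)) hdet
    exact ⟨χ, hχ, by rwa [pullback_timeOne (one_le_wn (by omega)) hχ] at heq⟩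
  -- The change preserves the terms of lowest weight `2n`, among them `x ^ n`. Taking for `n` the
  -- smaller of the two orders forces them to coincide.
  have hlead : ∀ n, 3 ≤ n → n ≤ n₂ → u₁ n 0 = u₂ n 0 := by
    intro n hn hn₂
    obtain ⟨χ, hχ, h⟩ := hlog n hn hn₂
    have h1 := expLie_sub_self hχ (hu₂.hamiltonian_mem_filt hn₂)
    have h2 := mem_filt_wn.mp h1 n 0 0 (by omega)
    rw [map_sub, coeff_hamiltonian_zero] at h2
    have h3 := congrArg (coeff (mon n 0 0)) h
    rw [map_add, coeff_hamiltonian_zero, hc _ _ _ (Or.inl (by omega))] at h3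
    linear_combination h3 + h2
  have hn : n₁ = n₂ := by
    rcases lt_trichotomy n₁ n₂ with h | h | h
    · exfalso
      have h1 := hlead n₁ hu₁.three_le h.le
      rw [hu₁.leading] at h1
      have h2 : u₂ n₁ 0 ≠ 0 := h1 ▸ hu₁.ne_zero
      rcases hu₂.lt_of_ne_zero h2 with h3 | h3 <;> omega
    · exact h
    · exfalso
      have h1 := hlead n₂ hu₂.three_le le_rfl
      rw [hu₂.leading] at h1
      have h2 : u₁ n₂ 0 ≠ 0 := h1.symm ▸ hu₂.ne_zero
      rcases hu₁.lt_of_ne_zero h2 with h3 | h3 <;> omega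
  subst hn
  refine ⟨rfl, fun k m hk => ?_⟩
  obtain ⟨χ, hχ, h⟩ := hlog n₁ hu₁.three_le le_rfl
  have h1 := congrArg (coeff (mon k 0 m)) (eq_of_expLie_eq hu₁ hu₂ hc hχ h)
  rw [map_add, coeff_hamiltonian_zero, coeff_hamiltonian_zero, hc _ _ _ (Or.inl (by omega)),
    add_zero] at h1
  exact h1.symm

/-! ### The symmetry `(x, y) ↦ (-x, -y)` -/

theorem pullback_linMap_smul_one (s : ℝ) (i j k : ℕ) (g : Series) :
    coeff (mon i j k) (pullback (linMap (s • 1)) g) = s ^ (i + j) * coeff (mon i j k) g := by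
  have : (![linMap (s • 1) 0, linMap (s • 1) 1, X 2] : Fin 3 → Series) =
      (![s, s, 1] : Fin 3 → ℝ) • (X : Fin 3 → Series) := by
    funext a
    fin_cases a <;> simp [linMap]
  rw [pullback, this, ← rescale_eq_subst, coeff_rescale]
  congr 1
  rw [Finsupp.prod_fintype _ _ (fun _ => pow_zero _), Fin.prod_univ_three]
  simp [pow_add]

theorem pullback_linMap_hamiltonian {s : ℝ} (hs : s = 1 ∨ s = -1) (u : ℕ → ℕ → ℝ) :
    pullback (linMap (s • 1)) (hamiltonian u) = hamiltonian fun k m => s ^ k * u k m := by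
  refine ext_mon fun i j k => ?_
  rw [pullback_linMap_smul_one]
  rcases j with _ | j
  · rw [coeff_hamiltonian_zero, coeff_hamiltonian_zero, add_zero]
  · rw [coeff_hamiltonian_succ, coeff_hamiltonian_succ]
    split_ifs with h
    · obtain ⟨rfl, rfl, rfl⟩ := h
      rcases hs with rfl | rfl <;> norm_num
    · rw [mul_zero]

theorem IsNormalForm.symmetry (hu : IsNormalForm n b u) {s : ℝ} (hs : s = 1 ∨ s = -1) :
    IsNormalForm n (s ^ n * b) fun k m => s ^ k * u k m where
  three_le := hu.three_le
  ne_zero := mul_ne_zero (pow_ne_zero _ (by rcases hs with rfl | rfl <;> norm_num)) hu.ne_zero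
  leading := by rw [hu.leading]
  support k m h1 h2 := by rw [hu.support k m h1 h2, mul_zero]

theorem mul_self_of_sign {s : ℝ} (hs : s = 1 ∨ s = -1) : s * s = 1 := by
  rcases hs with rfl | rfl <;> norm_num

theorem linMap_sign_mul {s : ℝ} (hs : s = 1 ∨ s = -1) :
    (s • 1 : Matrix (Fin 2) (Fin 2) ℝ) * (s • 1) = 1 := by
  rw [smul_mul_smul_comm, mul_self_of_sign hs, one_mul, one_smul]

/-- Uniqueness of the normal form up to the symmetry. -/
theorem unique_of_conjugateBy (hu₁ : IsNormalForm n₁ b₁ u₁) (hu₂ : IsNormalForm n₂ b₂ u₂)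
    (hθ : IsCanonicalChange θ)
    (hconj : ConjugateBy (timeOne (hamiltonian u₁)) θ (timeOne (hamiltonian u₂))) :
    n₁ = n₂ ∧ ∃ s : ℝ, (s = 1 ∨ s = -1) ∧ linearPart θ 0 0 = s ∧
      ∀ k m, 1 ≤ k → u₂ k m = s ^ k * u₁ k m := by
  obtain ⟨ψ, hi, heq⟩ := hconj
  have hw : ∀ i, 1 ≤ wn 3 i := one_le_wn (by omega)
  have hT₁ := hu₁.tame
  have hT₂ := hu₂.tame
  have hf₂ := (filtered_timeOne hT₂).fixesOrigin hw
  set M := linearPart θ with hM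
  -- Both normal forms have the linear part `jordan`. Its commutant consists of the matrices with
  -- equal diagonal entries `s` and zero lower left entry, so the determinant is `s² > 0`: the
  -- orientation is preserved and `s = ±1`.
  have hcomm : M * jordan = jordan * M := by
    have h1 := congrArg linearPart heq
    rw [linearPart_comp (hf₂.comp hθ.1), linearPart_comp hθ.1, linearPart_timeOne_hamiltonian hu₁,
      linearPart_timeOne_hamiltonian hu₂, ← hM] at h1
    have h2 := congrArg linearPart hi.2.1
    rw [linearPart_comp hi.1, linearPart_idMap, ← hM] at h2
    calc M * jordan = M * (linearPart ψ * (jordan * M)) := congrArg (M * ·) h1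
      _ = jordan * M := by rw [← mul_assoc, h2, one_mul]
  obtain ⟨h10, h11⟩ := eq_of_commute_jordan hcomm
  have hMdet : M.det = M 0 0 * M 0 0 := by
    rw [Matrix.det_fin_two, h10, h11]; ring
  have hMne : M.det = 1 ∨ M.det = -1 := by
    rw [hM, ← constantCoeff_det_jacobian]
    rcases hθ.2 with h | h
    · left; rw [h, map_one]
    · right; rw [h, map_neg, map_one]
  have hMpos : 0 < M.det := by
    have := mul_self_nonneg (M 0 0)
    rcases hMne with h | h <;> rw [h]
    · exact one_pos
    · linarith
  have hdetJ := det_jacobian_eq_one hθ.2 hMpos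
  have hdet : poisson (θ 0) (θ 1) = 1 := by rw [← det_jacobian, hdetJ]
  obtain ⟨s, hsM⟩ : ∃ s, M 0 0 = s := ⟨_, rfl⟩
  have hs : s = 1 ∨ s = -1 := by
    have h1 : M.det = 1 := hMne.resolve_right (by linarith)
    rw [← hsM]
    exact mul_self_eq_one_iff.mp (hMdet ▸ h1)
  -- The only condition beyond fixing the origin is that `θ 1` has no linear term in `x`, which is
  -- `h10`.
  have hfil : Filtered (wn 3) θ := by
    have h0 : ∀ i, coeff (mon 0 0 0) (θ i) = 0 := by
      intro i
      have := hθ.1 i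
      rwa [← coeff_zero_eq_constantCoeff_apply, show (0 : Fin 3 →₀ ℕ) = mon 0 0 0 by simp [mon]]
        at this
    constructor
    · rw [mem_filt_wn]
      intro i j k hwt
      rw [wn_zero] at hwt
      obtain ⟨rfl, rfl, rfl⟩ : i = 0 ∧ j = 0 ∧ k = 0 := by omega
      exact h0 0
    · rw [mem_filt_wn]
      intro i j k hwt
      rw [wn_one] at hwt
      obtain ⟨hi', rfl, rfl⟩ : (i = 0 ∨ i = 1) ∧ j = 0 ∧ k = 0 := by omega
      rcases hi' with rfl | rfl
      · exact h0 1
      · rw [← linearPart_apply_zero, ← hM, h10]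
  rw [conj_timeOne hw hfil hdet hT₂ hi] at heq
  obtain ⟨c, hc, hceq⟩ := eq_add_of_timeOne_eq hT₁ (pullback_mem_filt hw hfil hT₂) heq
  -- Composing with `s` times the identity makes the linear part unipotent, at the price of
  -- replacing `u₂` by its image under the symmetry.
  set S : Matrix (Fin 2) (Fin 2) ℝ := s • 1 with hS
  have hSS : S * S = 1 := linMap_sign_mul hs
  have hS0 := fixesOrigin_linMap S
  have hθ' : FixesOrigin (comp (linMap S) θ) := hS0.comp hθ.1
  have hθθ : comp (linMap S) (comp (linMap S) θ) = θ := by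
    rw [← comp_assoc hS0 hθ.1, linMap_mul, hSS, linMap_one, idMap_comp hθ.1]
  have hceq' : hamiltonian u₁ = pullback (comp (linMap S) θ)
      (hamiltonian fun k m => s ^ k * u₂ k m) + c := by
    rw [← pullback_linMap_hamiltonian hs, pullback_pullback hS0 hθ', hθθ, hceq]
  have hdet' : poisson (comp (linMap S) θ 0) (comp (linMap S) θ 1) = 1 := by
    have h1 := det_jacobian_comp hθ.1 (linMap S)
    rw [det_jacobian_linMap, hdetJ, mul_one, pullback_C hθ.1, det_jacobian] at h1
    rw [h1, hS, Matrix.det_smul]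
    simp [sq, mul_self_of_sign hs]
  have hL' : linearPart (comp (linMap S) θ) = !![1, s * M 0 1; 0, 1] := by
    rw [linearPart_comp hθ.1, linearPart_linMap, ← hM, hS, smul_mul_assoc, one_mul]
    have := mul_self_of_sign hs
    ext i j
    fin_cases i <;> fin_cases j <;> simp [h10, h11, hsM, this]
  obtain ⟨hn, hu⟩ := unique_of_unipotent hu₁ (hu₂.symmetry hs) hc hθ' hdet' hL' hceq'
  refine ⟨hn, s, hs, hsM, fun k m hk => ?_⟩
  rw [← hu k m hk, ← mul_assoc, ← mul_pow, mul_self_of_sign hs, one_pow, one_mul]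

end FormalNF

end

noncomputable section

namespace FormalNF

open MvPowerSeries

/-! ### Taylor series of smooth families -/

section Taylor

variable {V : Set (Fin 3 → ℝ)} {f g : (Fin 3 → ℝ) → ℝ}

theorem eqOn_partialD (hV : IsOpen V) (h : Set.EqOn f g V) (i : Fin 3) :
    Set.EqOn (partialD i f) (partialD i g) V := fun p hp => by
  rw [partialD, partialD, (h.eventuallyEq_of_mem (hV.mem_nhds hp)).fderiv_eq]

theorem contDiffOn_partialD (hV : IsOpen V) (hf : ContDiffOn ℝ ∞ f V) (i : Fin 3) :
    ContDiffOn ℝ ∞ (partialD i f) V :=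
  (hf.fderiv_of_isOpen hV (m := ∞) (by simp)).clm_apply contDiffOn_const

theorem differentiableAt_of_contDiffOn (hV : IsOpen V) (hf : ContDiffOn ℝ ∞ f V)
    {p : Fin 3 → ℝ} (hp : p ∈ V) : DifferentiableAt ℝ f p :=
  ((hf.contDiffAt (hV.mem_nhds hp)).differentiableAt (by simp))

theorem contDiffOn_add (hf : ContDiffOn ℝ ∞ f V) (hg : ContDiffOn ℝ ∞ g V) :
    ContDiffOn ℝ ∞ (f + g) V := hf.add hg

theorem contDiffOn_sub (hf : ContDiffOn ℝ ∞ f V) (hg : ContDiffOn ℝ ∞ g V) :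
    ContDiffOn ℝ ∞ (f - g) V := hf.sub hg

theorem contDiffOn_mul (hf : ContDiffOn ℝ ∞ f V) (hg : ContDiffOn ℝ ∞ g V) :
    ContDiffOn ℝ ∞ (f * g) V := hf.mul hg

theorem eqOn_partialD_sub (hV : IsOpen V) (hf : ContDiffOn ℝ ∞ f V) (hg : ContDiffOn ℝ ∞ g V)
    (i : Fin 3) : Set.EqOn (partialD i (f - g)) (partialD i f - partialD i g) V := fun p hp => by
  simp only [partialD, Pi.sub_apply]
  rw [fderiv_sub (differentiableAt_of_contDiffOn hV hf hp)
    (differentiableAt_of_contDiffOn hV hg hp)]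
  rfl

theorem eqOn_partialD_mul (hV : IsOpen V) (hf : ContDiffOn ℝ ∞ f V) (hg : ContDiffOn ℝ ∞ g V)
    (i : Fin 3) :
    Set.EqOn (partialD i (f * g)) (f * partialD i g + g * partialD i f) V := fun p hp => by
  simp only [partialD, Pi.add_apply, Pi.mul_apply]
  rw [fderiv_mul (differentiableAt_of_contDiffOn hV hf hp)
    (differentiableAt_of_contDiffOn hV hg hp)]
  rfl

theorem eqOn_partialD_comm (hV : IsOpen V) (hf : ContDiffOn ℝ ∞ f V) (i j : Fin 3) :
    Set.EqOn (partialD i (partialD j f)) (partialD j (partialD i f)) V := fun p hp => by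
  have hd : DifferentiableAt ℝ (fderiv ℝ f) p :=
    ((hf.fderiv_of_isOpen hV (m := ∞) (by simp)).contDiffAt (hV.mem_nhds hp)).differentiableAt
      (by simp)
  have key : ∀ i j, partialD i (partialD j f) p =
      fderiv ℝ (fderiv ℝ f) p (Pi.single i 1) (Pi.single j 1) := by
    intro i j
    change fderiv ℝ (fun q => fderiv ℝ f q (Pi.single j 1)) p (Pi.single i 1) = _
    rw [fderiv_clm_apply hd (differentiableAt_const _)]
    simp
  rw [key, key]
  exact ((hf.contDiffAt (hV.mem_nhds hp)).isSymmSndFDerivAt (by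
    rw [minSmoothness_of_isRCLikeNormedField]
    exact WithTop.coe_le_coe.mpr (le_top : (2 : ℕ∞) ≤ ⊤))).eq _ _

theorem contDiffOn_iterate_partialD (hV : IsOpen V) (i : Fin 3) (a : ℕ)
    (hf : ContDiffOn ℝ ∞ f V) : ContDiffOn ℝ ∞ ((partialD i)^[a] f) V := by
  induction a generalizing f with
  | zero => exact hf
  | succ a ih => exact ih (contDiffOn_partialD hV hf i)

theorem eqOn_iterate_partialD (hV : IsOpen V) (i : Fin 3) (a : ℕ) (h : Set.EqOn f g V) :
    Set.EqOn ((partialD i)^[a] f) ((partialD i)^[a] g) V := by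
  induction a generalizing f g with
  | zero => exact h
  | succ a ih => exact ih (eqOn_partialD hV h i)

theorem eqOn_iterate_partialD_comm (hV : IsOpen V) (i j : Fin 3) (a : ℕ)
    (hf : ContDiffOn ℝ ∞ f V) :
    Set.EqOn (partialD j ((partialD i)^[a] f)) ((partialD i)^[a] (partialD j f)) V := by
  induction a generalizing f with
  | zero => exact fun _ _ => rfl
  | succ a ih =>
    exact (ih (contDiffOn_partialD hV hf i)).trans
      (eqOn_iterate_partialD hV i a (eqOn_partialD_comm hV hf j i))

theorem coeff_taylorSeries (g : (Fin 3 → ℝ) → ℝ) (i j k : ℕ) :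
    coeff (mon i j k) (taylorSeries g) =
      ((partialD 0)^[i] ((partialD 1)^[j] ((partialD 2)^[k] g))) 0 /
        (i.factorial * j.factorial * k.factorial : ℝ) := by
  change ((partialD 0)^[mon i j k 0] ((partialD 1)^[mon i j k 1] ((partialD 2)^[mon i j k 2] g))) 0 /
    ((mon i j k 0).factorial * (mon i j k 1).factorial * (mon i j k 2).factorial : ℝ) = _
  simp only [mon_zero, mon_one, mon_two]

theorem taylorSeries_congr (hV : IsOpen V) (h0 : 0 ∈ V) (h : Set.EqOn f g V) :
    taylorSeries f = taylorSeries g := by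
  refine ext_mon fun i j k => ?_
  rw [coeff_taylorSeries, coeff_taylorSeries, eqOn_iterate_partialD hV 0 i
    (eqOn_iterate_partialD hV 1 j (eqOn_iterate_partialD hV 2 k h)) h0]

/-- The new derivative has to be moved past the iterated ones. Partial derivatives commute only
where the function is smooth, so these identities are carried on the open set `V` and evaluated at
`0` last. -/
theorem pderiv_taylorSeries (hV : IsOpen V) (h0 : 0 ∈ V) (hf : ContDiffOn ℝ ∞ f V) (i : Fin 3) :
    pderiv ℝ i (taylorSeries f) = taylorSeries (partialD i f) := by
  have fact : ∀ m : ℕ, ((m + 1).factorial : ℝ) = (m + 1) * m.factorial := fun m => by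
    rw [Nat.factorial_succ]; push_cast; ring
  have pos : ∀ m : ℕ, (m.factorial : ℝ) ≠ 0 := fun m => by positivity
  refine ext_mon fun a b c => ?_
  have h2 := contDiffOn_iterate_partialD hV 2 c hf
  have h12 := contDiffOn_iterate_partialD hV 1 b h2
  have p0 := pos a
  have p1 := pos b
  have p2 := pos c
  rw [coeff_taylorSeries]
  fin_cases i
  · change coeff (mon a b c) (pderiv ℝ 0 (taylorSeries f)) =
      ((partialD 0)^[a] ((partialD 1)^[b] ((partialD 2)^[c] (partialD 0 f)))) 0 / _
    rw [coeff_mon_pderiv_zero, coeff_taylorSeries, fact, Function.iterate_succ_apply,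
      eqOn_iterate_partialD hV 0 a ((eqOn_iterate_partialD_comm hV 1 0 b h2).trans
        (eqOn_iterate_partialD hV 1 b (eqOn_iterate_partialD_comm hV 2 0 c hf))) h0]
    have : (a + 1 : ℝ) ≠ 0 := by positivity
    field_simp
  · change coeff (mon a b c) (pderiv ℝ 1 (taylorSeries f)) =
      ((partialD 0)^[a] ((partialD 1)^[b] ((partialD 2)^[c] (partialD 1 f)))) 0 / _
    rw [coeff_mon_pderiv_one, coeff_taylorSeries, fact, Function.iterate_succ_apply _ b,
      eqOn_iterate_partialD hV 0 a
        (eqOn_iterate_partialD hV 1 b (eqOn_iterate_partialD_comm hV 2 1 c hf)) h0]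
    have : (b + 1 : ℝ) ≠ 0 := by positivity
    field_simp
  · change coeff (mon a b c) (pderiv ℝ 2 (taylorSeries f)) =
      ((partialD 0)^[a] ((partialD 1)^[b] ((partialD 2)^[c] (partialD 2 f)))) 0 / _
    have e : mon a b c + Finsupp.single 2 1 = mon a b (c + 1) :=
      exponent_ext (by simp) (by simp) (by simp)
    rw [coeff_pderiv, e, coeff_taylorSeries, fact, Function.iterate_succ_apply _ c, mon_two]
    have : (c + 1 : ℝ) ≠ 0 := by positivity
    field_simp

theorem constantCoeff_taylorSeries (g : (Fin 3 → ℝ) → ℝ) :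
    coeff 0 (taylorSeries g) = g 0 := by
  have h0 : (0 : Fin 3 →₀ ℕ) = mon 0 0 0 := by simp [mon]
  rw [h0, coeff_taylorSeries]
  simp

/-- Induction on the exponent: the coefficients are determined by the constant term and the
derivatives. -/
theorem coeff_induction {α : Type*} (P : α → Series) (hP0 : ∀ a, coeff 0 (P a) = 0)
    (hP : ∀ a i e, (∀ a', coeff e (P a') = 0) → coeff e (pderiv ℝ i (P a)) = 0) (a : α) :
    P a = 0 := by
  have H : ∀ N (e : Fin 3 →₀ ℕ), e.degree = N → ∀ a, coeff e (P a) = 0 := by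
    intro N
    induction N with
    | zero =>
      intro e he a
      rw [(Finsupp.degree_eq_zero_iff e).mp he]
      exact hP0 a
    | succ N ih =>
      intro e he a
      obtain ⟨i, hi⟩ : ∃ i, e i ≠ 0 := by
        by_contra hne
        push Not at hne
        rw [show e = 0 from Finsupp.ext hne] at he
        simp at he
      obtain ⟨d, rfl⟩ : ∃ d, e = d + Finsupp.single i 1 :=
        ⟨e - Finsupp.single i 1, (tsub_add_cancel_of_le
          (Finsupp.single_le_iff.mpr (Nat.one_le_iff_ne_zero.mpr hi))).symm⟩
      have hd : d.degree = N := by simpa using he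
      have := hP a i d (ih d hd)
      rw [coeff_pderiv] at this
      exact (mul_eq_zero.mp this).resolve_right (by positivity)
  ext e
  rw [H _ e rfl, map_zero]

theorem taylorSeries_sub (hV : IsOpen V) (h0 : 0 ∈ V) (hf : ContDiffOn ℝ ∞ f V)
    (hg : ContDiffOn ℝ ∞ g V) : taylorSeries (f - g) = taylorSeries f - taylorSeries g := by
  rw [← sub_eq_zero]
  let S := {x : ((Fin 3 → ℝ) → ℝ) × ((Fin 3 → ℝ) → ℝ) // ContDiffOn ℝ ∞ x.1 V ∧ ContDiffOn ℝ ∞ x.2 V}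
  refine coeff_induction (α := S) (fun x => taylorSeries (x.1.1 - x.1.2) -
    (taylorSeries x.1.1 - taylorSeries x.1.2)) ?_ ?_ ⟨(f, g), hf, hg⟩
  · rintro ⟨⟨f, g⟩, hf, hg⟩
    simp only [map_sub, constantCoeff_taylorSeries, Pi.sub_apply, sub_self]
  · rintro ⟨⟨f, g⟩, hf, hg⟩ i e ih
    replace hf : ContDiffOn ℝ ∞ f V := hf
    replace hg : ContDiffOn ℝ ∞ g V := hg
    have := ih ⟨(partialD i f, partialD i g), contDiffOn_partialD hV hf i,
      contDiffOn_partialD hV hg i⟩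
    change coeff e (pderiv ℝ i (taylorSeries (f - g) - (taylorSeries f - taylorSeries g))) = 0
    rw [map_sub, map_sub (pderiv ℝ i), pderiv_taylorSeries hV h0 hf, pderiv_taylorSeries hV h0 hg,
      pderiv_taylorSeries hV h0 (contDiffOn_sub hf hg), taylorSeries_congr hV h0 (eqOn_partialD_sub hV hf hg i)]
    exact this

theorem taylorSeries_add (hV : IsOpen V) (h0 : 0 ∈ V) (hf : ContDiffOn ℝ ∞ f V)
    (hg : ContDiffOn ℝ ∞ g V) : taylorSeries (f + g) = taylorSeries f + taylorSeries g := by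
  have := taylorSeries_sub hV h0 (contDiffOn_add hf hg) hg
  rw [show f + g - g = f from add_sub_cancel_right f g] at this
  rw [this]
  ring

/-- The induction runs over all pairs of smooth functions at once: by the product rule, the
derivative of the defect for `(f, g)` is a sum of defects for other pairs. -/
theorem taylorSeries_mul (hV : IsOpen V) (h0 : 0 ∈ V) (hf : ContDiffOn ℝ ∞ f V)
    (hg : ContDiffOn ℝ ∞ g V) : taylorSeries (f * g) = taylorSeries f * taylorSeries g := by
  rw [← sub_eq_zero]
  let S := {x : ((Fin 3 → ℝ) → ℝ) × ((Fin 3 → ℝ) → ℝ) // ContDiffOn ℝ ∞ x.1 V ∧ ContDiffOn ℝ ∞ x.2 V}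
  refine coeff_induction (α := S) (fun x => taylorSeries (x.1.1 * x.1.2) -
    taylorSeries x.1.1 * taylorSeries x.1.2) ?_ ?_ ⟨(f, g), hf, hg⟩
  · rintro ⟨⟨f, g⟩, hf, hg⟩
    have h1 : coeff 0 (taylorSeries f * taylorSeries g) = f 0 * g 0 := by
      rw [← constantCoeff_taylorSeries f, ← constantCoeff_taylorSeries g,
        coeff_zero_eq_constantCoeff_apply, map_mul]
      rfl
    change coeff 0 (taylorSeries (f * g) - taylorSeries f * taylorSeries g) = 0
    rw [map_sub, h1, constantCoeff_taylorSeries, Pi.mul_apply, sub_self]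
  · rintro ⟨⟨f, g⟩, hf, hg⟩ i e ih
    replace hf : ContDiffOn ℝ ∞ f V := hf
    replace hg : ContDiffOn ℝ ∞ g V := hg
    have df := contDiffOn_partialD hV hf i
    have dg := contDiffOn_partialD hV hg i
    have h1 := ih ⟨(f, partialD i g), hf, dg⟩
    have h2 := ih ⟨(g, partialD i f), hg, df⟩
    have e : pderiv ℝ i (taylorSeries (f * g) - taylorSeries f * taylorSeries g) =
        (taylorSeries (f * partialD i g) - taylorSeries f * taylorSeries (partialD i g)) +
        (taylorSeries (g * partialD i f) - taylorSeries g * taylorSeries (partialD i f)) := by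
      rw [map_sub, pderiv_mul, pderiv_taylorSeries hV h0 hf, pderiv_taylorSeries hV h0 hg,
        pderiv_taylorSeries hV h0 (contDiffOn_mul hf hg),
        taylorSeries_congr hV h0 (eqOn_partialD_mul hV hf hg i),
        taylorSeries_add hV h0 (contDiffOn_mul hf dg) (contDiffOn_mul hg df)]
      ring
    refine (congrArg (coeff _) e).trans ?_
    rw [map_add]
    exact (congrArg₂ (· + ·) h1 h2).trans (add_zero 0)

theorem taylorSeries_const (a : ℝ) : taylorSeries (fun _ => a) = C a := by
  have hc : ∀ a : ℝ, ContDiffOn ℝ ∞ (fun _ : Fin 3 → ℝ => a) Set.univ := fun a => contDiffOn_const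
  rw [← sub_eq_zero]
  refine coeff_induction (α := ℝ) (fun a => taylorSeries (fun _ => a) - C a) (fun a => ?_)
    (fun a i e ih => ?_) a
  · rw [map_sub, constantCoeff_taylorSeries, coeff_zero_C, sub_self]
  · have hD : partialD i (fun _ : Fin 3 → ℝ => a) = fun _ => 0 := by
      funext p
      simp [partialD]
    have := ih 0
    rw [map_zero, sub_zero] at this
    rw [map_sub, pderiv_taylorSeries isOpen_univ (Set.mem_univ _) (hc a), hD, pderiv_C, sub_zero,
      this]

/-- The Taylor series of a smooth family of area-preserving maps is area-preserving. -/
theorem areaPreserving_of_isTaylorOfSmooth {F : FormalMap} (hF : IsTaylorOfSmooth F) :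
    AreaPreserving F := by
  obtain ⟨f, V, hV, h0, hf, hdet, rfl⟩ := hF
  have hd : ∀ i j, ContDiffOn ℝ ∞ (partialD j (f i)) V := fun i j => contDiffOn_partialD hV (hf i) j
  set D : (Fin 3 → ℝ) → ℝ :=
    partialD 0 (f 0) * partialD 1 (f 1) - partialD 1 (f 0) * partialD 0 (f 1) with hD
  have hDs : ContDiffOn ℝ ∞ D V := contDiffOn_sub (contDiffOn_mul (hd 0 0) (hd 1 1)) (contDiffOn_mul (hd 0 1) (hd 1 0))
  have hjac : (jacobian fun i => taylorSeries (f i)).det = taylorSeries D := by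
    rw [det_jacobian, poisson, pderiv_taylorSeries hV h0 (hf 0), pderiv_taylorSeries hV h0 (hf 0),
      pderiv_taylorSeries hV h0 (hf 1), pderiv_taylorSeries hV h0 (hf 1), hD,
      taylorSeries_sub hV h0 (contDiffOn_mul (hd 0 0) (hd 1 1))
        (contDiffOn_mul (hd 0 1) (hd 1 0)),
      taylorSeries_mul hV h0 (hd 0 0) (hd 1 1), taylorSeries_mul hV h0 (hd 0 1) (hd 1 0)]
  -- The sign of the determinant need not be constant on `V`, but its square is `1`. The sign is
  -- chosen only for the series, in a ring without zero divisors.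
  have hsq : Set.EqOn (D * D) (fun _ => 1) V := fun p hp => by
    have h1 := hdet p hp
    rw [Matrix.det_fin_two] at h1
    change D p * D p = 1
    rw [← abs_mul_abs_self (D p)]
    have : |D p| = 1 := h1
    rw [this, one_mul]
  have h2 : taylorSeries D * taylorSeries D = 1 := by
    rw [← taylorSeries_mul hV h0 hDs hDs, taylorSeries_congr hV h0 hsq, taylorSeries_const, map_one]
  unfold AreaPreserving
  rw [hjac]
  exact mul_self_eq_one_iff.mp h2

end Taylor

theorem IsParabolicFamily.areaPreserving' {F : FormalMap} (hF : IsParabolicFamily F) :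
    AreaPreserving F :=
  hF.areaPreserving.elim id areaPreserving_of_isTaylorOfSmooth

/-! ### Complete invariants -/

variable {n₁ n₂ : ℕ} {b₁ b₂ : ℝ} {F G φ₁ φ₂ θ : FormalMap} {u₁ u₂ : ℕ → ℕ → ℝ}

theorem fixesOrigin_timeOne_hamiltonian {n : ℕ} {b : ℝ} {u : ℕ → ℕ → ℝ} (hu : IsNormalForm n b u) :
    FixesOrigin (timeOne (hamiltonian u)) :=
  (filtered_timeOne hu.tame).fixesOrigin (one_le_wn (by omega))

/-- If `φ₁` brings `F` to the normal form `u₁`, then the normal form is conjugate to `F` by the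
inverse of `φ₁`. -/
theorem Normalises.symm (hu₁ : IsNormalForm n₁ b₁ u₁) (h₁ : Normalises φ₁ F u₁) :
    ∃ ψ, IsInverse φ₁ ψ ∧ ConjugateBy (timeOne (hamiltonian u₁)) ψ F := by
  obtain ⟨hφ, ψ, hi, heq⟩ := h₁
  exact ⟨ψ, hi, φ₁, hi.symm hφ.1,
    ConjugateBy.symm hφ.1 (fixesOrigin_timeOne_hamiltonian hu₁) hi heq⟩

/-- The change `φ₂ ∘ φ₁⁻¹` conjugates the two normal forms. If the linear parts agree, its linear
part is the identity and the sign is `1`. -/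
theorem unique_of_normalises (hu₁ : IsNormalForm n₁ b₁ u₁) (h₁ : Normalises φ₁ F u₁)
    (hu₂ : IsNormalForm n₂ b₂ u₂) (h₂ : Normalises φ₂ F u₂) :
    n₁ = n₂ ∧ (∃ s : ℝ, (s = 1 ∨ s = -1) ∧ ∀ k m, 1 ≤ k → u₂ k m = s ^ k * u₁ k m) ∧
      (linearPart φ₁ = linearPart φ₂ → ∀ k m, 1 ≤ k → u₂ k m = u₁ k m) := by
  obtain ⟨ψ, hi, hψ⟩ := h₁.symm hu₁
  have hcan := h₂.1.comp (h₁.1.inverse hi)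
  obtain ⟨hn, s, hs, hL, hu⟩ := unique_of_conjugateBy hu₁ hu₂ hcan
    (ConjugateBy.trans hi.1 h₂.1.1 (fixesOrigin_timeOne_hamiltonian hu₂) hψ h₂.2)
  refine ⟨hn, ⟨s, hs, hu⟩, fun hlin k m hk => ?_⟩
  have h1 : linearPart (comp φ₂ ψ) = 1 := by
    rw [linearPart_comp hi.1, ← hlin, ← linearPart_comp hi.1, hi.2.1, linearPart_idMap]
  rw [h1] at hL
  rw [hu k m hk, ← hL]
  simp

theorem timeOne_hamiltonian_congr (h : ∀ k m, 1 ≤ k → u₂ k m = u₁ k m) :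
    timeOne (hamiltonian u₂) = timeOne (hamiltonian u₁) := by
  have hc : EpsOnly (hamiltonian u₂ - hamiltonian u₁) := by
    intro i j k hij
    rw [map_sub]
    rcases j with _ | j
    · rw [coeff_hamiltonian_zero, coeff_hamiltonian_zero, h i k (by omega), sub_self]
    · rw [coeff_hamiltonian_succ, coeff_hamiltonian_succ, sub_self]
  have := hc.timeOne_add (hamiltonian u₁)
  rwa [add_sub_cancel] at this

theorem conjugateBy_symmetry (hu₁ : IsNormalForm n₁ b₁ u₁) {s : ℝ} (hs : s = 1 ∨ s = -1)
    (h : ∀ k m, 1 ≤ k → u₂ k m = s ^ k * u₁ k m) :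
    ConjugateBy (timeOne (hamiltonian u₁)) (linMap (s • 1)) (timeOne (hamiltonian u₂)) := by
  have hi := isInverse_linMap (linMap_sign_mul hs)
  have hT := (hu₁.symmetry hs).tame
  have hfil : Filtered (wn 3) (linMap (s • 1)) := by
    constructor
    · simpa [linMap] using smul_mem_filt s (X_mem_filt (wn 3) 0)
    · simpa [linMap] using smul_mem_filt s (X_mem_filt (wn 3) 1)
  have hdet : poisson (linMap (s • 1) 0) (linMap (s • 1) 1) = 1 := by
    rw [← det_jacobian, det_jacobian_linMap, Matrix.det_smul]
    simp [sq, mul_self_of_sign hs]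
  refine ⟨_, hi, ?_⟩
  rw [timeOne_hamiltonian_congr (u₁ := fun k m => s ^ k * u₁ k m) h,
    conj_timeOne (one_le_wn (by omega)) hfil hdet hT hi,
    pullback_linMap_hamiltonian hs]
  congr 2
  funext k m
  rw [← mul_assoc, ← mul_pow, mul_self_of_sign hs, one_pow, one_mul]

/-- The change is `φ₂⁻¹ ∘ (s · id) ∘ φ₁`. The relation between the linear parts serves to get
`Dθ_0(0) = 1` when `s = 1` and the linear parts of `φ₁` and `φ₂` agree. -/
theorem conjugate_of_invariants (hu₁ : IsNormalForm n₁ b₁ u₁) (h₁ : Normalises φ₁ F u₁)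
    (hu₂ : IsNormalForm n₂ b₂ u₂) (h₂ : Normalises φ₂ G u₂) (hG : FixesOrigin G) {s : ℝ}
    (hs : s = 1 ∨ s = -1) (h : ∀ k m, 1 ≤ k → u₂ k m = s ^ k * u₁ k m) :
    ∃ θ, IsCanonicalChange θ ∧ ConjugateBy F θ G ∧
      linearPart φ₂ * linearPart θ = (s • 1) * linearPart φ₁ := by
  obtain ⟨ψ, hi, hψ⟩ := h₂.symm hu₂
  have hS0 := fixesOrigin_linMap (s • 1)
  have hS : IsCanonicalChange (linMap (s • 1)) := isCanonicalChange_linMap (Or.inl (by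
    rw [Matrix.det_smul]; simp [sq, mul_self_of_sign hs]))
  have h3 := ConjugateBy.trans h₁.1.1 hS0 (fixesOrigin_timeOne_hamiltonian hu₂) h₁.2
    (conjugateBy_symmetry hu₁ hs h)
  have h0 := hS0.comp h₁.1.1
  refine ⟨comp ψ (comp (linMap (s • 1)) φ₁), (h₂.1.inverse hi).comp (hS.comp h₁.1),
    ConjugateBy.trans h0 hi.1 hG h3 hψ, ?_⟩
  rw [linearPart_comp h0, ← mul_assoc, ← linearPart_comp hi.1, hi.2.1, linearPart_idMap, one_mul,
    linearPart_comp h₁.1.1, linearPart_linMap]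

theorem normalises_comp (hu₂ : IsNormalForm n₂ b₂ u₂) (h₂ : Normalises φ₂ G u₂)
    (hθ : IsCanonicalChange θ) (hc : ConjugateBy F θ G) : Normalises (comp φ₂ θ) F u₂ :=
  ⟨h₂.1.comp hθ, ConjugateBy.trans hθ.1 h₂.1.1 (fixesOrigin_timeOne_hamiltonian hu₂) hc h₂.2⟩

/-- If `θ` conjugates `F` to `G`, then `φ₂ ∘ θ` brings `F` to the form of `G`, and uniqueness for
`F` applies. -/
theorem complete_invariants (hu₁ : IsNormalForm n₁ b₁ u₁) (h₁ : Normalises φ₁ F u₁)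
    (hu₂ : IsNormalForm n₂ b₂ u₂) (h₂ : Normalises φ₂ G u₂) (hG : FixesOrigin G) :
    ((∃ θ, IsCanonicalChange θ ∧ ConjugateBy F θ G) ↔
        ∃ s : ℝ, (s = 1 ∨ s = -1) ∧ ∀ k m, 1 ≤ k → u₂ k m = s ^ k * u₁ k m) ∧
      (linearPart φ₁ = linearPart φ₂ →
        ((∃ θ, IsCanonicalChange θ ∧ linearPart θ = 1 ∧ ConjugateBy F θ G) ↔
          ∀ k m, 1 ≤ k → u₂ k m = u₁ k m)) := by
  refine ⟨⟨?_, ?_⟩, fun hlin => ⟨?_, fun h => ?_⟩⟩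
  · rintro ⟨θ, hθ, hc⟩
    exact (unique_of_normalises hu₁ h₁ hu₂ (normalises_comp hu₂ h₂ hθ hc)).2.1
  · rintro ⟨s, hs, h⟩
    obtain ⟨θ, hθ, hc, -⟩ := conjugate_of_invariants hu₁ h₁ hu₂ h₂ hG hs h
    exact ⟨θ, hθ, hc⟩
  · rintro ⟨θ, hθ, hL, hc⟩
    refine (unique_of_normalises hu₁ h₁ hu₂ (normalises_comp hu₂ h₂ hθ hc)).2.2 ?_
    rw [linearPart_comp hθ.1, hL, mul_one, hlin]
  · obtain ⟨θ, hθ, hc, hL⟩ := conjugate_of_invariants hu₁ h₁ hu₂ h₂ hG (Or.inl rfl)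
      (s := 1) (fun k m hk => by rw [one_pow, one_mul, h k m hk])
    refine ⟨θ, hθ, ?_, hc⟩
    obtain ⟨-, ψ, hi, -⟩ := h₂
    have h3 : linearPart ψ * linearPart φ₂ = 1 := by
      rw [mul_eq_one_comm, ← linearPart_comp hi.1, hi.2.1, linearPart_idMap]
    rw [one_smul, one_mul, hlin] at hL
    calc linearPart θ = linearPart ψ * (linearPart φ₂ * linearPart θ) := by
          rw [← mul_assoc, h3, one_mul]
      _ = 1 := by rw [hL, h3]

end FormalNF

end

open FormalNF
theorem theorem2 (F : FormalMap) (hF : IsParabolicFamily F) :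
    -- a Hamiltonian of the simplified form exists
    (∃ φ₀ u₀, IsSimplified u₀ ∧ Normalises φ₀ F u₀) ∧
    -- in the non-degenerate case any such Hamiltonian can be simplified further
    (∀ (n : ℕ) (b : ℝ) (φ₀ : FormalMap) (u₀ : ℕ → ℕ → ℝ),
      IsSimplified u₀ → Normalises φ₀ F u₀ →
      3 ≤ n → (∀ k < n, u₀ k 0 = 0) → u₀ n 0 = b → b ≠ 0 →
      ∃ (θ φ : FormalMap) (u : ℕ → ℕ → ℝ),
        IsNormalForm n b u ∧
        IsCanonicalChange θ ∧ linearPart θ = 1 ∧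
        pullback θ (hamiltonian u₀) =
          hamiltonian u + MvPowerSeries.C (u₀ 0 1) * MvPowerSeries.X 2 ∧
        comp θ φ = φ₀ ∧ Normalises φ F u) ∧
    -- uniqueness of the normal form
    (∀ (n₁ n₂ : ℕ) (b₁ b₂ : ℝ) (φ₁ φ₂ : FormalMap) (u₁ u₂ : ℕ → ℕ → ℝ),
      IsNormalForm n₁ b₁ u₁ → Normalises φ₁ F u₁ →
      IsNormalForm n₂ b₂ u₂ → Normalises φ₂ F u₂ →
      n₁ = n₂ ∧
      (∃ s : ℝ, (s = 1 ∨ s = -1) ∧ ∀ k m, 1 ≤ k → u₂ k m = s ^ k * u₁ k m) ∧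
      (linearPart φ₁ = linearPart φ₂ → ∀ k m, 1 ≤ k → u₂ k m = u₁ k m)) ∧
    -- the coefficients form a complete set of formal invariants
    (∀ (G : FormalMap), IsParabolicFamily G →
      ∀ (n₁ n₂ : ℕ) (b₁ b₂ : ℝ) (φ₁ φ₂ : FormalMap) (u₁ u₂ : ℕ → ℕ → ℝ),
      IsNormalForm n₁ b₁ u₁ → Normalises φ₁ F u₁ →
      IsNormalForm n₂ b₂ u₂ → Normalises φ₂ G u₂ →
      ((∃ θ, IsCanonicalChange θ ∧ ConjugateBy F θ G) ↔
        ∃ s : ℝ, (s = 1 ∨ s = -1) ∧ ∀ k m, 1 ≤ k → u₂ k m = s ^ k * u₁ k m) ∧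
      (linearPart φ₁ = linearPart φ₂ →
        ((∃ θ, IsCanonicalChange θ ∧ linearPart θ = 1 ∧ ConjugateBy F θ G) ↔
          ∀ k m, 1 ≤ k → u₂ k m = u₁ k m))) := by
  refine ⟨exists_simplified hF.areaPreserving' hF.fixesOrigin hF.eigenvalue hF.not_diagonalisable,
    ?_, ?_, ?_⟩
  · intro n b φ₀ u₀ _ hN hn hlow hlead hb
    exact exists_normalForm hn hN hlow hlead hb
  · intro n₁ n₂ b₁ b₂ φ₁ φ₂ u₁ u₂ hu₁ h₁ hu₂ h₂
    exact unique_of_normalises hu₁ h₁ hu₂ h₂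
  · intro G hG n₁ n₂ b₁ b₂ φ₁ φ₂ u₁ u₂ hu₁ h₁ hu₂ h₂
    exact complete_invariants hu₁ h₁ hu₂ h₂ hG.fixesOrigin
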